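/- Let $d\ge 2$ and let $\Omega\subset\mathbb R^d$ be a non-empty bounded open set with smooth boundary satisfying a uniform interior ball condition. Let $q>d$ and $1<r\le q$, and write $s'=s/(s-1)$ for $s>1$. For $(a,b)\in\mathbb R\times\mathbb R^d$ let $\ell_r(a,b)=\frac1r\frac{|b|^r}{a^{r-1}}$ if $a>0$, $\ell_r(0,0)=0$, and $\ell_r(a,b)=+\infty$ otherwise, and for $(m,w)\in W^{1,q}(\Omega)\times L^q(\Omega)^d$ let $\mathcal L_r(m,w)=\int_\Omega \ell_r(m(x),w(x))\,dx$. The subdifferential $\partial\mathcal L_r(m,w)$ at a point where $\mathcal L_r$ is finite is the set of $(\alpha,\beta)\in (W^{1,q}(\Omega))^*\times L^{q'}(\Omega)^d$ such that $$\mathcal L_r(m,w)+\langle\alpha,\tilde m-m\rangle+\int_\Omega\beta\cdot(\tilde w-w)\,dx\le\mathcal L_r(\tilde m,\tilde w)\qquad\text{for all }(\tilde m,\tilde w)\in W^{1,q}(\Omega)\times L^q(\Omega)^d .$$ Let $\mathcal A_{r'}$ be the set of $(a,b)\in L^\infty(\Omega)\times L^\infty(\Omega)^d$ with $a+\frac1{r'}|b|^{r'}\le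 0$ a.e. in $\Omega$, and let $\overline{\mathcal A_{r'}}$ be its closure in $(W^{1,q}(\Omega))^*\times L^{q'}(\Omega)^d$, where $a$ acts on $W^{1,q}(\Omega)$ by $\varphi\mapsto\int_\Omega a\varphi\,dx$. Since $q>d$, every element of $W^{1,q}(\Omega)$ has a unique representative that is continuous on $\overline\Omega$, and we identify it with this representative; a finite signed Borel measure $\alpha$ on $\overline\Omega$ is identified with the functional $\varphi\mapsto\int_{\overline\Omega}\varphi\,d\alpha$ on $W^{1,q}(\Omega)$. Let $(m,w)\in W^{1,q}(\Omega)\times L^q(\Omega)^d$ with $\mathcal L_r(m,w)<\infty$, put $E_0=\{x\in\overline\Omega: m(x)=0\}$ and $E_1=\{x\in\overline\Omega: m(x)>0\}$, and let $v=(w/m)\mathbb 1_{E_1}$. If $v\notin L^r(\Omega)^d$, then $\partial\mathcal L_r(m,w)=\emptyset$. If $v\in L^r(\Omega)^d$, then $\partial\mathcal L_r(m,w)$ is non-empty, and it is the set of all $(\alpha,\beta)\in\overline{\mathcal A_{r'}}$ such that $\alpha$ is a finite signed Borel measure on $\overline\Omega$ whose restriction to $E_1$ is absolutely continuous with respect to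 Lebesgue measure with density $-\frac1{r'}|v|^r$ (in particular it does not charge $E_1\cap\partial\Omega$), and $\beta=|v|^{r-2}v$ a.e. on $E_1\cap\Omega$ (where $|v|^{r-2}v=0$ if $v=0$). In particular, for every $(\alpha,\beta)\in\partial\mathcal L_r(m,w)$, the part of $\alpha$ that is singular with respect to Lebesgue measure is concentrated on $E_0$. -/

import Mathlib

open MeasureTheory Set Topology
open scoped ENNReal ContDiff

noncomputable section

/-- `1 ≤ q` as an extended exponent, for a real exponent `q > 1`. -/
instance factOneLeOfReal (q : ℝ) [h : Fact (1 < q)] : Fact (1 ≤ ENNReal.ofReal q) :=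
  ⟨by simpa using ENNReal.ofReal_le_ofReal h.out.le⟩

/-- `1 ≤ q'` as an extended exponent, where `q' = q / (q - 1)` and `q > 1`. -/
instance factOneLeOfRealConj (q : ℝ) [h : Fact (1 < q)] :
    Fact (1 ≤ ENNReal.ofReal q.conjExponent) :=
  ⟨by
    have h1 : 1 < q.conjExponent := (Real.HolderConjugate.conjExponent h.out).symm.lt
    simpa using ENNReal.ofReal_le_ofReal h1.le⟩

/-- Euclidean space `ℝ^d`. -/
abbrev Eucl (d : ℕ) : Type := EuclideanSpace ℝ (Fin d)

variable {d : ℕ}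

/-- The boundary of `Ω` is smooth: near each boundary point, `Ω` is the region where a smooth
function with non-vanishing differential at that point is negative. -/
def HasSmoothBoundary (Ω : Set (Eucl d)) : Prop :=
  ∀ x ∈ frontier Ω, ∃ ρ : Eucl d → ℝ, ContDiff ℝ ∞ ρ ∧ fderiv ℝ ρ x ≠ 0 ∧
    ∃ U ∈ 𝓝 x, ∀ y ∈ U, (y ∈ Ω ↔ ρ y < 0)

/-- Uniform interior ball condition: there is one radius `R > 0` such that each boundary point
lies on the boundary of a ball of radius `R` contained in `Ω`. -/
def UniformInteriorBall (Ω : Set (Eucl d)) : Prop :=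
  ∃ R : ℝ, 0 < R ∧ ∀ x ∈ frontier Ω, ∃ c : Eucl d, dist x c = R ∧ Metric.ball c R ⊆ Ω

/-- The scalar space `L^p(Ω)` for a real exponent `p`. -/
abbrev LpS (Ω : Set (Eucl d)) (p : ℝ) := Lp ℝ (ENNReal.ofReal p) (volume.restrict Ω)

/-- The space of vector fields `L^p(Ω)^d` for a real exponent `p`. -/
abbrev LpV (Ω : Set (Eucl d)) (p : ℝ) := Lp (Eucl d) (ENNReal.ofReal p) (volume.restrict Ω)

/-- `g` is the weak gradient of `u` on `Ω`, tested against `φ ∈ C_c^∞(Ω)`. -/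
def IsWeakGradient (Ω : Set (Eucl d)) (u : Eucl d → ℝ) (g : Eucl d → Eucl d) : Prop :=
  ∀ φ : Eucl d → ℝ, ContDiff ℝ ∞ φ → HasCompactSupport φ → tsupport φ ⊆ Ω →
    ∀ e : Eucl d, ∫ x in Ω, fderiv ℝ φ x e * u x = - ∫ x in Ω, φ x * inner ℝ e (g x)

theorem integrable_fderiv_mul (Ω : Set (Eucl d)) (q : ℝ) [Fact (1 < q)] (u : LpS Ω q)
    {φ : Eucl d → ℝ} (hφ : ContDiff ℝ ∞ φ) (hc : HasCompactSupport φ) (e : Eucl d) :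
    Integrable (fun x => fderiv ℝ φ x e * u x) (volume.restrict Ω) := by
  have hu : LocallyIntegrable u (volume.restrict Ω) :=
    (Lp.memLp u).locallyIntegrable (Fact.out : 1 ≤ ENNReal.ofReal q)
  have h1 : Continuous fun x => fderiv ℝ φ x e :=
    (hφ.continuous_fderiv (by simp)).clm_apply continuous_const
  exact hu.integrable_smul_left_of_hasCompactSupport h1 (hc.fderiv_apply (𝕜 := ℝ) e)

theorem integrable_mul_inner (Ω : Set (Eucl d)) (q : ℝ) [Fact (1 < q)] (g : LpV Ω q)
    {φ : Eucl d → ℝ} (hφ : ContDiff ℝ ∞ φ) (hc : HasCompactSupport φ) (e : Eucl d) :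
    Integrable (fun x => φ x * inner ℝ e (g x)) (volume.restrict Ω) := by
  have hg : LocallyIntegrable g (volume.restrict Ω) :=
    (Lp.memLp g).locallyIntegrable (Fact.out : 1 ≤ ENNReal.ofReal q)
  have h := (hg.integrable_smul_left_of_hasCompactSupport hφ.continuous hc).const_inner (𝕜 := ℝ) e
  refine h.congr (Filter.Eventually.of_forall fun x => ?_)
  simp [inner_smul_right]

/-- The Sobolev space `W^{1,q}(Ω)`, as the space of pairs `(u, ∇u)` in `L^q(Ω) × L^q(Ω)^d`.
The gradient is determined by `u`, and the induced norm `max ‖u‖ ‖∇u‖` is equivalent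
to the usual Sobolev norm. -/
def sobolevSubmodule (Ω : Set (Eucl d)) (q : ℝ) [Fact (1 < q)] :
    Submodule ℝ (LpS Ω q × LpV Ω q) where
  carrier := {p | IsWeakGradient Ω p.1 p.2}
  zero_mem' := by
    intro φ _ _ _ e
    have h1 : ∀ᵐ x ∂volume.restrict Ω, fderiv ℝ φ x e * (0 : LpS Ω q) x = 0 := by
      filter_upwards [Lp.coeFn_zero ℝ (ENNReal.ofReal q) (volume.restrict Ω)] with x hx
      rw [hx]
      simp
    have h2 : ∀ᵐ x ∂volume.restrict Ω, φ x * inner ℝ e ((0 : LpV Ω q) x) = 0 := by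
      filter_upwards [Lp.coeFn_zero (Eucl d) (ENNReal.ofReal q) (volume.restrict Ω)] with x hx
      rw [hx]
      simp
    simp only [Prod.fst_zero, Prod.snd_zero]
    rw [integral_eq_zero_of_ae h1, integral_eq_zero_of_ae h2, neg_zero]
  add_mem' := by
    intro a b ha hb φ hφ hc hs e
    have h1 : ∀ᵐ x ∂volume.restrict Ω, fderiv ℝ φ x e * (a + b).1 x
        = fderiv ℝ φ x e * a.1 x + fderiv ℝ φ x e * b.1 x := by
      filter_upwards [Lp.coeFn_add a.1 b.1] with x hx
      simp only [Prod.fst_add, hx, Pi.add_apply, mul_add]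
    have h2 : ∀ᵐ x ∂volume.restrict Ω, φ x * inner ℝ e ((a + b).2 x)
        = φ x * inner ℝ e (a.2 x) + φ x * inner ℝ e (b.2 x) := by
      filter_upwards [Lp.coeFn_add a.2 b.2] with x hx
      simp only [Prod.snd_add, hx, Pi.add_apply, inner_add_right, mul_add]
    rw [integral_congr_ae h1, integral_congr_ae h2,
      integral_add (integrable_fderiv_mul Ω q a.1 hφ hc e)
        (integrable_fderiv_mul Ω q b.1 hφ hc e),
      integral_add (integrable_mul_inner Ω q a.2 hφ hc e)
        (integrable_mul_inner Ω q b.2 hφ hc e),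
      ha φ hφ hc hs e, hb φ hφ hc hs e]
    ring
  smul_mem' := by
    intro c a ha φ hφ hc hs e
    have h1 : ∀ᵐ x ∂volume.restrict Ω, fderiv ℝ φ x e * (c • a).1 x
        = c * (fderiv ℝ φ x e * a.1 x) := by
      filter_upwards [Lp.coeFn_smul c a.1] with x hx
      simp only [Prod.smul_fst, hx, Pi.smul_apply, smul_eq_mul]
      ring
    have h2 : ∀ᵐ x ∂volume.restrict Ω, φ x * inner ℝ e ((c • a).2 x)
        = c * (φ x * inner ℝ e (a.2 x)) := by
      filter_upwards [Lp.coeFn_smul c a.2] with x hx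
      simp only [Prod.smul_snd, hx, Pi.smul_apply, inner_smul_right]
      ring
    rw [integral_congr_ae h1, integral_congr_ae h2, integral_const_mul, integral_const_mul,
      ha φ hφ hc hs e]
    ring

/-- The Sobolev space `W^{1,q}(Ω)`, a normed space. -/
abbrev Sobolev (Ω : Set (Eucl d)) (q : ℝ) [Fact (1 < q)] : Type := ↥(sobolevSubmodule Ω q)

/-- The underlying function, an element of `L^q(Ω)`, of an element of `W^{1,q}(Ω)`. -/
abbrev Sobolev.fn {Ω : Set (Eucl d)} {q : ℝ} [Fact (1 < q)] (m : Sobolev Ω q) : LpS Ω q :=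
  (m : LpS Ω q × LpV Ω q).1

/-- The space `(W^{1,q}(Ω))^* × L^{q'}(Ω)^d`, the dual of `W^{1,q}(Ω) × L^q(Ω)^d`, with its
norm topology. -/
abbrev DualPair (Ω : Set (Eucl d)) (q : ℝ) [Fact (1 < q)] : Type :=
  StrongDual ℝ (Sobolev Ω q) × LpV Ω q.conjExponent

/-- `f` is the continuous representative of `m` on the closure of `Ω`; for `Ω` open its values
on the closure are determined by `m`. -/
def IsContRep {Ω : Set (Eucl d)} {q : ℝ} [Fact (1 < q)] (m : Sobolev Ω q)
    (f : Eucl d → ℝ) : Prop :=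
  ContinuousOn f (closure Ω) ∧ m.fn =ᵐ[volume.restrict Ω] f

/-- The function `ℓ_r(a, b)`, equal to `|b|^r / (r a^(r-1))` for `a > 0`, to `0` at `(0, 0)`,
and to `+∞` elsewhere. -/
def ell (r a : ℝ) (b : Eucl d) : ℝ≥0∞ :=
  open Classical in
  if 0 < a then ENNReal.ofReal (1 / r * (‖b‖ ^ r / a ^ (r - 1)))
  else if a = 0 ∧ b = 0 then 0 else ⊤

/-- The functional `𝓛_r(m, w) = ∫_Ω ℓ_r(m, w) dx`. -/
def energy {Ω : Set (Eucl d)} {q : ℝ} [Fact (1 < q)] (r : ℝ) (m : Sobolev Ω q)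
    (w : LpV Ω q) : ℝ≥0∞ :=
  ∫⁻ x in Ω, ell r (m.fn x) (w x)

/-- The duality product `⟨α, m⟩ + ∫_Ω β · w dx`. -/
def pairing {Ω : Set (Eucl d)} {q : ℝ} [Fact (1 < q)] (p : DualPair Ω q) (m : Sobolev Ω q)
    (w : LpV Ω q) : ℝ :=
  p.1 m + ∫ x in Ω, inner ℝ (p.2 x) (w x)

/-- The convex subdifferential `∂𝓛_r(m, w)`, a subset of `(W^{1,q}(Ω))^* × L^{q'}(Ω)^d`. -/
def subdifferential {Ω : Set (Eucl d)} {q : ℝ} [Fact (1 < q)] (r : ℝ) (m : Sobolev Ω q)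
    (w : LpV Ω q) : Set (DualPair Ω q) :=
  {p | energy r m w < ⊤ ∧ ∀ (m' : Sobolev Ω q) (w' : LpV Ω q),
    (energy r m w : EReal) + ((pairing p (m' - m) (w' - w) : ℝ) : EReal) ≤ energy r m' w'}

/-- For an exponent `s`, the set `𝓐_s` of pairs of bounded functions `(a, b)` on `Ω` such that
`a + |b|^s / s ≤ 0` almost everywhere, seen in `(W^{1,q}(Ω))^* × L^{q'}(Ω)^d` (the function `a`
acts by `φ ↦ ∫_Ω a φ dx`). -/
def setA (Ω : Set (Eucl d)) (q : ℝ) [Fact (1 < q)] (s : ℝ) : Set (DualPair Ω q) :=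
  {p | ∃ (a : Eucl d → ℝ) (b : Eucl d → Eucl d),
    MemLp a ⊤ (volume.restrict Ω) ∧ MemLp b ⊤ (volume.restrict Ω) ∧
    (∀ᵐ x ∂volume.restrict Ω, a x + 1 / s * ‖b x‖ ^ s ≤ 0) ∧
    (∀ φ : Sobolev Ω q, p.1 φ = ∫ x in Ω, a x * φ.fn x) ∧
    p.2 =ᵐ[volume.restrict Ω] b}

/-- The integral of `f` against a finite signed measure, by the Jordan decomposition. -/
def signedIntegral (μ : SignedMeasure (Eucl d)) (f : Eucl d → ℝ) : ℝ :=
  ∫ x, f x ∂μ.toJordanDecomposition.posPart - ∫ x, f x ∂μ.toJordanDecomposition.negPart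

/-- The functional `α` on `W^{1,q}(Ω)` is given by the signed measure `μ` on the closure of `Ω`:
`⟨α, φ⟩ = ∫ φ dμ`, where `φ` is evaluated through its continuous representative. -/
def IsRepresentedBy {Ω : Set (Eucl d)} {q : ℝ} [Fact (1 < q)] (α : StrongDual ℝ (Sobolev Ω q))
    (μ : SignedMeasure (Eucl d)) : Prop :=
  (∀ B, MeasurableSet B → Disjoint B (closure Ω) → μ B = 0) ∧
  ∀ φ : Sobolev Ω q, ∃ f : Eucl d → ℝ, IsContRep φ f ∧ α φ = signedIntegral μ f

/-- The set `{m = 0}` in the closure of `Ω`. -/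
def zeroSet (Ω : Set (Eucl d)) (f : Eucl d → ℝ) : Set (Eucl d) := {x ∈ closure Ω | f x = 0}

/-- The set `{m > 0}` in the closure of `Ω`. -/
def posSet (Ω : Set (Eucl d)) (f : Eucl d → ℝ) : Set (Eucl d) := {x ∈ closure Ω | 0 < f x}

/-- The field `v = (w / m) 𝟙_{m > 0}`. -/
def velocity (Ω : Set (Eucl d)) (f : Eucl d → ℝ) (w : Eucl d → Eucl d) : Eucl d → Eucl d :=
  (posSet Ω f).indicator fun x => (f x)⁻¹ • w x

end

/-!
The functional `𝓛_r` is convex, positively homogeneous of degree one, and is the support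
function of `𝓐_{r'}`: pointwise `ℓ_r(a, b)` is the supremum of `α a + β · b` over
`α + |β|^{r'} / r' ≤ 0`, and the supremum is approached by bounded measurable choices of `(α, β)`
(`tendsto_optDensity_mul_add`, `energy_le_of_forall_setA`). As `W^{1,q} × L^q` is reflexive (`exists_eq_pairing`), Hahn-Banach
separation in the dual identifies the closure of `𝓐_{r'}` with the set of functionals dominated by
`𝓛_r` (`dominatedSet_subset_closure`, `closure_setA_subset`), and by homogeneity the subgradients at
`(m, w)` are the dominated functionals whose value at `(m, w)` is `𝓛_r(m, w)`
(`mem_subdifferential_iff`).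

Let `(α, β)` be dominated. Then `α` is nonpositive on nonnegative functions. By Morrey's theorem
(`exists_contRep`), proved from the interior cone property of smooth domains, `W^{1,q}` embeds in
the continuous functions on the closure of `Ω`. The M. Riesz extension theorem and the
Riesz-Markov-Kakutani theorem then give a finite measure `ν` on the closure with `α = -ν`
(`exists_isNegIntegral`), unique because smooth functions determine a measure. Testing domination
with momenta `φ z`, where `z` is conjugate to a truncation of `β`, shows that `ν` is at least the
measure `ρ` of density `|β|^{r'} / r'` (`powMeasure_le`). Writing `w = m v`, one has
`𝓛_r(m, w) - ⟨α, m⟩ - ∫ β · w = ∫ m d(ν - ρ) + ∫ m (|β|^{r'} / r' + |v|^r / r - β · v) dx`.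
Both terms are nonnegative, the second by Young's inequality. So `(α, β)` is a subgradient exactly
when `ν = ρ` on `{m > 0}` and equality holds in Young's inequality there, that is
`β = |v|^{r-2} v` (`restrict_eq_of_pairing_eq_energy`, `pairing_eq_energy_of_restrict_eq`). Then `ν`
has density `|v|^r / r'` on `{m > 0}`, which is integrable since `ν` is finite: hence `v ∈ L^r`.
Conversely, for `v ∈ L^r` the pair `(-|v|^r / r', |v|^{r-2} v)` is a subgradient; here `r ≤ q` gives
`L^{r'} ⊆ L^{q'}` (`subdifferential_nonempty`).
-/

noncomputable section

variable {d : ℕ}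

/-! ### The dual of `L^p` of a finite measure -/

section LpDuality

open Filter

variable {X : Type*} [MeasurableSpace X] {μ : Measure X}

theorem clm_ext_indicatorConstLp [IsFiniteMeasure μ] {p : ℝ≥0∞} [Fact (1 ≤ p)] (hp : p ≠ ⊤)
    {S T : Lp ℝ p μ →L[ℝ] ℝ}
    (h : ∀ (s : Set X) (hs : MeasurableSet s),
      S (indicatorConstLp p hs (measure_ne_top μ s) 1) =
        T (indicatorConstLp p hs (measure_ne_top μ s) 1)) : S = T := by
  ext f
  induction f using Lp.induction hp with
  | indicatorConst c hs hμs =>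
    rename_i s
    have : ((Lp.simpleFunc.indicatorConst p hs hμs.ne c : Lp.simpleFunc ℝ p μ) : Lp ℝ p μ)
        = c • indicatorConstLp p hs (measure_ne_top μ s) 1 := by
      rw [Lp.simpleFunc.coe_indicatorConst, indicatorConstLp, indicatorConstLp,
        ← MemLp.toLp_const_smul]
      congr 1
      ext x
      by_cases hx : x ∈ s <;> simp [hx]
    rw [this, map_smul, map_smul, h s hs]
  | add hf hg _ h1 h2 => rw [map_add, map_add, h1, h2]
  | isClosed => exact isClosed_eq S.continuous T.continuous

/-- A continuous functional on `L^p` of a finite measure induces a signed measure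
`A ↦ T 1_A`. -/
def signedMeasureOfDual [IsFiniteMeasure μ] {p : ℝ≥0∞} [Fact (1 ≤ p)] (hp : p ≠ ⊤)
    (T : Lp ℝ p μ →L[ℝ] ℝ) : SignedMeasure X :=
  open Classical in
  { measureOf' := fun s => if hs : MeasurableSet s then
      T (indicatorConstLp p hs (measure_ne_top μ s) 1) else 0
    empty' := by simp
    not_measurable' := fun s hs => by simp [hs]
    m_iUnion' := by
      intro f hf hd
      have hU : ∀ s : Finset ℕ, MeasurableSet (⋃ i ∈ s, f i) := fun s =>
        s.measurableSet_biUnion fun i _ => hf i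
      have hsum : ∀ s : Finset ℕ, ∑ i ∈ s, T (indicatorConstLp p (hf i) (measure_ne_top μ _) 1)
          = T (indicatorConstLp p (hU s) (measure_ne_top μ _) 1) := by
        intro s
        induction s using Finset.induction_on with
        | empty => simp
        | insert a s ha ih =>
          have hdis : Disjoint (f a) (⋃ i ∈ s, f i) := by
            rw [Set.disjoint_iUnion₂_right]
            intro i hi
            exact hd (by rintro rfl; exact ha hi)
          rw [Finset.sum_insert ha, ih, ← map_add,
            ← indicatorConstLp_disjoint_union (hf a) (hU s) (measure_ne_top μ _)
              (measure_ne_top μ _) hdis]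
          congr 2
          simp
      simp only [hf, MeasurableSet.iUnion hf, dif_pos]
      unfold HasSum
      simp only [hsum]
      refine (T.continuous.tendsto _).comp (tendsto_indicatorConstLp_set hp ?_)
      have h1 : ∀ s : Finset ℕ, symmDiff (⋃ i ∈ s, f i) (⋃ i, f i) = (⋃ i, f i) \ ⋃ i ∈ s, f i := by
        intro s
        rw [Set.symmDiff_def, Set.sdiff_eq_empty.2, Set.empty_union]
        exact Set.iUnion₂_subset fun i _ => Set.subset_iUnion f i
      simp only [h1]
      have h2 : ⋂ s : Finset ℕ, ((⋃ i, f i) \ ⋃ i ∈ s, f i) = ∅ := by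
        ext x
        simp only [Set.mem_iInter, Set.mem_sdiff, Set.mem_iUnion, Set.mem_empty_iff_false,
          iff_false, not_forall]
        by_cases hx : ∃ i, x ∈ f i
        · obtain ⟨i, hi⟩ := hx
          exact ⟨{i}, fun h => h.2 ⟨i, by simp, hi⟩⟩
        · exact ⟨∅, fun h => hx h.1⟩
      have h3 := tendsto_measure_iInter_atTop (μ := μ)
        (s := fun s : Finset ℕ => ((⋃ i, f i) \ ⋃ i ∈ s, f i))
        (fun s => ((MeasurableSet.iUnion hf).diff (hU s)).nullMeasurableSet)
        (fun s t hst => Set.sdiff_subset_sdiff_right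
          (Set.biUnion_subset_biUnion_left hst)) ⟨∅, measure_ne_top μ _⟩
      rw [h2, measure_empty] at h3
      exact h3 }

/-- The density is obtained from the Radon-Nikodym theorem. -/
theorem exists_density_of_dual [IsFiniteMeasure μ] {p : ℝ≥0∞} [Fact (1 ≤ p)] (hp : p ≠ ⊤)
    (T : Lp ℝ p μ →L[ℝ] ℝ) : ∃ g : X → ℝ, Measurable g ∧ Integrable g μ ∧
      ∀ (s : Set X) (hs : MeasurableSet s),
        T (indicatorConstLp p hs (measure_ne_top μ s) 1) = ∫ x in s, g x ∂μ := by
  set σ := signedMeasureOfDual hp T with hσ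
  have hval : ∀ (s : Set X) (hs : MeasurableSet s),
      σ s = T (indicatorConstLp p hs (measure_ne_top μ s) 1) := by
    intro s hs
    exact dif_pos hs
  have hac : σ ≪ᵥ μ.toENNRealVectorMeasure := by
    refine VectorMeasure.AbsolutelyContinuous.mk fun s hs h0 => ?_
    rw [Measure.toENNRealVectorMeasure_apply_measurable hs] at h0
    rw [hval s hs]
    have : indicatorConstLp p hs (measure_ne_top μ s) (1 : ℝ) = 0 := by
      rw [← norm_le_zero_iff]
      refine (norm_indicatorConstLp_le).trans ?_
      have hp1 : (1 : ℝ≥0∞) ≤ p := Fact.out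
      have : p.toReal ≠ 0 := (ENNReal.toReal_pos (one_pos.trans_le hp1).ne' hp).ne'
      simp [measureReal_def, h0, Real.zero_rpow (inv_ne_zero this)]
    rw [this, map_zero]
  refine ⟨σ.rnDeriv μ, σ.measurable_rnDeriv μ, σ.integrable_rnDeriv μ, fun s hs => ?_⟩
  rw [← hval s hs]
  conv_lhs => rw [← SignedMeasure.withDensityᵥ_rnDeriv_eq σ μ hac]
  rw [withDensityᵥ_apply (σ.integrable_rnDeriv μ) hs]

/-- The density of a continuous functional on `L^p` is in `L^{p'}`: the norms of its truncations are
bounded by that of the functional, and Fatou's lemma passes to the limit. -/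
theorem memLp_of_dual_density [IsFiniteMeasure μ] {p p' : ℝ} (hpp : p.HolderConjugate p')
    [Fact (1 ≤ ENNReal.ofReal p)]
    (T : Lp ℝ (ENNReal.ofReal p) μ →L[ℝ] ℝ) {g : X → ℝ} (hg : Measurable g)
    (hT : ∀ (s : Set X) (hs : MeasurableSet s),
        T (indicatorConstLp (ENNReal.ofReal p) hs (measure_ne_top μ s) 1) = ∫ x in s, g x ∂μ) :
    MemLp g (ENNReal.ofReal p') μ := by
  have hp0 := hpp.pos
  have hp'0 := hpp.symm.pos
  have := hpp.ennrealOfReal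
  have := hpp.symm.ennrealOfReal
  have : Fact (1 ≤ ENNReal.ofReal p') := ⟨by simpa using ENNReal.ofReal_le_ofReal hpp.symm.lt.le⟩
  let A : ℕ → Set X := fun n => {x | ‖g x‖ ≤ n}
  have hA : ∀ n, MeasurableSet (A n) := fun n => measurableSet_le hg.norm measurable_const
  let gn : ℕ → X → ℝ := fun n => (A n).indicator g
  have hgn_meas : ∀ n, Measurable (gn n) := fun n => hg.indicator (hA n)
  have hgn_bdd : ∀ n x, ‖gn n x‖ ≤ n := by
    intro n x
    by_cases hx : x ∈ A n
    · have h : ‖g x‖ ≤ n := hx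
      simpa only [gn, Set.indicator_of_mem hx] using h
    · simp [gn, hx]
  have hgn : ∀ n r, MemLp (gn n) r μ := fun n r =>
    MemLp.of_bound (hgn_meas n).aestronglyMeasurable n (.of_forall (hgn_bdd n))
  let χ : ℕ → Lp ℝ ⊤ μ := fun n => indicatorConstLp ⊤ (hA n) (measure_ne_top μ _) 1
  let M : ℕ → (Lp ℝ (ENNReal.ofReal p) μ →L[ℝ] Lp ℝ (ENNReal.ofReal p) μ) := fun n =>
    (ContinuousLinearMap.mul ℝ ℝ).holderL μ ⊤ (ENNReal.ofReal p) (ENNReal.ofReal p) (χ n)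
  have hM : ∀ n f, M n f =ᵐ[μ] (A n).indicator f := by
    intro n f
    have h1 := (ContinuousLinearMap.mul ℝ ℝ).coeFn_holder (r := ENNReal.ofReal p) (χ n) f
    have h2 : χ n =ᵐ[μ] _ := indicatorConstLp_coeFn
    filter_upwards [h1, h2] with x hx hx2
    refine hx.trans ?_
    rw [hx2]
    by_cases h : x ∈ A n <;> simp [h]
  let G : ℕ → (Lp ℝ (ENNReal.ofReal p) μ →L[ℝ] ℝ) := fun n =>
    (ContinuousLinearMap.mul ℝ ℝ).lpPairing μ (ENNReal.ofReal p') (ENNReal.ofReal p)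
      ((hgn n _).toLp (gn n))
  have hG : ∀ n f, G n f = ∫ x, gn n x * f x ∂μ := by
    intro n f
    rw [ContinuousLinearMap.lpPairing_eq_integral]
    refine integral_congr_ae ?_
    filter_upwards [(hgn n (ENNReal.ofReal p')).coeFn_toLp] with x hx
    simp [hx]
  have hTM : ∀ n, T.comp (M n) = G n := by
    intro n
    refine clm_ext_indicatorConstLp ENNReal.ofReal_ne_top fun s hs => ?_
    have h1 : M n (indicatorConstLp _ hs (measure_ne_top μ s) 1) =
        indicatorConstLp _ (hs.inter (hA n)) (measure_ne_top μ _) 1 := by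
      refine Lp.ext ((hM n _).trans ?_)
      have h2 := indicatorConstLp_coeFn (p := ENNReal.ofReal p) (hs := hs)
        (hμs := measure_ne_top μ s) (c := (1:ℝ))
      have h3 := indicatorConstLp_coeFn (p := ENNReal.ofReal p) (hs := hs.inter (hA n))
        (hμs := measure_ne_top μ _) (c := (1:ℝ))
      filter_upwards [h2, h3] with x h2 h3
      rw [h3]
      by_cases hx : x ∈ A n <;> by_cases hs : x ∈ s <;> simp [hx, hs, h2]
    rw [ContinuousLinearMap.comp_apply, h1, hT, hG, ← integral_indicator (hs.inter (hA n))]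
    refine integral_congr_ae ?_
    have h2 := indicatorConstLp_coeFn (p := ENNReal.ofReal p) (hs := hs)
        (hμs := measure_ne_top μ s) (c := (1:ℝ))
    filter_upwards [h2] with x h2
    rw [h2]
    by_cases hx : x ∈ A n <;> by_cases hs : x ∈ s <;> simp [hx, hs, gn]
  have hbound : ∀ n, eLpNorm (gn n) (ENNReal.ofReal p') μ ≤ ENNReal.ofReal ‖T‖ := by
    intro n
    -- test `T` against the extremal function in Hölder's inequality
    let h : X → ℝ := fun x => SignType.sign (gn n x) * ‖gn n x‖ ^ (p' - 1)
    have hh_meas : Measurable h := by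
      have : Measurable fun x => ((SignType.sign (gn n x) : SignType) : ℝ) := by
        have h1 : Measurable (fun t : ℝ => ((SignType.sign t : SignType) : ℝ)) := by
          have : (fun t : ℝ => ((SignType.sign t : SignType) : ℝ)) = fun t =>
              if 0 < t then 1 else if t < 0 then -1 else 0 := by
            ext t
            rcases lt_trichotomy t 0 with h | h | h <;> simp [h, h.le, not_lt.2, sign_apply]
          rw [this]
          exact Measurable.ite measurableSet_Ioi measurable_const
            (Measurable.ite measurableSet_Iio measurable_const measurable_const)
        exact h1.comp (hgn_meas n)
      exact this.mul ((hgn_meas n).norm.pow_const _)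
    have hp1 : 0 < p' - 1 := by linarith [hpp.symm.lt]
    have hhn : ∀ x, ‖h x‖ = ‖gn n x‖ ^ (p' - 1) := by
      intro x
      by_cases h0 : gn n x = 0
      · simp [h, h0, Real.zero_rpow hp1.ne']
      · have : ‖((SignType.sign (gn n x) : SignType) : ℝ)‖ = 1 := by
          rcases lt_or_gt_of_ne h0 with h | h <;> simp [h]
        simp only [h, norm_mul, this, one_mul, Real.norm_eq_abs]
        exact abs_of_nonneg (by positivity)
    have hmem : MemLp h (ENNReal.ofReal p) μ := by
      refine MemLp.of_bound hh_meas.aestronglyMeasurable ((n:ℝ) ^ (p' - 1)) (.of_forall fun x => ?_)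
      rw [hhn]
      exact Real.rpow_le_rpow (norm_nonneg _) (hgn_bdd n x) hp1.le
    have hgh : ∀ x, gn n x * h x = ‖gn n x‖ ^ p' := by
      intro x
      by_cases h0 : gn n x = 0
      · simp [h0, Real.zero_rpow hp'0.ne']
      · have h1 : gn n x * SignType.sign (gn n x) = ‖gn n x‖ := by
          rw [self_mul_sign, Real.norm_eq_abs]
        simp only [h]
        rw [← mul_assoc, h1]
        nth_rewrite 1 [← Real.rpow_one ‖gn n x‖]
        rw [← Real.rpow_add (norm_pos_iff.2 h0)]
        ring_nf
    set I : ℝ := ∫ x, ‖gn n x‖ ^ p' ∂μ with hI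
    have hI0 : 0 ≤ I := integral_nonneg fun x => by positivity
    have hTh : T (hmem.toLp h) = I := by
      have h1 : M n (hmem.toLp h) = hmem.toLp h := by
        refine Lp.ext ((hM n _).trans ?_)
        filter_upwards [hmem.coeFn_toLp] with x hx
        by_cases hxA : x ∈ A n
        · simp [hxA]
        · have : gn n x = 0 := by simp [gn, hxA]
          rw [Set.indicator_of_notMem hxA, hx]
          simp [h, this]
      have h2 := congrArg (fun S => S (hmem.toLp h)) (hTM n)
      simp only [ContinuousLinearMap.comp_apply, h1] at h2
      rw [h2, hG]
      refine integral_congr_ae ?_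
      filter_upwards [hmem.coeFn_toLp] with x hx
      rw [hx, hgh]
    have hnorm : ‖hmem.toLp h‖ = I ^ (1 / p) := by
      rw [Lp.norm_toLp, hmem.eLpNorm_eq_integral_rpow_norm (by simpa using hp0)
        ENNReal.ofReal_ne_top, ENNReal.toReal_ofReal hp0.le, ENNReal.toReal_ofReal (by positivity),
        one_div]
      congr 1
      refine integral_congr_ae (.of_forall fun x => ?_)
      simp only [hhn]
      rw [← Real.rpow_mul (norm_nonneg _)]
      congr 1
      have := hpp.symm.sub_one_mul_conj
      linarith
    have hle : I ≤ ‖T‖ * I ^ (1 / p) := by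
      rw [← hnorm]
      calc I = T (hmem.toLp h) := hTh.symm
        _ ≤ ‖T (hmem.toLp h)‖ := le_abs_self _
        _ ≤ _ := T.le_opNorm _
    rw [(hgn n _).eLpNorm_eq_integral_rpow_norm (by simpa using hp'0) ENNReal.ofReal_ne_top,
      ENNReal.toReal_ofReal hp'0.le]
    refine ENNReal.ofReal_le_ofReal ?_
    rw [← hI]
    rcases hI0.eq_or_lt with h0 | hpos
    · rw [← h0, Real.zero_rpow (inv_ne_zero hp'0.ne')]
      exact norm_nonneg _
    · have h1 : I = I ^ (p'⁻¹) * I ^ (1 / p) := by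
        rw [← Real.rpow_add hpos]
        have := hpp.inv_add_inv_eq_one
        rw [one_div, add_comm, this, Real.rpow_one]
      have h2 : 0 < I ^ (1 / p) := Real.rpow_pos_of_pos hpos _
      nth_rewrite 1 [h1] at hle
      exact le_of_mul_le_mul_right hle h2
  refine ⟨hg.aestronglyMeasurable, lt_of_le_of_lt ?_ (ENNReal.ofReal_lt_top (r := ‖T‖))⟩
  refine (Lp.eLpNorm_lim_le_liminf_eLpNorm (fun n => (hgn_meas n).aestronglyMeasurable) g
    (.of_forall fun x => ?_)).trans ?_
  · refine tendsto_const_nhds.congr' ?_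
    filter_upwards [eventually_ge_atTop ⌈‖g x‖⌉₊] with n hn
    have h1 : ‖g x‖ ≤ n := (Nat.le_ceil _).trans (by exact_mod_cast hn)
    have h2 : x ∈ A n := h1
    simp [gn, h2]
  · exact liminf_le_of_le (by isBoundedDefault) fun b hb => by
      obtain ⟨n, hn⟩ := hb.exists
      exact hn.trans (hbound n)

/-- **Riesz representation** for the dual of `L^p` of a finite measure, `1 < p < ⊤`. -/
theorem exists_Lp_dual_real [IsFiniteMeasure μ] {p p' : ℝ} (hpp : p.HolderConjugate p')
    [Fact (1 ≤ ENNReal.ofReal p)]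
    (T : Lp ℝ (ENNReal.ofReal p) μ →L[ℝ] ℝ) :
    ∃ g : Lp ℝ (ENNReal.ofReal p') μ, ∀ f, T f = ∫ x, g x * f x ∂μ := by
  have := hpp.ennrealOfReal
  have := hpp.symm.ennrealOfReal
  have : Fact (1 ≤ ENNReal.ofReal p') := ⟨by simpa using ENNReal.ofReal_le_ofReal hpp.symm.lt.le⟩
  obtain ⟨g, hgm, -, hT⟩ := exists_density_of_dual ENNReal.ofReal_ne_top T
  have hg := memLp_of_dual_density hpp T hgm hT
  refine ⟨hg.toLp g, fun f => ?_⟩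
  have h := clm_ext_indicatorConstLp ENNReal.ofReal_ne_top (S := T)
    (T := (ContinuousLinearMap.mul ℝ ℝ).lpPairing μ (ENNReal.ofReal p') (ENNReal.ofReal p)
      (hg.toLp g)) ?_
  · rw [h, ContinuousLinearMap.lpPairing_eq_integral]
    rfl
  · intro s hs
    rw [ContinuousLinearMap.lpPairing_eq_integral, hT, ← integral_indicator hs]
    refine integral_congr_ae ?_
    have h2 := indicatorConstLp_coeFn (p := ENNReal.ofReal p) (hs := hs)
        (hμs := measure_ne_top μ s) (c := (1:ℝ))
    filter_upwards [h2, hg.coeFn_toLp] with x h2 h3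
    rw [h2, ContinuousLinearMap.mul_apply', h3]
    by_cases hs : x ∈ s <;> simp [hs]

/-- Riesz representation for vector fields, obtained coordinate by coordinate. -/
theorem exists_Lp_dual_eucl [IsFiniteMeasure μ] {d : ℕ} {p p' : ℝ} (hpp : p.HolderConjugate p')
    [Fact (1 ≤ ENNReal.ofReal p)]
    (T : Lp (Eucl d) (ENNReal.ofReal p) μ →L[ℝ] ℝ) :
    ∃ g : Lp (Eucl d) (ENNReal.ofReal p') μ, ∀ f, T f = ∫ x, inner ℝ (g x) (f x) ∂μ := by
  let b := EuclideanSpace.basisFun (Fin d) ℝ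
  let ι : Fin d → (ℝ →L[ℝ] Eucl d) := fun i => ContinuousLinearMap.toSpanSingleton ℝ (b i)
  let π : Fin d → (Eucl d →L[ℝ] ℝ) := fun i => innerSL ℝ (b i)
  choose g hg using fun i : Fin d => exists_Lp_dual_real hpp
    (T.comp ((ι i).compLpL (ENNReal.ofReal p) μ))
  have hgm : MemLp (fun x => ∑ i, g i x • b i) (ENNReal.ofReal p') μ :=
    memLp_finsetSum _ fun i _ => by
      exact (ι i).comp_memLp' (Lp.memLp (g i))
  refine ⟨hgm.toLp _, fun f => ?_⟩
  have hf : f = ∑ i, (ι i).compLpL (ENNReal.ofReal p) μ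
      ((π i).compLpL (ENNReal.ofReal p) μ f) := by
    refine Lp.ext ?_
    have h1 : ∀ i, (ι i).compLpL (ENNReal.ofReal p) μ ((π i).compLpL (ENNReal.ofReal p) μ f)
        =ᵐ[μ] fun x => inner ℝ (b i) (f x) • b i := by
      intro i
      filter_upwards [(ι i).coeFn_compLpL (p := ENNReal.ofReal p) (μ := μ)
        ((π i).compLpL (ENNReal.ofReal p) μ f), (π i).coeFn_compLpL (p := ENNReal.ofReal p)
        (μ := μ) f] with x hx hx2
      rw [hx, hx2]
      simp [ι, π]
    filter_upwards [Lp.coeFn_fun_finsetSum Finset.univ (fun i => (ι i).compLpL (ENNReal.ofReal p) μ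
      ((π i).compLpL (ENNReal.ofReal p) μ f)), ae_all_iff.2 h1] with x hx hx2
    rw [hx]
    simp only [hx2]
    exact (b.sum_repr' (f x)).symm
  have h3 : ∀ i, T ((ι i).compLpL (ENNReal.ofReal p) μ ((π i).compLpL (ENNReal.ofReal p) μ f))
      = ∫ x, g i x * inner ℝ (b i) (f x) ∂μ := by
    intro i
    refine (hg i _).trans (integral_congr_ae ?_)
    filter_upwards [(π i).coeFn_compLpL (p := ENNReal.ofReal p) (μ := μ) f] with x hx
    rw [hx]
    rfl
  conv_lhs => rw [hf]
  rw [map_sum]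
  simp only [h3]
  rw [← integral_finsetSum]
  · refine integral_congr_ae ?_
    filter_upwards [hgm.coeFn_toLp] with x hx
    rw [hx, sum_inner]
    simp only [inner_smul_left]
    rfl
  · intro i _
    have := hpp.symm.ennrealOfReal
    have h4 : MemLp (fun x => inner ℝ (b i) (f x)) (ENNReal.ofReal p) μ :=
      (Lp.memLp f).const_inner (b i)
    exact (Lp.memLp (g i)).integrable_mul h4

end LpDuality

/-! ### Reflexivity of `W^{1,q} × L^q` -/

section Reflexivity

/-- The functional on `E` induced by the pairings `B₁`, `B₂` and the maps `J₁`, `J₂` out of `E`. -/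
def pullbackPairings {E F₁ F₂ G₁ G₂ : Type*} [NormedAddCommGroup E] [NormedSpace ℝ E]
    [NormedAddCommGroup F₁] [NormedSpace ℝ F₁] [NormedAddCommGroup F₂] [NormedSpace ℝ F₂]
    [NormedAddCommGroup G₁] [NormedSpace ℝ G₁] [NormedAddCommGroup G₂] [NormedSpace ℝ G₂]
    (J₁ : E →L[ℝ] F₁) (J₂ : E →L[ℝ] F₂) (B₁ : G₁ →L[ℝ] F₁ →L[ℝ] ℝ) (B₂ : G₂ →L[ℝ] F₂ →L[ℝ] ℝ) :
    (G₁ × G₂) →L[ℝ] StrongDual ℝ E :=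
  ((ContinuousLinearMap.precomp ℝ J₁).comp B₁).coprod ((ContinuousLinearMap.precomp ℝ J₂).comp B₂)

theorem strongDual_prod_decomp {E F : Type*} [NormedAddCommGroup E] [NormedSpace ℝ E]
    [NormedAddCommGroup F] [NormedSpace ℝ F] (ξ : StrongDual ℝ (StrongDual ℝ E × F)) :
    ∃ (ξ₁ : StrongDual ℝ (StrongDual ℝ E)) (ξ₂ : StrongDual ℝ F), ∀ p, ξ p = ξ₁ p.1 + ξ₂ p.2 :=
  ⟨ξ.comp (.inl ℝ _ _), ξ.comp (.inr ℝ _ _), fun p => by simp [← map_add]⟩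

variable {Ω : Set (Eucl d)} {q : ℝ} [Fact (1 < q)]

theorem holderConjugate_conjExponent (q : ℝ) [h : Fact (1 < q)] :
    q.HolderConjugate q.conjExponent :=
  Real.HolderConjugate.conjExponent h.out

/-- The pairing `(g, u) ↦ ∫_Ω g u` of `L^{q'}(Ω)` with `L^q(Ω)`. -/
def pairS (Ω : Set (Eucl d)) (q : ℝ) [Fact (1 < q)] :
    LpS Ω q.conjExponent →L[ℝ] LpS Ω q →L[ℝ] ℝ :=
  have := (holderConjugate_conjExponent q).symm.ennrealOfReal
  (ContinuousLinearMap.mul ℝ ℝ).lpPairing (volume.restrict Ω) _ _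

/-- The pairing `(g, w) ↦ ∫_Ω g · w` of `L^{q'}(Ω)^d` with `L^q(Ω)^d`. -/
def pairV (Ω : Set (Eucl d)) (q : ℝ) [Fact (1 < q)] :
    LpV Ω q.conjExponent →L[ℝ] LpV Ω q →L[ℝ] ℝ :=
  have := (holderConjugate_conjExponent q).symm.ennrealOfReal
  (innerSL ℝ).lpPairing (volume.restrict Ω) _ _

theorem pairS_apply (g : LpS Ω q.conjExponent) (u : LpS Ω q) :
    pairS Ω q g u = ∫ x in Ω, g x * u x := by
  have := (holderConjugate_conjExponent q).symm.ennrealOfReal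
  exact (ContinuousLinearMap.mul ℝ ℝ).lpPairing_eq_integral g u

theorem pairV_apply (g : LpV Ω q.conjExponent) (u : LpV Ω q) :
    pairV Ω q g u = ∫ x in Ω, inner ℝ (g x) (u x) := by
  have := (holderConjugate_conjExponent q).symm.ennrealOfReal
  exact (innerSL ℝ).lpPairing_eq_integral g u

theorem pairing_eq (p : DualPair Ω q) (m : Sobolev Ω q) (w : LpV Ω q) :
    pairing p m w = p.1 m + pairV Ω q p.2 w := by
  rw [pairing, pairV_apply]

/-- The weak gradient, as a continuous linear map. -/
def Sobolev.gradL (Ω : Set (Eucl d)) (q : ℝ) [Fact (1 < q)] : Sobolev Ω q →L[ℝ] LpV Ω q :=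
  (ContinuousLinearMap.snd ℝ _ _).comp (sobolevSubmodule Ω q).subtypeL

/-- The inclusion of `W^{1,q}(Ω)` in `L^q(Ω)`, as a continuous linear map. -/
def Sobolev.fnL (Ω : Set (Eucl d)) (q : ℝ) [Fact (1 < q)] : Sobolev Ω q →L[ℝ] LpS Ω q :=
  (ContinuousLinearMap.fst ℝ _ _).comp (sobolevSubmodule Ω q).subtypeL

/-- The functional `φ ↦ ∫_Ω g₀ φ + ∫_Ω g₁ · ∇φ` on `W^{1,q}(Ω)`. -/
def sobolevDualMk (Ω : Set (Eucl d)) (q : ℝ) [Fact (1 < q)] :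
    (LpS Ω q.conjExponent × LpV Ω q.conjExponent) →L[ℝ] StrongDual ℝ (Sobolev Ω q) :=
  pullbackPairings (Sobolev.fnL Ω q) (Sobolev.gradL Ω q) (pairS Ω q) (pairV Ω q)

theorem sobolevDualMk_apply (g : LpS Ω q.conjExponent × LpV Ω q.conjExponent)
    (m : Sobolev Ω q) :
    sobolevDualMk Ω q g m = (∫ x in Ω, g.1 x * m.fn x) +
      ∫ x in Ω, inner ℝ (g.2 x) ((m : LpS Ω q × LpV Ω q).2 x) := by
  rw [← pairS_apply, ← pairV_apply]
  rfl

theorem sobolevDualMk_surjective (hΩ : volume Ω ≠ ⊤) :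
    Function.Surjective (sobolevDualMk Ω q) := by
  have : IsFiniteMeasure (volume.restrict Ω) := ⟨by simpa using hΩ.lt_top⟩
  intro α
  obtain ⟨T, hT, -⟩ := exists_extension_norm_eq (𝕜 := ℝ) (sobolevSubmodule Ω q) α
  obtain ⟨g0, hg0⟩ := exists_Lp_dual_real (holderConjugate_conjExponent q)
    (T.comp (ContinuousLinearMap.inl ℝ (LpS Ω q) (LpV Ω q)))
  obtain ⟨g1, hg1⟩ := exists_Lp_dual_eucl (holderConjugate_conjExponent q)
    (T.comp (ContinuousLinearMap.inr ℝ (LpS Ω q) (LpV Ω q)))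
  refine ⟨(g0, g1), ?_⟩
  ext m
  rw [sobolevDualMk_apply, ← hT m, ← hg0, ← hg1]
  simp only [ContinuousLinearMap.comp_apply, ← map_add]
  simp

theorem memLp_restrict_of_continuous_hasCompactSupport {F : Type*} [NormedAddCommGroup F]
    {φ : Eucl d → F} (hφ : Continuous φ) (hc : HasCompactSupport φ) (s : ℝ≥0∞) :
    MemLp φ s (volume.restrict Ω) :=
  (hφ.memLp_of_hasCompactSupport hc).restrict Ω

/-- A functional on `L^{q'}(Ω) × L^{q'}(Ω)^d` is given by `L^q` functions `(u, g)`. If it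
vanishes on the pairs inducing the zero functional on `W^{1,q}(Ω)`, it vanishes in particular on the
pairs `(∂_e ψ, ψ e)`, which says that `g = ∇u`. -/
theorem exists_eq_sobolevDualMk_apply (hΩ : volume Ω ≠ ⊤)
    (η : (LpS Ω q.conjExponent × LpV Ω q.conjExponent) →L[ℝ] ℝ)
    (hker : ∀ a, sobolevDualMk Ω q a = 0 → η a = 0) :
    ∃ m : Sobolev Ω q, ∀ a, η a = sobolevDualMk Ω q a m := by
  have : IsFiniteMeasure (volume.restrict Ω) := ⟨by simpa using hΩ.lt_top⟩
  have hpp := holderConjugate_conjExponent q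
  obtain ⟨u, hu⟩ := exists_Lp_dual_real hpp.symm
    (η.comp (ContinuousLinearMap.inl ℝ (LpS Ω q.conjExponent) (LpV Ω q.conjExponent)))
  obtain ⟨g, hg⟩ := exists_Lp_dual_eucl hpp.symm
    (η.comp (ContinuousLinearMap.inr ℝ (LpS Ω q.conjExponent) (LpV Ω q.conjExponent)))
  have hη : ∀ a, η a = (∫ x in Ω, u x * a.1 x) + ∫ x in Ω, inner ℝ (g x) (a.2 x) := by
    intro a
    have h : a = (a.1, 0) + (0, a.2) := by simp
    conv_lhs => rw [h, map_add]
    exact congrArg₂ (· + ·) (hu a.1) (hg a.2)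
  have hmem : (u, g) ∈ sobolevSubmodule Ω q := by
    intro φ hφ hc hs e
    have hD : Continuous fun x => fderiv ℝ φ x e :=
      (hφ.continuous_fderiv (by simp)).clm_apply continuous_const
    have h0 : MemLp (fun x => fderiv ℝ φ x e) (ENNReal.ofReal q.conjExponent)
        (volume.restrict Ω) :=
      memLp_restrict_of_continuous_hasCompactSupport hD (hc.fderiv_apply (𝕜 := ℝ) e) _
    have h1 : MemLp (fun x => φ x • e) (ENNReal.ofReal q.conjExponent) (volume.restrict Ω) :=
      memLp_restrict_of_continuous_hasCompactSupport (hφ.continuous.smul continuous_const)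
        hc.smul_right _
    have hz : sobolevDualMk Ω q (h0.toLp _, h1.toLp _) = 0 := by
      ext m
      rw [sobolevDualMk_apply, zero_apply]
      have hm := m.2 φ hφ hc hs e
      rw [← sub_eq_zero, sub_neg_eq_add] at hm
      rw [← hm]
      congr 1
      · refine integral_congr_ae ?_
        filter_upwards [h0.coeFn_toLp] with x hx
        rw [hx]
      · refine integral_congr_ae ?_
        filter_upwards [h1.coeFn_toLp] with x hx
        rw [hx, inner_smul_left]
        rfl
    have hz2 := hker _ hz
    rw [hη] at hz2
    rw [← sub_eq_zero, sub_neg_eq_add, ← hz2]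
    congr 1
    · refine integral_congr_ae ?_
      filter_upwards [h0.coeFn_toLp] with x hx
      rw [hx, mul_comm]
    · refine integral_congr_ae ?_
      filter_upwards [h1.coeFn_toLp] with x hx
      rw [hx, inner_smul_right, real_inner_comm]
  refine ⟨⟨(u, g), hmem⟩, fun a => ?_⟩
  rw [hη, sobolevDualMk_apply]
  exact congrArg₂ (· + ·) (integral_congr_ae (.of_forall fun x => mul_comm _ _))
    (integral_congr_ae (.of_forall fun x => real_inner_comm _ _))

/-- `W^{1,q}(Ω) × L^q(Ω)^d` is reflexive: a continuous functional on its dual is the evaluation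
at a point. -/
theorem exists_eq_pairing (hΩ : volume Ω ≠ ⊤) (ξ : StrongDual ℝ (DualPair Ω q)) :
    ∃ (m : Sobolev Ω q) (w : LpV Ω q), ∀ p, ξ p = pairing p m w := by
  have : IsFiniteMeasure (volume.restrict Ω) := ⟨by simpa using hΩ.lt_top⟩
  obtain ⟨ξ₁, ξ₂, hξ⟩ := strongDual_prod_decomp (E := Sobolev Ω q) (F := LpV Ω q.conjExponent) ξ
  have hker : ∀ a, sobolevDualMk Ω q a = 0 → (ξ₁.comp (sobolevDualMk Ω q)) a = 0 :=
    fun a ha => (congrArg ξ₁ ha).trans (map_zero ξ₁)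
  obtain ⟨m, hm⟩ := exists_eq_sobolevDualMk_apply hΩ (ξ₁.comp (sobolevDualMk Ω q)) hker
  have hm2 : ∀ α, ξ₁ α = α m := fun α => by
    obtain ⟨a, rfl⟩ := sobolevDualMk_surjective hΩ α
    exact hm a
  obtain ⟨w, hw⟩ := exists_Lp_dual_eucl (holderConjugate_conjExponent q).symm ξ₂
  refine ⟨m, w, fun p => (hξ p).trans (congrArg₂ (· + ·) (hm2 p.1) ((hw p.2).trans ?_))⟩
  exact integral_congr_ae (.of_forall fun x => real_inner_comm _ _)

end Reflexivity

/-! ### Smooth functions and measures -/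

section SmoothFunctions

open Filter

theorem memLp_restrict_of_continuous {Ω : Set (Eucl d)} (hΩ : Bornology.IsBounded Ω)
    {F : Type*} [NormedAddCommGroup F] {φ : Eucl d → F} (hφ : Continuous φ)
    (s : ℝ≥0∞) : MemLp φ s (volume.restrict Ω) := by
  have hK : IsCompact (closure Ω) := hΩ.isCompact_closure
  have : IsFiniteMeasure (volume.restrict (closure Ω)) := ⟨by simpa using hK.measure_lt_top⟩
  obtain ⟨C, hC⟩ := hK.exists_bound_of_continuousOn hφ.continuousOn
  refine MemLp.mono_measure (Measure.restrict_mono subset_closure le_rfl)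
    (MemLp.of_bound hφ.aestronglyMeasurable C ?_)
  filter_upwards [ae_restrict_mem isClosed_closure.measurableSet] with x hx using hC x hx

/-- Smooth functions belong to `W^{1,q}(Ω)` for `Ω` bounded. -/
theorem exists_sobolev_of_contDiff {Ω : Set (Eucl d)} (hΩ : Bornology.IsBounded Ω)
    (q : ℝ) [Fact (1 < q)] {φ : Eucl d → ℝ} (hφ : ContDiff ℝ ∞ φ) :
    ∃ m : Sobolev Ω q, m.fn =ᵐ[volume.restrict Ω] φ := by
  have hfd : Continuous (fderiv ℝ φ) := hφ.continuous_fderiv (by simp)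
  have hgc : Continuous (gradient φ) :=
    (InnerProductSpace.toDual ℝ (Eucl d)).symm.continuous.comp hfd
  have h0 : MemLp φ (ENNReal.ofReal q) (volume.restrict Ω) :=
    memLp_restrict_of_continuous hΩ hφ.continuous _
  have h1 : MemLp (gradient φ) (ENNReal.ofReal q) (volume.restrict Ω) :=
    memLp_restrict_of_continuous hΩ hgc _
  have hmem : (h0.toLp φ, h1.toLp (gradient φ)) ∈ sobolevSubmodule Ω q := by
    intro ψ hψ hc hs e
    have hψ0 : ∀ x, x ∉ Ω → ψ x = 0 := fun x hx =>
      image_eq_zero_of_notMem_tsupport fun h => hx (hs h)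
    have hψ1 : ∀ x, x ∉ Ω → fderiv ℝ ψ x e = 0 := fun x hx => by
      have : x ∉ tsupport (fderiv ℝ ψ) := fun h => hx (hs (tsupport_fderiv_subset ℝ h))
      simp [image_eq_zero_of_notMem_tsupport this]
    have e1 : ∫ x in Ω, fderiv ℝ ψ x e * h0.toLp φ x = ∫ x, fderiv ℝ ψ x e * φ x := by
      rw [← setIntegral_eq_integral_of_forall_compl_eq_zero (s := Ω)
        (f := fun x => fderiv ℝ ψ x e * φ x) fun x hx => by rw [hψ1 x hx, zero_mul]]
      refine integral_congr_ae ?_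
      filter_upwards [h0.coeFn_toLp] with x hx
      rw [hx]
    have e2 : ∫ x in Ω, ψ x * inner ℝ e (h1.toLp (gradient φ) x) =
        ∫ x, ψ x * fderiv ℝ φ x e := by
      rw [← setIntegral_eq_integral_of_forall_compl_eq_zero (s := Ω)
        (f := fun x => ψ x * fderiv ℝ φ x e) fun x hx => by rw [hψ0 x hx, zero_mul]]
      refine integral_congr_ae ?_
      filter_upwards [h1.coeFn_toLp] with x hx
      rw [hx, real_inner_comm, gradient, InnerProductSpace.toDual_symm_apply]
    have hDψ : Continuous fun x => fderiv ℝ ψ x e :=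
      (hψ.continuous_fderiv (by simp)).clm_apply continuous_const
    have hDφ : Continuous fun x => fderiv ℝ φ x e := hfd.clm_apply continuous_const
    rw [e1, e2, integral_mul_fderiv_eq_neg_fderiv_mul_of_integrable, neg_neg]
    · exact (hDψ.mul hφ.continuous).integrable_of_hasCompactSupport
        ((hc.fderiv_apply (𝕜 := ℝ) e).mul_right)
    · exact (hψ.continuous.mul hDφ).integrable_of_hasCompactSupport hc.mul_right
    · exact (hψ.continuous.mul hφ.continuous).integrable_of_hasCompactSupport hc.mul_right
    · exact fun x _ => (hψ.differentiable (by simp)).differentiableAt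
    · exact fun x _ => (hφ.differentiable (by simp)).differentiableAt
  exact ⟨⟨_, hmem⟩, h0.coeFn_toLp⟩

/-- Finite measures are ordered as soon as the integrals of smooth functions are: the indicator of
an open set `U` is the limit of `1 - (1 - f)^n` for a smooth `f` with support `U`. -/
theorem measure_le_of_forall_integral_contDiff_le {μ ν : Measure (Eucl d)} [IsFiniteMeasure μ]
    [IsFiniteMeasure ν]
    (h : ∀ φ : Eucl d → ℝ, ContDiff ℝ ∞ φ → (∀ x, φ x ∈ Icc (0 : ℝ) 1) →
      ∫ x, φ x ∂μ ≤ ∫ x, φ x ∂ν) : μ ≤ ν := by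
  have hopen : ∀ U : Set (Eucl d), IsOpen U → μ U ≤ ν U := by
    intro U hU
    obtain ⟨f, hfs, hf, hfr⟩ := hU.exists_contDiff_support_eq (n := ⊤)
    have hf01 : ∀ x, f x ∈ Icc (0 : ℝ) 1 := fun x => hfr (mem_range_self x)
    let φ : ℕ → Eucl d → ℝ := fun n x => 1 - (1 - f x) ^ n
    have hφ : ∀ n, ContDiff ℝ ∞ (φ n) := fun n =>
      contDiff_const.sub ((contDiff_const.sub hf).pow n)
    have hφ01 : ∀ n x, φ n x ∈ Icc (0 : ℝ) 1 := by
      intro n x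
      have h0 : 0 ≤ 1 - f x := by linarith [(hf01 x).2]
      have h1 : 1 - f x ≤ 1 := by linarith [(hf01 x).1]
      exact ⟨sub_nonneg.2 (pow_le_one₀ h0 h1), sub_le_self _ (pow_nonneg h0 n)⟩
    have hlim : ∀ x, Tendsto (fun n => φ n x) atTop (𝓝 (U.indicator 1 x)) := by
      intro x
      by_cases hx : x ∈ U
      · have h0 : f x ≠ 0 := by rwa [← hfs] at hx
        have h1 : 0 < f x := lt_of_le_of_ne (hf01 x).1 h0.symm
        have := (tendsto_pow_atTop_nhds_zero_of_lt_one (r := 1 - f x)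
          (by linarith [(hf01 x).2]) (by linarith)).const_sub 1
        simpa [φ, hx] using this
      · have h0 : f x = 0 := by
          by_contra h0
          exact hx (hfs ▸ h0)
        simp [φ, hx, h0]
    have key : ∀ ρ : Measure (Eucl d), IsFiniteMeasure ρ →
        Tendsto (fun n => ∫ x, φ n x ∂ρ) atTop (𝓝 (ρ.real U)) := by
      intro ρ _
      rw [← integral_indicator_one hU.measurableSet]
      refine tendsto_integral_of_dominated_convergence (fun _ => 1)
        (fun n => (hφ n).continuous.aestronglyMeasurable) (integrable_const _)
        (fun n => .of_forall fun x => ?_) (.of_forall hlim)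
      rw [Real.norm_eq_abs, abs_of_nonneg (hφ01 n x).1]
      exact (hφ01 n x).2
    have h1 := le_of_tendsto_of_tendsto' (key μ inferInstance) (key ν inferInstance)
      fun n => h (φ n) (hφ n) (hφ01 n)
    exact (ENNReal.toReal_le_toReal (measure_ne_top _ _) (measure_ne_top _ _)).1 h1
  refine Measure.le_iff.2 fun B _ => ?_
  rw [B.measure_eq_iInf_isOpen ν]
  exact le_iInf₂ fun U hBU => le_iInf fun hU => (measure_mono hBU).trans (hopen U hU)

end SmoothFunctions

/-! ### Averages over cones -/

section Cone

open Metric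

/-- Uniform cone property: near each point of the closure of `Ω`, the cones with a fixed axis,
aperture and height, and vertex in the closure, lie in `Ω`. Near a boundary point the axis is a
direction in which the defining function decreases. -/
theorem exists_cone {Ω : Set (Eucl d)} (hopen : IsOpen Ω) (hsmooth : HasSmoothBoundary Ω)
    {x₀ : Eucl d} (hx₀ : x₀ ∈ closure Ω) :
    ∃ δ > 0, ∃ e : Eucl d, ∃ ε > 0, ∃ h > 0, ∀ y ∈ ball x₀ δ ∩ closure Ω, ∀ v ∈ ball e ε,
      ∀ t : ℝ, 0 < t → t ≤ h → y + t • v ∈ Ω := by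
  by_cases hx : x₀ ∈ Ω
  · obtain ⟨δ, hδ, hball⟩ := Metric.isOpen_iff.1 hopen x₀ hx
    refine ⟨δ / 2, by positivity, 0, 1, one_pos, δ / 2, by positivity, ?_⟩
    intro y hy v hv t ht hth
    apply hball
    have h1 : dist y x₀ < δ / 2 := hy.1
    have h2 : ‖v‖ < 1 := by simpa using hv
    have h3 : ‖t • v‖ ≤ δ / 2 := by
      rw [norm_smul, Real.norm_of_nonneg ht.le]
      nlinarith [norm_nonneg v]
    rw [mem_ball, dist_eq_norm]
    calc ‖y + t • v - x₀‖ = ‖(y - x₀) + t • v‖ := by congr 1; abel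
      _ ≤ ‖y - x₀‖ + ‖t • v‖ := norm_add_le _ _
      _ < δ := by rw [dist_eq_norm] at h1; linarith
  · have hfr : x₀ ∈ frontier Ω := by rw [hopen.frontier_eq]; exact ⟨hx₀, hx⟩
    obtain ⟨ρ, hρ, hD0, U, hU, hUΩ⟩ := hsmooth x₀ hfr
    set D := fderiv ℝ ρ x₀ with hD
    obtain ⟨e, he⟩ : ∃ e, D e = -1 := by
      obtain ⟨v, hv⟩ : ∃ v, D v ≠ 0 := by
        by_contra! h
        exact hD0 (ContinuousLinearMap.ext h)
      exact ⟨-(D v)⁻¹ • v, by simp [hv]⟩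
    let c : NNReal := ⟨1 / (4 * (‖e‖ + 1)), by positivity⟩
    have hc : (c : ℝ) * (‖e‖ + 1) = 1 / 4 := by
      show 1 / (4 * (‖e‖ + 1)) * (‖e‖ + 1) = 1 / 4
      field_simp
    have hstrict : HasStrictFDerivAt ρ D x₀ :=
      hρ.contDiffAt.hasStrictFDerivAt (by simp)
    have hc0 : 0 < c := by
      rw [← NNReal.coe_pos]
      show 0 < 1 / (4 * (‖e‖ + 1))
      positivity
    obtain ⟨S, hS, hSlin⟩ := hstrict.approximates_deriv_on_nhds (c := c) (Or.inr hc0)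
    obtain ⟨δ, hδ, hball⟩ := Metric.mem_nhds_iff.1 (Filter.inter_mem hU hS)
    let ε : ℝ := min 1 (1 / (4 * (‖D‖ + 1)))
    have hε : 0 < ε := by positivity
    have hε1 : ε ≤ 1 := min_le_left _ _
    have hεD : ‖D‖ * ε ≤ 1 / 4 := by
      have h1 : ε ≤ 1 / (4 * (‖D‖ + 1)) := min_le_right _ _
      have h2 : ε * (4 * (‖D‖ + 1)) ≤ 1 := (le_div_iff₀ (by positivity)).1 h1
      nlinarith [norm_nonneg D]
    let h : ℝ := δ / (2 * (‖e‖ + 1))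
    have hh : h * (‖e‖ + 1) = δ / 2 := by simp only [h]; field_simp
    refine ⟨δ / 2, by positivity, e, ε, hε, h, by positivity, ?_⟩
    rintro y ⟨hy1, hy2⟩ v hv t ht hth
    have hyball : y ∈ ball x₀ δ := ball_subset_ball (by linarith) hy1
    have hρy : ρ y ≤ 0 := by
      have h1 : y ∈ closure (ball x₀ δ ∩ Ω) :=
        isOpen_ball.inter_closure ⟨hyball, hy2⟩
      have h2 : ball x₀ δ ∩ Ω ⊆ {z | ρ z ≤ 0} := fun z hz =>
        ((hUΩ z (hball hz.1).1).1 hz.2).le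
      exact closure_minimal h2 (isClosed_le hρ.continuous continuous_const) h1
    have hvn : ‖v - e‖ < ε := by simpa [dist_eq_norm] using hv
    have hve : ‖v‖ ≤ ‖e‖ + 1 := by
      have := norm_le_norm_add_norm_sub' v e
      linarith
    have hz : y + t • v ∈ ball x₀ δ := by
      have h3 : ‖t • v‖ ≤ δ / 2 := by
        rw [norm_smul, Real.norm_of_nonneg ht.le, ← hh]
        gcongr
      have h1 : ‖y - x₀‖ < δ / 2 := by simpa [dist_eq_norm] using hy1
      rw [mem_ball, dist_eq_norm]
      calc ‖y + t • v - x₀‖ = ‖(y - x₀) + t • v‖ := by congr 1; abel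
        _ ≤ ‖y - x₀‖ + ‖t • v‖ := norm_add_le _ _
        _ < δ := by linarith
    rw [hUΩ _ (hball hz).1]
    have hlin := hSlin _ (hball hz).2 _ (hball hyball).2
    rw [add_sub_cancel_left, map_smul, smul_eq_mul, norm_smul, Real.norm_of_nonneg ht.le] at hlin
    have hDv : D v ≤ -(3 / 4) := by
      have h1 : D v = -1 + D (v - e) := by rw [map_sub, he]; ring
      have h2 : D (v - e) ≤ ‖D‖ * ε :=
        (le_abs_self _).trans ((D.le_opNorm _).trans (by gcongr))
      linarith
    have h4 : (c : ℝ) * (t * ‖v‖) ≤ t * (1 / 4) := by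
      rw [← hc]
      have : (c : ℝ) * (t * ‖v‖) ≤ c * (t * (‖e‖ + 1)) := by gcongr
      linarith
    have h5 := (le_abs_self _).trans hlin
    nlinarith

end Cone

section Kernel

open Metric Filter

variable {Ω : Set (Eucl d)} {q : ℝ} [Fact (1 < q)]

theorem Sobolev.integrable_fn [IsFiniteMeasure (volume.restrict Ω)] (m : Sobolev Ω q) :
    Integrable m.fn (volume.restrict Ω) :=
  (Lp.memLp m.fn).integrable Fact.out

/-- The weak gradient of an element of `W^{1,q}(Ω)`. -/
abbrev Sobolev.grad (m : Sobolev Ω q) : LpV Ω q := (m : LpS Ω q × LpV Ω q).2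

/-- Weak divergence formula for the radial vector field `ζ(x) (x - y)`. -/
theorem Sobolev.integral_div_radial (m : Sobolev Ω q) {ζ : Eucl d → ℝ} (hζ : ContDiff ℝ ∞ ζ)
    (hc : HasCompactSupport ζ) (hs : tsupport ζ ⊆ Ω) (y : Eucl d) :
    ∫ x in Ω, (fderiv ℝ ζ x (x - y) + d * ζ x) * m.fn x =
      - ∫ x in Ω, ζ x * inner ℝ (x - y) (m.grad x) := by
  let b := EuclideanSpace.basisFun (Fin d) ℝ
  let φ : Fin d → Eucl d → ℝ := fun i x => ζ x * inner ℝ (b i) (x - y)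
  have hlin : ∀ i, ContDiff ℝ ∞ fun x : Eucl d => (inner ℝ (b i) (x - y) : ℝ) := fun i =>
    contDiff_const.inner ℝ (contDiff_id.sub contDiff_const)
  have hφ : ∀ i, ContDiff ℝ ∞ (φ i) := fun i => hζ.mul (hlin i)
  have hφc : ∀ i, HasCompactSupport (φ i) := fun i => hc.mul_right
  have hφs : ∀ i, tsupport (φ i) ⊆ Ω := fun i => (tsupport_mul_subset_left).trans hs
  have hw := fun i => m.2 (φ i) (hφ i) (hφc i) (hφs i) (b i)
  have hd : ∀ i x, fderiv ℝ (φ i) x (b i) =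
      fderiv ℝ ζ x (b i) * inner ℝ (b i) (x - y) + ζ x := by
    intro i x
    have h1 : HasFDerivAt (fun x : Eucl d => (inner ℝ (b i) (x - y) : ℝ)) (innerSL ℝ (b i)) x := by
      have := ((innerSL ℝ (b i)).hasFDerivAt (x := x - y)).comp x
        ((hasFDerivAt_id x).sub_const y)
      exact this
    have h2 := ((hζ.differentiable (by simp)).differentiableAt (x := x)).hasFDerivAt.mul h1
    rw [show fderiv ℝ (φ i) x = _ from h2.fderiv]
    have h3 : (inner ℝ (b i) (b i) : ℝ) = 1 := by
      rw [real_inner_self_eq_norm_sq, b.orthonormal.1 i]; norm_num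
    simp only [_root_.add_apply, _root_.smul_apply, innerSL_apply_apply, smul_eq_mul, h3]
    ring
  have hsum : ∀ x, fderiv ℝ ζ x (x - y) + d * ζ x = ∑ i, fderiv ℝ (φ i) x (b i) := by
    intro x
    simp only [hd, Finset.sum_add_distrib]
    congr 1
    · conv_lhs => rw [← b.sum_repr' (x - y)]
      simp [mul_comm]
    · simp
  have hi1 : ∀ i, Integrable (fun x => fderiv ℝ (φ i) x (b i) * m.fn x) (volume.restrict Ω) :=
    fun i => integrable_fderiv_mul Ω q m.fn (hφ i) (hφc i) (b i)
  have hi2 : ∀ i, Integrable (fun x => φ i x * inner ℝ (b i) (m.grad x)) (volume.restrict Ω) :=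
    fun i => integrable_mul_inner Ω q m.grad (hφ i) (hφc i) (b i)
  simp only [hsum, Finset.sum_mul]
  rw [integral_finsetSum _ fun i _ => hi1 i, Finset.sum_congr rfl fun i _ => hw i,
    Finset.sum_neg_distrib, ← integral_finsetSum _ fun i _ => hi2 i]
  congr 1
  refine integral_congr_ae (.of_forall fun x => ?_)
  simp only [φ, mul_assoc, ← Finset.mul_sum]
  congr 1
  rw [← b.sum_inner_mul_inner (x - y)]
  simp only [real_inner_comm]

/-- The average of `u` over `Ω` with weight `s^d η(s (x - y))`, a kernel concentrated at distance
of order `1 / s` from `y`. -/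
def coneAverage (Ω : Set (Eucl d)) (η : Eucl d → ℝ) (u : Eucl d → ℝ) (s : ℝ) (y : Eucl d) : ℝ :=
  ∫ x in Ω, s ^ d * η (s • (x - y)) * u x

theorem continuous_coneAverage [IsFiniteMeasure (volume.restrict Ω)] {η u : Eucl d → ℝ}
    (hη : Continuous η) {M : ℝ} (hM : ∀ z, |η z| ≤ M) (hu : Integrable u (volume.restrict Ω))
    (s : ℝ) : Continuous (coneAverage Ω η u s) := by
  refine continuous_of_dominated (bound := fun x => |s ^ d| * M * |u x|) (fun y => ?_)
    (fun y => .of_forall fun x => ?_) (hu.abs.const_mul _) (.of_forall fun x => ?_)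
  · exact (Continuous.aestronglyMeasurable (by fun_prop)).mul hu.aestronglyMeasurable
  · rw [Real.norm_eq_abs, abs_mul, abs_mul]
    gcongr
    exact hM _
  · fun_prop

theorem abs_coneAverage_le [IsFiniteMeasure (volume.restrict Ω)] {η u : Eucl d → ℝ}
    {M : ℝ} (hM : ∀ z, |η z| ≤ M) (hu : Integrable u (volume.restrict Ω))
    {s : ℝ} (hs : 0 ≤ s) (y : Eucl d) :
    |coneAverage Ω η u s y| ≤ s ^ d * M * ∫ x in Ω, |u x| := by
  rw [← integral_const_mul, ← Real.norm_eq_abs]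
  refine norm_integral_le_of_norm_le (hu.abs.const_mul _) (.of_forall fun x => ?_)
  rw [Real.norm_eq_abs, abs_mul, abs_mul, abs_of_nonneg (pow_nonneg hs d)]
  gcongr
  exact hM _

theorem hasDerivAt_coneAverage [IsFiniteMeasure (volume.restrict Ω)] {η : Eucl d → ℝ}
    (hη : ContDiff ℝ ∞ η) (hηc : HasCompactSupport η) (m : Sobolev Ω q) {s : ℝ} (hs : 0 < s)
    (y : Eucl d) (hsupp : ∀ x, s • (x - y) ∈ tsupport η → x ∈ Ω) :
    HasDerivAt (fun s => coneAverage Ω η m.fn s y)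
      (-∫ x in Ω, s ^ d * s⁻¹ * η (s • (x - y)) * inner ℝ (x - y) (m.grad x)) s := by
  have hηd : Differentiable ℝ η := hη.differentiable (by simp)
  have hη' : Continuous (fderiv ℝ η) := hη.continuous_fderiv (by simp)
  -- the derivative of the kernel with respect to `s`
  let K' : ℝ → Eucl d → ℝ := fun s x =>
    s ^ d * s⁻¹ * (fderiv ℝ η (s • (x - y)) (s • (x - y)) + d * η (s • (x - y)))
  have hK : ∀ x, ∀ s > 0, HasDerivAt (fun s : ℝ => s ^ d * η (s • (x - y))) (K' s x) s := by
    intro x s hs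
    have h1 : HasDerivAt (fun s : ℝ => s • (x - y)) (x - y) s := by
      simpa using (hasDerivAt_id s).smul_const (x - y)
    have h2 := (hηd (s • (x - y))).hasFDerivAt.comp_hasDerivAt s h1
    have h3 := (hasDerivAt_pow d s).mul h2
    refine h3.congr_deriv ?_
    simp only [K', map_smul, smul_eq_mul, Function.comp]
    have h4 : (d : ℝ) * s ^ (d - 1) = d * (s ^ d * s⁻¹) := by
      rcases Nat.eq_zero_or_pos d with rfl | hd
      · simp
      · rw [← Nat.sub_add_cancel hd, pow_succ]
        field_simp
        simp
    rw [h4]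
    field_simp
    ring
  -- it is bounded for `s` bounded away from `0` and `∞`
  let θ : Eucl d → ℝ := fun z => fderiv ℝ η z z + d * η z
  have hθ : Continuous θ := (hη'.clm_apply continuous_id).add (continuous_const.mul hη.continuous)
  have hθc : HasCompactSupport θ := by
    refine HasCompactSupport.add ?_ hηc.mul_left
    refine hηc.fderiv (𝕜 := ℝ) |>.mono fun z hz => ?_
    rw [Function.mem_support] at hz ⊢
    intro h0
    exact hz (by simp [h0])
  obtain ⟨C, hC⟩ := hθ.bounded_above_of_compact_support hθc
  have hC0 : 0 ≤ C := (norm_nonneg _).trans (hC 0)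
  have hu := m.integrable_fn
  have hder := (hasDerivAt_integral_of_dominated_loc_of_deriv_le (μ := volume.restrict Ω)
    (F := fun s x => s ^ d * η (s • (x - y)) * m.fn x) (F' := fun s x => K' s x * m.fn x)
    (x₀ := s) (s := Ioo (s / 2) (2 * s)) (bound := fun x => (2 * s) ^ d * (s / 2)⁻¹ * C * |m.fn x|)
    (Ioo_mem_nhds (by linarith) (by linarith)) ?_ ?_ ?_ ?_ ?_ ?_).2
  · refine hder.congr_deriv ?_
    -- the weak formulation turns the divergence of the radial field into the gradient of `m`
    let ζ : Eucl d → ℝ := fun x => s ^ d * s⁻¹ * η (s • (x - y))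
    have hL : ContDiff ℝ ∞ fun x : Eucl d => s • (x - y) :=
      (contDiff_id.sub contDiff_const).const_smul s
    have hζ : ContDiff ℝ ∞ ζ := contDiff_const.mul (hη.comp hL)
    have hts : tsupport (fun x => η (s • (x - y))) ⊆ (fun x => s • (x - y)) ⁻¹' tsupport η :=
      closure_minimal (fun x hx => subset_tsupport η hx)
        ((isClosed_tsupport η).preimage hL.continuous)
    have hζs : tsupport ζ ⊆ (fun x => s • (x - y)) ⁻¹' tsupport η :=
      (tsupport_mul_subset_right).trans hts
    have hζc : HasCompactSupport ζ := by
      refine IsCompact.of_isClosed_subset (hηc.isCompact.image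
        (f := fun z => s⁻¹ • z + y) (by fun_prop)) (isClosed_tsupport _) fun x hx => ?_
      refine ⟨s • (x - y), hζs hx, ?_⟩
      simp [smul_smul, hs.ne']
    have h := m.integral_div_radial hζ hζc (fun x hx => hsupp x (hζs hx)) y
    rw [← h]
    refine integral_congr_ae (.of_forall fun x => ?_)
    have hfd : HasFDerivAt ζ ((s ^ d * s⁻¹) • (fderiv ℝ η (s • (x - y))).comp
        (s • ContinuousLinearMap.id ℝ (Eucl d))) x := by
      have h1 : HasFDerivAt (fun x : Eucl d => s • (x - y))
          (s • ContinuousLinearMap.id ℝ (Eucl d)) x :=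
        ((hasFDerivAt_id x).sub_const y).const_smul s
      exact ((hηd _).hasFDerivAt.comp x h1).const_mul _
    simp only [K', hfd.fderiv, ζ, _root_.smul_apply, ContinuousLinearMap.comp_apply,
      ContinuousLinearMap.id_apply, smul_eq_mul, map_smul]
    ring
  · refine .of_forall fun t => ?_
    exact (Continuous.aestronglyMeasurable (by fun_prop)).mul hu.aestronglyMeasurable
  · obtain ⟨M, hM⟩ := hη.continuous.bounded_above_of_compact_support hηc
    refine hu.bdd_mul (c := |s ^ d| * M) (Continuous.aestronglyMeasurable (by fun_prop))
      (.of_forall fun x => ?_)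
    rw [norm_mul]
    gcongr
    · exact le_rfl
    · exact hM _
  · refine Continuous.aestronglyMeasurable ?_ |>.mul hu.aestronglyMeasurable
    show Continuous fun x => s ^ d * s⁻¹ * θ (s • (x - y))
    fun_prop
  · refine .of_forall fun x t ht => ?_
    have ht0 : 0 < t := lt_trans (by positivity) ht.1
    rw [norm_mul, Real.norm_eq_abs (m.fn x)]
    gcongr
    show ‖t ^ d * t⁻¹ * θ (t • (x - y))‖ ≤ _
    rw [norm_mul, Real.norm_of_nonneg (by positivity)]
    have h1 := ht.1.le
    have h2 := ht.2.le
    gcongr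
    exact hC _
  · exact (hu.abs.const_mul _)
  · refine .of_forall fun x t ht => ?_
    exact (hK x t (lt_trans (by positivity) ht.1)).mul_const _

end Kernel

/-! ### Morrey's theorem up to the boundary -/

section Morrey

open Metric Filter

variable {Ω : Set (Eucl d)} {q : ℝ} [Fact (1 < q)]

theorem setIntegral_norm_le_norm_mul_rpow {X F : Type*} [MeasurableSpace X] {μ : Measure X}
    [NormedAddCommGroup F] {q : ℝ} (hq : 1 < q) (g : Lp F (ENNReal.ofReal q) μ) {B : Set X}
    (hB : μ B ≠ ⊤) :
    ∫ x in B, ‖g x‖ ∂μ ≤ ‖g‖ * μ.real B ^ (1 - 1 / q) := by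
  have hq0 : 0 < q := by linarith
  have h1 := eLpNorm_le_eLpNorm_mul_rpow_measure_univ (μ := μ.restrict B) (p := 1)
    (q := ENNReal.ofReal q) (by simpa using ENNReal.ofReal_le_ofReal hq.le)
    (Lp.aestronglyMeasurable g).restrict
  have h2 : eLpNorm g (ENNReal.ofReal q) (μ.restrict B) ≤ eLpNorm g (ENNReal.ofReal q) μ :=
    eLpNorm_mono_measure _ Measure.restrict_le_self
  rw [integral_norm_eq_lintegral_enorm (Lp.aestronglyMeasurable g).restrict,
    ← eLpNorm_one_eq_lintegral_enorm, Lp.norm_def, measureReal_def, ENNReal.toReal_rpow,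
    ← ENNReal.toReal_mul]
  have hκ : 0 ≤ 1 - 1 / q := by
    rw [sub_nonneg, div_le_one hq0]; exact hq.le
  refine ENNReal.toReal_mono (ENNReal.mul_ne_top (Lp.eLpNorm_ne_top g)
    (ENNReal.rpow_ne_top_of_nonneg hκ hB)) (h1.trans ?_)
  rw [Measure.restrict_apply_univ, ENNReal.toReal_one, ENNReal.toReal_ofReal hq0.le, div_one]
  gcongr

/-- A function whose derivative is `O(s^{-γ-1})` varies by `O(s^{-γ})` on `[s, ∞)`. -/
theorem abs_sub_le_of_abs_deriv_le_rpow {A A' : ℝ → ℝ} {s₀ D γ : ℝ} (hs₀ : 0 < s₀) (hγ : 0 < γ)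
    (hA : ∀ s ≥ s₀, HasDerivAt A (A' s) s) (hA' : ∀ s ≥ s₀, |A' s| ≤ D * s ^ (-γ - 1))
    {s t : ℝ} (hs : s₀ ≤ s) (hst : s ≤ t) : |A t - A s| ≤ D / γ * s ^ (-γ) := by
  have hD : 0 ≤ D := by
    have h1 := (abs_nonneg _).trans (hA' s₀ le_rfl)
    exact nonneg_of_mul_nonneg_left h1 (by positivity)
  let B : ℝ → ℝ := fun s => -(D / γ * s ^ (-γ))
  have hB : ∀ s ≥ s₀, HasDerivAt B (D * s ^ (-γ - 1)) s := by
    intro s hs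
    have h1 := ((Real.hasDerivAt_rpow_const (p := -γ)
      (Or.inl (hs₀.trans_le hs).ne')).const_mul (D / γ)).neg
    refine h1.congr_deriv ?_
    field_simp
  have hmono : ∀ σ : ℝ, |σ| = 1 → MonotoneOn (fun s => B s + σ * A s) (Ici s₀) := by
    intro σ hσ
    have hd : ∀ s ≥ s₀, HasDerivAt (fun s => B s + σ * A s) (D * s ^ (-γ - 1) + σ * A' s) s :=
      fun s hs => (hB s hs).add ((hA s hs).const_mul σ)
    refine monotoneOn_of_deriv_nonneg (convex_Ici _)
      (fun s hs => (hd s hs).continuousAt.continuousWithinAt)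
      (fun s hs => ?_) fun s hs => ?_
    · rw [interior_Ici] at hs
      exact (hd s hs.le).differentiableAt.differentiableWithinAt
    · rw [interior_Ici] at hs
      rw [(hd s hs.le).deriv]
      have h1 := neg_abs_le (σ * A' s)
      rw [abs_mul, hσ, one_mul] at h1
      linarith [hA' s hs.le]
  have h1 := hmono 1 (by simp) hs (hs.trans hst) hst
  have h2 := hmono (-1) (by simp) hs (hs.trans hst) hst
  have h3 : 0 ≤ D / γ * t ^ (-γ) := by
    have : 0 < t := hs₀.trans_le (hs.trans hst)
    positivity
  simp only [B] at h1 h2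
  rw [abs_le]
  constructor <;> linarith

/-- Hölder's inequality on the support of the kernel, a ball of radius `R / s`. As `q > d`, the
exponent of `s` is less than `-1`. -/
theorem abs_integral_radial_le (η : Eucl d → ℝ) {M R : ℝ} (hR : 0 ≤ R) (hM : ∀ z, |η z| ≤ M)
    (hηR : ∀ z, η z ≠ 0 → ‖z‖ ≤ R) (g : LpV Ω q) {s : ℝ} (hs : 0 < s) (y : Eucl d) :
    |∫ x in Ω, s ^ d * s⁻¹ * η (s • (x - y)) * inner ℝ (x - y) (g x)| ≤
      M * R * (R ^ d * volume.real (ball (0 : Eucl d) 1)) ^ (1 - 1 / q) * ‖g‖ *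
        s ^ (-(1 - d / q) - 1) := by
  have hq : 1 < q := Fact.out
  have hM0 : 0 ≤ M := (abs_nonneg _).trans (hM 0)
  set V := volume.real (ball (0 : Eucl d) 1) with hV
  have hV0 : 0 ≤ V := measureReal_nonneg
  let B := closedBall y (R / s)
  have hBv : volume.real B = (R / s) ^ d * V := by
    rw [Measure.addHaar_real_closedBall _ _ (by positivity)]
    simp [hV]
  have hBfin : (volume.restrict Ω) B ≠ ⊤ :=
    ((Measure.restrict_le_self _).trans_lt measure_closedBall_lt_top).ne
  have hgi : Integrable (B.indicator fun x => ‖g x‖) (volume.restrict Ω) := by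
    rw [integrable_indicator_iff measurableSet_closedBall]
    have : IsFiniteMeasure ((volume.restrict Ω).restrict B) := ⟨by simpa using hBfin.lt_top⟩
    exact ((Lp.memLp g).restrict B).integrable Fact.out |>.norm
  have h1 : |∫ x in Ω, s ^ d * s⁻¹ * η (s • (x - y)) * inner ℝ (x - y) (g x)| ≤
      ∫ x in Ω, (s ^ d * s⁻¹ * M * (R / s)) * B.indicator (fun x => ‖g x‖) x := by
    rw [← Real.norm_eq_abs]
    refine norm_integral_le_of_norm_le (hgi.const_mul _) (.of_forall fun x => ?_)
    by_cases h0 : η (s • (x - y)) = 0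
    · rw [h0]
      simp only [mul_zero, zero_mul, norm_zero]
      have : 0 ≤ B.indicator (fun x => ‖g x‖) x := indicator_nonneg (fun _ _ => norm_nonneg _) x
      positivity
    · have h2 := hηR _ h0
      rw [norm_smul, Real.norm_of_nonneg hs.le] at h2
      have h3 : ‖x - y‖ ≤ R / s := by rwa [le_div_iff₀' hs]
      have h4 : x ∈ B := by rwa [mem_closedBall, dist_eq_norm]
      rw [indicator_of_mem h4, norm_mul, norm_mul,
        Real.norm_of_nonneg (show 0 ≤ s ^ d * s⁻¹ by positivity), Real.norm_eq_abs]
      calc s ^ d * s⁻¹ * |η (s • (x - y))| * ‖(inner ℝ (x - y) (g x) : ℝ)‖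
          ≤ s ^ d * s⁻¹ * M * (‖x - y‖ * ‖g x‖) := by
            gcongr
            · exact hM _
            · exact norm_inner_le_norm _ _
        _ ≤ s ^ d * s⁻¹ * M * (R / s * ‖g x‖) := by gcongr
        _ = _ := by ring
  rw [integral_const_mul, integral_indicator measurableSet_closedBall] at h1
  have h5 := setIntegral_norm_le_norm_mul_rpow hq g hBfin
  have hκ : 0 ≤ 1 - 1 / q := by
    rw [sub_nonneg, div_le_one (by linarith)]; exact hq.le
  have h6 : (volume.restrict Ω).real B ≤ (R / s) ^ d * V := by
    rw [← hBv]
    exact ENNReal.toReal_mono measure_closedBall_lt_top.ne (Measure.restrict_le_self _)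
  have h7 : ((R / s) ^ d * V) ^ (1 - 1 / q) =
      (R ^ d * V) ^ (1 - 1 / q) * s ^ (-(d : ℝ) * (1 - 1 / q)) := by
    rw [Real.rpow_mul hs.le, ← Real.mul_rpow (by positivity) (by positivity)]
    congr 1
    rw [Real.rpow_neg hs.le, Real.rpow_natCast, div_pow]
    field_simp
  calc _ ≤ _ := h1
    _ ≤ s ^ d * s⁻¹ * M * (R / s) * (‖g‖ * ((R / s) ^ d * V) ^ (1 - 1 / q)) := by
      gcongr
      exact h5.trans (by gcongr)
    _ = M * R * (R ^ d * V) ^ (1 - 1 / q) * ‖g‖ *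
        (s ^ d * s⁻¹ * s⁻¹ * s ^ (-(d : ℝ) * (1 - 1 / q))) := by rw [h7]; ring
    _ = _ := by
      congr 1
      rw [← Real.rpow_natCast, ← Real.rpow_neg_one, ← Real.rpow_add hs, ← Real.rpow_add hs,
        ← Real.rpow_add hs]
      congr 1
      field_simp
      ring

/-- Lebesgue differentiation for the averages `coneAverage`. -/
theorem ae_tendsto_coneAverage (hΩ : MeasurableSet Ω)
    {η u : Eucl d → ℝ} (hη : Continuous η) {M R : ℝ} (hR : 0 < R) (hM : ∀ z, |η z| ≤ M)
    (hηR : ∀ z, η z ≠ 0 → ‖z‖ ≤ R) (hη1 : ∫ z, η z = 1) (hu : Integrable u (volume.restrict Ω)) :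
    ∀ᵐ y ∂volume.restrict Ω,
      Tendsto (fun s => coneAverage Ω η u s y) atTop (𝓝 (u y)) := by
  have hM0 : 0 ≤ M := (abs_nonneg _).trans (hM 0)
  let U := Ω.indicator u
  have hU : Integrable U := (integrable_indicator_iff hΩ).2 hu
  set V := volume.real (ball (0 : Eucl d) 1) with hV
  have hae := IsUnifLocDoublingMeasure.ae_tendsto_average_norm_sub (volume : Measure (Eucl d))
    hU.locallyIntegrable 1
  rw [ae_restrict_iff' hΩ]
  filter_upwards [hae] with y hy hyΩ
  have hδ : Tendsto (fun s : ℝ => R / s) atTop (𝓝[>] 0) := by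
    refine tendsto_nhdsWithin_iff.2 ⟨tendsto_const_nhds.div_atTop tendsto_id, ?_⟩
    filter_upwards [eventually_gt_atTop 0] with s hs
    exact div_pos hR hs
  have hav := hy (fun _ => y) (fun s : ℝ => R / s) hδ (by
    filter_upwards [eventually_gt_atTop 0] with s hs
    exact mem_closedBall_self (by positivity))
  rw [tendsto_iff_norm_sub_tendsto_zero]
  have hlim := hav.const_mul (M * (R ^ d * V))
  rw [mul_zero] at hlim
  refine squeeze_zero' (.of_forall fun s => norm_nonneg _) ?_ hlim
  filter_upwards [eventually_gt_atTop 0] with s hs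
  let B := closedBall y (R / s)
  have hBv : volume.real B = (R / s) ^ d * V := by
    rw [Measure.addHaar_real_closedBall _ _ (by positivity)]
    simp [hV]
  have hV0 : 0 < V := by
    rw [hV, measureReal_def]
    exact ENNReal.toReal_pos (measure_ball_pos _ _ one_pos).ne' measure_ball_lt_top.ne
  have hηc : HasCompactSupport η := HasCompactSupport.of_support_subset_isCompact
    (isCompact_closedBall (0 : Eucl d) R) fun z hz => by simpa using hηR z hz
  have hKint : Integrable fun x => s ^ d * η (s • (x - y)) := by
    have h1 : Integrable η := hη.integrable_of_hasCompactSupport hηc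
    have h2 : Integrable fun x => η (s • x) := h1.comp_smul hs.ne'
    exact (h2.comp_sub_right y).const_mul _
  have hK1 : ∫ x, s ^ d * η (s • (x - y)) = 1 := by
    rw [integral_const_mul, integral_sub_right_eq_self (fun x => η (s • x)) y,
      Measure.integral_comp_smul, hη1]
    have : (0 : ℝ) < s ^ d := by positivity
    simp [abs_of_pos this, this.ne']
  have hKU : Integrable fun x => s ^ d * η (s • (x - y)) * U x := by
    refine hU.bdd_mul (c := s ^ d * M) hKint.aestronglyMeasurable (.of_forall fun x => ?_)
    rw [norm_mul, Real.norm_of_nonneg (by positivity)]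
    gcongr
    exact hM _
  have h1 : coneAverage Ω η u s y - u y = ∫ x, s ^ d * η (s • (x - y)) * (U x - U y) := by
    have e1 : coneAverage Ω η u s y = ∫ x, s ^ d * η (s • (x - y)) * U x := by
      rw [coneAverage, ← integral_indicator hΩ]
      refine integral_congr_ae (.of_forall fun x => ?_)
      by_cases hx : x ∈ Ω <;> simp [U, hx]
    have e2 : u y = U y := by simp [U, hyΩ]
    simp only [mul_sub]
    rw [integral_sub hKU (hKint.mul_const _), integral_mul_const, hK1, e1, e2, one_mul]
  have hUB : IntegrableOn (fun x => ‖U x - U y‖) B :=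
    (hU.integrableOn.sub (integrableOn_const measure_closedBall_lt_top.ne)).norm
  rw [h1]
  calc ‖∫ x, s ^ d * η (s • (x - y)) * (U x - U y)‖
      ≤ ∫ x, s ^ d * M * B.indicator (fun x => ‖U x - U y‖) x := by
        refine norm_integral_le_of_norm_le
          (((integrable_indicator_iff measurableSet_closedBall).2 hUB).const_mul _)
          (.of_forall fun x => ?_)
        by_cases h0 : η (s • (x - y)) = 0
        · rw [h0]
          simp only [mul_zero, zero_mul, norm_zero]
          have : 0 ≤ B.indicator (fun x => ‖U x - U y‖) x :=
            indicator_nonneg (fun _ _ => norm_nonneg _) x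
          positivity
        · have h2 := hηR _ h0
          rw [norm_smul, Real.norm_of_nonneg hs.le] at h2
          have h3 : ‖x - y‖ ≤ R / s := by rwa [le_div_iff₀' hs]
          have h4 : x ∈ B := by rwa [mem_closedBall, dist_eq_norm]
          rw [indicator_of_mem h4, norm_mul, norm_mul,
            Real.norm_of_nonneg (show 0 ≤ s ^ d by positivity)]
          gcongr
          exact hM _
    _ = M * (R ^ d * V) * ⨍ x in B, ‖U x - U y‖ := by
        rw [integral_const_mul, integral_indicator measurableSet_closedBall, setAverage_eq, hBv,
          smul_eq_mul, div_pow]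
        field_simp
        rfl

/-- Morrey's theorem near a point: the averages over small cones converge uniformly. -/
theorem exists_local_contRep (hopen : IsOpen Ω) (hbdd : Bornology.IsBounded Ω)
    (hsmooth : HasSmoothBoundary Ω) (hqd : (d : ℝ) < q) {x₀ : Eucl d} (hx₀ : x₀ ∈ closure Ω) :
    ∃ δ > 0, ∃ C : ℝ, ∀ m : Sobolev Ω q, ∃ F : Eucl d → ℝ,
      ContinuousOn F (ball x₀ δ ∩ closure Ω) ∧
      (∀ᵐ y ∂volume.restrict Ω, y ∈ ball x₀ δ → m.fn y = F y) ∧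
      ∀ y ∈ ball x₀ δ ∩ closure Ω, |F y| ≤ C * ‖m‖ := by
  have hq : 1 < q := Fact.out
  have hfin : IsFiniteMeasure (volume.restrict Ω) := ⟨by simpa using hbdd.measure_lt_top⟩
  obtain ⟨δ, hδ, e, ε, hε, h, hh, hcone⟩ := exists_cone hopen hsmooth hx₀
  let f : ContDiffBump e := ⟨ε / 4, ε / 2, by positivity, by linarith⟩
  let η : Eucl d → ℝ := f.normed volume
  have hη : ContDiff ℝ ∞ η := f.contDiff_normed
  have hηc : HasCompactSupport η := f.hasCompactSupport_normed
  have hη1 : ∫ z, η z = 1 := f.integral_normed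
  have hηs : tsupport η = closedBall e (ε / 2) := f.tsupport_normed_eq
  obtain ⟨M, hM⟩ := hη.continuous.bounded_above_of_compact_support hηc
  have hM0 : 0 ≤ M := (norm_nonneg _).trans (hM 0)
  let R := ‖e‖ + ε
  have hR : 0 < R := by positivity
  have hηR : ∀ z, η z ≠ 0 → ‖z‖ ≤ R := by
    intro z hz
    have h1 : z ∈ closedBall e (ε / 2) := hηs ▸ subset_tsupport η hz
    rw [mem_closedBall, dist_eq_norm] at h1
    have := norm_le_norm_add_norm_sub' z e
    simp only [R]
    linarith
  let γ := 1 - d / q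
  have hγ : 0 < γ := by
    have : d / q < 1 := (div_lt_one (by linarith)).2 hqd
    simp only [γ]; linarith
  let C₁ := M * R * (R ^ d * volume.real (ball (0 : Eucl d) 1)) ^ (1 - 1 / q)
  have hC₁ : 0 ≤ C₁ := by positivity
  let s₀ := h⁻¹
  have hs₀ : 0 < s₀ := by positivity
  let V := (volume.restrict Ω).real univ ^ (1 - 1 / q)
  refine ⟨δ, hδ, s₀ ^ d * M * V + C₁ / γ * s₀ ^ (-γ), fun m => ?_⟩
  have hfn : ‖m.fn‖ ≤ ‖m‖ := norm_fst_le (m : LpS Ω q × LpV Ω q)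
  have hgrad : ‖m.grad‖ ≤ ‖m‖ := norm_snd_le (m : LpS Ω q × LpV Ω q)
  set W := ball x₀ δ ∩ closure Ω with hW
  have hosc : ∀ y ∈ W, ∀ s t, s₀ ≤ s → s ≤ t →
      |coneAverage Ω η m.fn t y - coneAverage Ω η m.fn s y| ≤ C₁ * ‖m‖ / γ * s ^ (-γ) := by
    intro y hy s t hs hst
    refine abs_sub_le_of_abs_deriv_le_rpow hs₀ hγ (A := fun s => coneAverage Ω η m.fn s y)
      (fun s hs => hasDerivAt_coneAverage hη hηc m (hs₀.trans_le hs) y fun x hx => ?_)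
      (fun s hs => ?_) hs hst
    · have hs' : 0 < s := hs₀.trans_le hs
      have h1 := hcone y hy (s • (x - y)) (by
        rw [hηs] at hx
        exact closedBall_subset_ball (by linarith) hx) s⁻¹ (by positivity)
        (inv_le_of_inv_le₀ hh hs)
      rwa [smul_smul, inv_mul_cancel₀ hs'.ne', one_smul, add_sub_cancel] at h1
    · rw [abs_neg]
      refine (abs_integral_radial_le η hR.le hM hηR m.grad
        (hs₀.trans_le hs) y).trans ?_
      have := hs₀.trans_le hs
      change C₁ * ‖m.grad‖ * s ^ (-γ - 1) ≤ _
      gcongr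
  let sn : ℕ → ℝ := fun n => s₀ + n
  have hsn : Tendsto sn atTop atTop :=
    tendsto_atTop_add_const_left _ _ tendsto_natCast_atTop_atTop
  have hsn0 : ∀ n, s₀ ≤ sn n := fun n => by simp [sn]
  have hsn1 : Monotone sn := fun a b hab => by
    simp only [sn]
    gcongr
  let b : ℕ → ℝ := fun n => C₁ * ‖m‖ / γ * sn n ^ (-γ)
  have hb : Tendsto b atTop (𝓝 0) := by
    have := ((tendsto_rpow_neg_atTop hγ).comp hsn).const_mul (C₁ * ‖m‖ / γ)
    rwa [mul_zero] at this
  have hdist : ∀ y ∈ W, ∀ n k, n ≤ k →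
      dist (coneAverage Ω η m.fn (sn k) y) (coneAverage Ω η m.fn (sn n) y) ≤ b n :=
    fun y hy n k hnk => hosc y hy _ _ (hsn0 n) (hsn1 hnk)
  have hex : ∀ y, ∃ l, y ∈ W → Tendsto (fun n => coneAverage Ω η m.fn (sn n) y) atTop (𝓝 l) := by
    intro y
    by_cases hy : y ∈ W
    · have hcau : CauchySeq fun n => coneAverage Ω η m.fn (sn n) y := by
        refine cauchySeq_of_le_tendsto_0 (fun n => b n + b n) (fun n k N hn hk => ?_)
          (by simpa using hb.add hb)
        exact (dist_triangle_right _ _ _).trans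
          (add_le_add (hdist y hy N n hn) (hdist y hy N k hk))
      obtain ⟨l, hl⟩ := cauchySeq_tendsto_of_complete hcau
      exact ⟨l, fun _ => hl⟩
    · exact ⟨0, fun h => absurd h hy⟩
  choose F hF using hex
  have hFb : ∀ y ∈ W, ∀ n, dist (F y) (coneAverage Ω η m.fn (sn n) y) ≤ b n := by
    intro y hy n
    refine le_of_tendsto ((hF y hy).dist tendsto_const_nhds) ?_
    filter_upwards [eventually_ge_atTop n] with k hk using hdist y hy n k hk
  refine ⟨F, ?_, ?_, ?_⟩
  · have hunif : TendstoUniformlyOn (fun n y => coneAverage Ω η m.fn (sn n) y) F atTop W := by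
      rw [Metric.tendstoUniformlyOn_iff]
      intro ε' hε'
      filter_upwards [hb.eventually_lt_const hε'] with n hn y hy
      exact (hFb y hy n).trans_lt hn
    exact hunif.continuousOn (Frequently.of_forall fun n =>
      (continuous_coneAverage hη.continuous hM m.integrable_fn _).continuousOn)
  · filter_upwards [ae_tendsto_coneAverage hopen.measurableSet hη.continuous hR hM hηR hη1
      m.integrable_fn, ae_restrict_mem hopen.measurableSet] with y hy hyΩ hyδ
    exact tendsto_nhds_unique (hy.comp hsn) (hF y ⟨hyδ, subset_closure hyΩ⟩)
  · intro y hy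
    have h1 := hFb y hy 0
    have h2 := abs_coneAverage_le (η := η) hM m.integrable_fn hs₀.le y
    have h3 : ∫ x in Ω, |m.fn x| ≤ ‖m.fn‖ * V := by
      have := setIntegral_norm_le_norm_mul_rpow hq m.fn (measure_ne_top (volume.restrict Ω) univ)
      rwa [Measure.restrict_univ] at this
    have hs00 : sn 0 = s₀ := by simp [sn]
    simp only [b, hs00, Real.dist_eq] at h1
    have h4 : |F y| ≤ |F y - coneAverage Ω η m.fn s₀ y| + |coneAverage Ω η m.fn s₀ y| := by
      simpa using abs_add_le (F y - coneAverage Ω η m.fn s₀ y) (coneAverage Ω η m.fn s₀ y)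
    have hV0 : 0 ≤ V := by positivity
    calc |F y| ≤ C₁ * ‖m‖ / γ * s₀ ^ (-γ) + s₀ ^ d * M * (‖m‖ * V) := by
          refine h4.trans (add_le_add h1 (h2.trans ?_))
          have : ‖m.fn‖ * V ≤ ‖m‖ * V := by gcongr
          gcongr
          exact h3.trans this
      _ = _ := by ring

theorem eqOn_of_ae_eq (hopen : IsOpen Ω) {V : Set (Eucl d)} (hV : IsOpen V)
    {F G : Eucl d → ℝ} (hF : ContinuousOn F (V ∩ closure Ω)) (hG : ContinuousOn G (V ∩ closure Ω))
    (h : ∀ᵐ y ∂volume.restrict Ω, y ∈ V → F y = G y) : EqOn F G (V ∩ closure Ω) := by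
  have hsub : V ∩ Ω ⊆ V ∩ closure Ω := inter_subset_inter_right _ subset_closure
  have h1 : EqOn F G (V ∩ Ω) := by
    refine Measure.eqOn_open_of_ae_eq (μ := volume) ?_ (hV.inter hopen) (hF.mono hsub)
      (hG.mono hsub)
    rw [ae_restrict_iff' hopen.measurableSet] at h
    rw [Filter.EventuallyEq, ae_restrict_iff' (hV.inter hopen).measurableSet]
    filter_upwards [h] with y hy hyV using hy hyV.2 hyV.1
  exact h1.of_subset_closure hF hG hsub hV.inter_closure

/-- **Morrey's theorem**: for `q > d`, the elements of `W^{1,q}(Ω)` have a representative that is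
continuous on the closure of `Ω`, and its supremum is controlled by the Sobolev norm. -/
theorem exists_contRep (hopen : IsOpen Ω) (hbdd : Bornology.IsBounded Ω)
    (hsmooth : HasSmoothBoundary Ω) (hqd : (d : ℝ) < q) :
    ∃ C : ℝ, 0 ≤ C ∧ ∀ m : Sobolev Ω q, ∃ f, IsContRep m f ∧ ∀ y ∈ closure Ω, |f y| ≤ C * ‖m‖ := by
  choose! δ hδ C hloc using fun x (hx : x ∈ closure Ω) =>
    exists_local_contRep (q := q) hopen hbdd hsmooth hqd hx
  obtain ⟨t, htK, htc⟩ := hbdd.isCompact_closure.elim_nhds_subcover (fun x => ball x (δ x))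
    fun x hx => ball_mem_nhds x (hδ x hx)
  refine ⟨∑ x ∈ t, |C x|, Finset.sum_nonneg fun _ _ => abs_nonneg _, fun m => ?_⟩
  choose! F hFc hFae hFb using fun x (hx : x ∈ closure Ω) => hloc x hx m
  -- the local representatives agree on overlaps, by density of `Ω`
  have hagree : ∀ x ∈ closure Ω, ∀ y ∈ ball x (δ x) ∩ closure Ω, F y y = F x y := by
    intro x hx y hy
    refine eqOn_of_ae_eq hopen (isOpen_ball.inter isOpen_ball)
      (V := ball y (δ y) ∩ ball x (δ x))
      ((hFc y hy.2).mono (inter_subset_inter_left _ inter_subset_left))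
      ((hFc x hx).mono (inter_subset_inter_left _ inter_subset_right)) ?_
      ⟨⟨mem_ball_self (hδ y hy.2), hy.1⟩, hy.2⟩
    filter_upwards [hFae y hy.2, hFae x hx] with z h1 h2 hz
    rw [← h1 hz.1, ← h2 hz.2]
  refine ⟨fun y => F y y, ⟨fun x hx => ?_, ?_⟩, fun y hy => ?_⟩
  · have h1 := (hFc x hx).continuousWithinAt ⟨mem_ball_self (hδ x hx), hx⟩
    have h2 : ContinuousWithinAt (fun y => F y y) (ball x (δ x) ∩ closure Ω) x :=
      h1.congr (fun y hy => hagree x hx y hy) rfl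
    rw [inter_comm] at h2
    exact h2.mono_of_mem_nhdsWithin
      (inter_mem_nhdsWithin _ (ball_mem_nhds x (hδ x hx)))
  · have h1 : ∀ᵐ y ∂volume.restrict Ω, ∀ x ∈ t, y ∈ ball x (δ x) → m.fn y = F x y :=
      (Finset.eventually_all t).2 fun x hx => hFae x (htK x hx)
    filter_upwards [h1, ae_restrict_mem hopen.measurableSet] with y hy hyΩ
    obtain ⟨x, hxt, hxy⟩ := mem_iUnion₂.1 (htc (subset_closure hyΩ))
    rw [hy x hxt hxy, hagree x (htK x hxt) y ⟨hxy, subset_closure hyΩ⟩]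
  · obtain ⟨x, hxt, hxy⟩ := mem_iUnion₂.1 (htc hy)
    show |F y y| ≤ _
    rw [hagree x (htK x hxt) y ⟨hxy, hy⟩]
    refine (hFb x (htK x hxt) y ⟨hxy, hy⟩).trans ?_
    gcongr
    exact (le_abs_self _).trans
      (Finset.single_le_sum (f := fun x => |C x|) (fun _ _ => abs_nonneg _) hxt)

end Morrey

/-! ### Functionals given by measures -/

section Representation

variable {Ω : Set (Eucl d)} {q : ℝ} [Fact (1 < q)]

theorem IsContRep.eqOn (hopen : IsOpen Ω) {m : Sobolev Ω q} {f g : Eucl d → ℝ}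
    (hf : IsContRep m f) (hg : IsContRep m g) : EqOn f g (closure Ω) := by
  have h := eqOn_of_ae_eq hopen isOpen_univ (F := f) (G := g) (by simpa using hf.1)
    (by simpa using hg.1) (by filter_upwards [hf.2, hg.2] with x h1 h2 _ using h1.symm.trans h2)
  simpa using h

theorem IsContRep.add {m₁ m₂ : Sobolev Ω q} {f g : Eucl d → ℝ}
    (hf : IsContRep m₁ f) (hg : IsContRep m₂ g) : IsContRep (m₁ + m₂) (f + g) := by
  refine ⟨hf.1.add hg.1, ?_⟩
  filter_upwards [hf.2, hg.2, Lp.coeFn_add m₁.fn m₂.fn] with x h1 h2 h3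
  rw [Pi.add_apply, ← h1, ← h2]
  exact h3

theorem IsContRep.smul {m : Sobolev Ω q} {f : Eucl d → ℝ} (c : ℝ)
    (hf : IsContRep m f) : IsContRep (c • m) (c • f) := by
  refine ⟨hf.1.const_smul c, ?_⟩
  filter_upwards [hf.2, Lp.coeFn_smul c m.fn] with x h1 h3
  rw [Pi.smul_apply, ← h1]
  exact h3

/-- A continuous function that is nonnegative almost everywhere on `Ω` is so on its closure. -/
theorem nonneg_on_closure_of_ae (hopen : IsOpen Ω) {f : Eucl d → ℝ}
    (hf : ContinuousOn f (closure Ω)) (h : ∀ᵐ x ∂volume.restrict Ω, 0 ≤ f x) :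
    ∀ x ∈ closure Ω, 0 ≤ f x := by
  have h1 := eqOn_of_ae_eq hopen isOpen_univ (F := f) (G := fun x => |f x|) (by simpa using hf)
    (by simpa using hf.abs) (by filter_upwards [h] with x hx _ using (abs_of_nonneg hx).symm)
  intro x hx
  rw [h1 ⟨mem_univ x, hx⟩]
  exact abs_nonneg _

/-- The functional `α` on `W^{1,q}(Ω)` is `φ ↦ -∫ φ dν` for a finite measure `ν` on the closure
of `Ω`. -/
structure IsNegIntegral (α : StrongDual ℝ (Sobolev Ω q)) (ν : Measure (Eucl d)) : Prop where
  isFinite : IsFiniteMeasure ν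
  compl_closure : ν (closure Ω)ᶜ = 0
  apply_eq : ∀ (φ : Sobolev Ω q) (f : Eucl d → ℝ), IsContRep φ f → α φ = -∫ x, f x ∂ν

/-- The linear map sending an element of `W^{1,q}(Ω)` to its continuous representative. -/
theorem exists_linearMap_contRep (hopen : IsOpen Ω)
    (hrep : ∀ m : Sobolev Ω q, ∃ f, IsContRep m f) :
    ∃ J : Sobolev Ω q →ₗ[ℝ] C(closure Ω, ℝ), ∀ m f, IsContRep m f → ∀ x, J m x = f x := by
  choose F hF using hrep
  refine ⟨{ toFun := fun m => ⟨(closure Ω).domRestrict (F m), (hF m).1.domRestrict⟩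
            map_add' := fun m₁ m₂ => ?_
            map_smul' := fun c m => ?_ }, fun m f hf x => ?_⟩
  · ext x
    exact IsContRep.eqOn hopen (hF _) ((hF m₁).add (hF m₂)) x.2
  · ext x
    exact IsContRep.eqOn hopen (hF _) ((hF m).smul c) x.2
  · exact IsContRep.eqOn hopen (hF m) hf x.2

/-- A positive linear functional on continuous functions on a compact set of `ℝ^d` is the
integral against a finite measure. -/
theorem exists_measure_of_positive {K : Set (Eucl d)} (hK : IsCompact K) (g : C(K, ℝ) →ₗ[ℝ] ℝ)
    (hg : ∀ f, 0 ≤ f → 0 ≤ g f) :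
    ∃ ν : Measure (Eucl d), IsFiniteMeasure ν ∧ ν Kᶜ = 0 ∧
      ∀ (F : Eucl d → ℝ) (f : C(K, ℝ)), (∀ x, f x = F x) → g f = ∫ x, F x ∂ν := by
  have : CompactSpace K := isCompact_iff_compactSpace.1 hK
  let ι : CompactlySupportedContinuousMap K ℝ →ₗ[ℝ] C(K, ℝ) :=
    { toFun := fun f => f.toContinuousMap
      map_add' := fun _ _ => rfl
      map_smul' := fun _ _ => rfl }
  let Λ : CompactlySupportedContinuousMap K ℝ →ₚ[ℝ] ℝ :=
    PositiveLinearMap.mk₀ (g ∘ₗ ι) fun f hf => hg _ fun x => hf x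
  let ν₀ := RealRMK.rieszMeasure Λ
  have hfin : IsFiniteMeasure ν₀ := ⟨isCompact_univ.measure_lt_top⟩
  have hemb : MeasurableEmbedding (Subtype.val : K → Eucl d) :=
    MeasurableEmbedding.subtype_coe hK.isClosed.measurableSet
  refine ⟨ν₀.map Subtype.val, inferInstance, ?_, fun F f hf => ?_⟩
  · rw [hemb.map_apply]
    convert measure_empty (μ := ν₀)
    ext x
    simp
  · rw [hemb.integral_map]
    have h1 := RealRMK.integral_rieszMeasure Λ
      (CompactlySupportedContinuousMap.continuousMapEquiv f)
    have h2 : ∀ x : K, F x = CompactlySupportedContinuousMap.continuousMapEquiv f x :=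
      fun x => (hf x).symm
    simp only [h2]
    exact h1.symm

/-- A functional that is nonpositive on nonnegative functions is given by a measure: it extends to
the continuous functions on the closure by the M. Riesz extension theorem, and the extension is
represented by the Riesz-Markov-Kakutani theorem. -/
theorem exists_isNegIntegral (hopen : IsOpen Ω) (hbdd : Bornology.IsBounded Ω)
    (hrep : ∀ m : Sobolev Ω q, ∃ f, IsContRep m f) (α : StrongDual ℝ (Sobolev Ω q))
    (hα : ∀ φ : Sobolev Ω q, (∀ᵐ x ∂volume.restrict Ω, 0 ≤ φ.fn x) → α φ ≤ 0) :
    ∃ ν, IsNegIntegral α ν := by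
  obtain ⟨J, hJ⟩ := exists_linearMap_contRep hopen hrep
  have hpos : ∀ φ, 0 ≤ J φ → α φ ≤ 0 := by
    intro φ h
    obtain ⟨f, hf⟩ := hrep φ
    refine hα φ ?_
    filter_upwards [hf.2, ae_restrict_mem hopen.measurableSet] with x hx hxΩ
    rw [hx, ← hJ φ f hf ⟨x, subset_closure hxΩ⟩]
    exact h _
  let a : Sobolev Ω q →ₗ[ℝ] ℝ := -(α : Sobolev Ω q →ₗ[ℝ] ℝ)
  have ha : ∀ φ, a φ = -α φ := fun φ => rfl
  have hker : LinearMap.ker J ≤ LinearMap.ker a := by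
    intro φ hφ
    rw [LinearMap.mem_ker] at hφ ⊢
    have h1 := hpos φ hφ.ge
    have h2 := hpos (-φ) (by rw [map_neg, hφ, neg_zero])
    rw [map_neg] at h2
    rw [ha]
    linarith
  let T : C(closure Ω, ℝ) →ₗ.[ℝ] ℝ :=
    ⟨LinearMap.range J, (LinearMap.ker J).liftQ a hker ∘ₗ J.quotKerEquivRange.symm.toLinearMap⟩
  have hT : ∀ φ, T ⟨J φ, LinearMap.mem_range_self J φ⟩ = -α φ := by
    intro φ
    show (LinearMap.ker J).liftQ a hker (J.quotKerEquivRange.symm _) = _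
    rw [LinearMap.quotKerEquivRange_symm_apply_image]
    rfl
  obtain ⟨one, hone⟩ := exists_sobolev_of_contDiff hbdd q (φ := fun _ => 1) contDiff_const
  have hJ1 : ∀ x, J one x = 1 := hJ one (fun _ => 1) ⟨continuousOn_const, hone⟩
  have : CompactSpace (closure Ω) := isCompact_iff_compactSpace.1 hbdd.isCompact_closure
  obtain ⟨g, hgT, hg0⟩ := riesz_extension (PointedCone.positive ℝ C(closure Ω, ℝ)) T
    (by
      rintro ⟨_, φ, rfl⟩ h
      rw [hT]
      have := hpos φ h
      linarith)
    (by
      intro y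
      refine ⟨⟨J (‖y‖ • one), LinearMap.mem_range_self J _⟩, ?_⟩
      rw [PointedCone.mem_positive]
      intro x
      have h1 := (abs_le.1 (y.norm_coe_le_norm x)).1
      have h2 : J (‖y‖ • one) x = ‖y‖ := by
        rw [map_smul, ContinuousMap.smul_apply, hJ1, smul_eq_mul, mul_one]
      show 0 ≤ J (‖y‖ • one) x + y x
      linarith)
  obtain ⟨ν, hν1, hν2, hν3⟩ := exists_measure_of_positive hbdd.isCompact_closure g
    fun f hf => hg0 f hf
  refine ⟨ν, hν1, hν2, fun φ f hf => ?_⟩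
  rw [← hν3 f (J φ) (hJ φ f hf), eq_neg_iff_add_eq_zero, hgT ⟨J φ, LinearMap.mem_range_self J φ⟩,
    hT]
  ring

variable {α : StrongDual ℝ (Sobolev Ω q)} {ν : Measure (Eucl d)}

theorem IsNegIntegral.integral_congr (h : IsNegIntegral α ν) {f g : Eucl d → ℝ}
    (hfg : EqOn f g (closure Ω)) : ∫ x, f x ∂ν = ∫ x, g x ∂ν := by
  refine integral_congr_ae ?_
  have h1 : ∀ᵐ x ∂ν, x ∈ closure Ω := by
    rw [ae_iff]; exact h.compl_closure
  filter_upwards [h1] with x hx using hfg hx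

theorem IsNegIntegral.isRepresentedBy (hrep : ∀ m : Sobolev Ω q, ∃ f, IsContRep m f)
    (h : IsNegIntegral α ν) :
    have := h.isFinite
    IsRepresentedBy α (-ν.toSignedMeasure) := by
  have := h.isFinite
  have hj : (-ν.toSignedMeasure).toJordanDecomposition =
      ⟨0, ν, Measure.MutuallySingular.zero_left⟩ := by
    refine SignedMeasure.toJordanDecomposition_eq ?_
    rw [JordanDecomposition.toSignedMeasure]
    simp
  refine ⟨fun B hB hBΩ => ?_, fun φ => ?_⟩
  · rw [_root_.neg_apply, Measure.toSignedMeasure_apply_measurable hB, measureReal_def,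
      measure_mono_null (subset_compl_iff_disjoint_right.2 hBΩ) h.compl_closure]
    simp
  · obtain ⟨f, hf⟩ := hrep φ
    refine ⟨f, hf, ?_⟩
    rw [signedIntegral, hj, h.apply_eq φ f hf]
    simp

/-- The measure representing a functional on `W^{1,q}(Ω)` is unique. -/
theorem IsNegIntegral.eq_of_isRepresentedBy (hopen : IsOpen Ω) (hbdd : Bornology.IsBounded Ω)
    (h : IsNegIntegral α ν) {μ : SignedMeasure (Eucl d)} (hμ : IsRepresentedBy α μ)
    {B : Set (Eucl d)} (hB : MeasurableSet B) : μ B = -ν.real B := by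
  have := h.isFinite
  have hcl : MeasurableSet (closure Ω) := isClosed_closure.measurableSet
  set j := μ.toJordanDecomposition with hj
  have hnull : j.posPart (closure Ω)ᶜ = 0 ∧ j.negPart (closure Ω)ᶜ = 0 := by
    obtain ⟨i, hi1, hi2, hi3, hp, hn⟩ := μ.toJordanDecomposition_spec
    constructor
    · rw [hj, hp, SignedMeasure.toMeasureOfZeroLE_apply _ _ _ hcl.compl]
      have := hμ.1 (i ∩ (closure Ω)ᶜ) (hi1.inter hcl.compl)
        (disjoint_compl_left.mono_left inter_subset_right)
      simp [this]
    · rw [hj, hn, SignedMeasure.toMeasureOfLEZero_apply _ _ _ hcl.compl]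
      have := hμ.1 (iᶜ ∩ (closure Ω)ᶜ) (hi1.compl.inter hcl.compl)
        (disjoint_compl_left.mono_left inter_subset_right)
      simp [this]
  have hint : ∀ φ : Eucl d → ℝ, ContDiff ℝ ∞ φ → (∀ x, φ x ∈ Icc (0 : ℝ) 1) →
      ∫ x, φ x ∂(j.posPart + ν) = ∫ x, φ x ∂j.negPart := by
    intro φ hφ hφ01
    have hi : ∀ ρ : Measure (Eucl d), IsFiniteMeasure ρ → Integrable φ ρ := fun ρ _ =>
      Integrable.of_bound hφ.continuous.aestronglyMeasurable 1 (.of_forall fun x => by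
        rw [Real.norm_eq_abs, abs_of_nonneg (hφ01 x).1]; exact (hφ01 x).2)
    obtain ⟨m, hm⟩ := exists_sobolev_of_contDiff hbdd q hφ
    have hmφ : IsContRep m φ := ⟨hφ.continuous.continuousOn, hm⟩
    obtain ⟨f, hf, hαf⟩ := hμ.2 m
    have hfφ := hf.eqOn hopen hmφ
    have e : ∀ ρ : Measure (Eucl d), ρ (closure Ω)ᶜ = 0 → ∫ x, f x ∂ρ = ∫ x, φ x ∂ρ := by
      intro ρ hρ
      have h1 : ∀ᵐ x ∂ρ, x ∈ closure Ω := by rw [ae_iff]; exact hρ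
      exact integral_congr_ae (by filter_upwards [h1] with x hx using hfφ hx)
    rw [h.apply_eq m φ hmφ, signedIntegral, e _ hnull.1, e _ hnull.2] at hαf
    rw [integral_add_measure (hi _ inferInstance) (hi _ inferInstance)]
    linarith
  have heq : j.posPart + ν = j.negPart := le_antisymm
    (measure_le_of_forall_integral_contDiff_le fun φ h1 h2 => (hint φ h1 h2).le)
    (measure_le_of_forall_integral_contDiff_le fun φ h1 h2 => (hint φ h1 h2).ge)
  have hval : μ B = j.posPart.real B - j.negPart.real B := by
    conv_lhs => rw [← μ.toSignedMeasure_toJordanDecomposition]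
    rw [JordanDecomposition.toSignedMeasure, _root_.sub_apply,
      Measure.toSignedMeasure_apply_measurable hB, Measure.toSignedMeasure_apply_measurable hB]
  rw [hval, ← heq, measureReal_add_apply]
  ring

end Representation

/-! ### The energy density -/

section Young

theorem norm_rpow_sub_two_smul {F : Type*} [NormedAddCommGroup F] [NormedSpace ℝ F] {r : ℝ}
    (hr : 1 < r) (v : F) : ‖‖v‖ ^ (r - 2) • v‖ = ‖v‖ ^ (r - 1) := by
  rcases eq_or_ne v 0 with rfl | hv
  · simp [Real.zero_rpow (by linarith : r - 1 ≠ 0)]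
  · have h0 : 0 < ‖v‖ := norm_pos_iff.2 hv
    rw [norm_smul, Real.norm_of_nonneg (by positivity)]
    nth_rewrite 2 [← Real.rpow_one ‖v‖]
    rw [← Real.rpow_add h0]
    congr 1
    ring

theorem norm_rpow_sub_two_smul_rpow {F : Type*} [NormedAddCommGroup F] [NormedSpace ℝ F]
    {r r' : ℝ} (h : r.HolderConjugate r') (v : F) : ‖‖v‖ ^ (r - 2) • v‖ ^ r' = ‖v‖ ^ r := by
  rw [norm_rpow_sub_two_smul h.lt, ← Real.rpow_mul (norm_nonneg _), h.sub_one_mul_conj]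

theorem inner_rpow_sub_two_smul_self {r : ℝ} (hr : 1 < r) (v : Eucl d) :
    inner ℝ (‖v‖ ^ (r - 2) • v) v = ‖v‖ ^ r := by
  rcases eq_or_ne v 0 with rfl | hv
  · simp [Real.zero_rpow (by linarith : r ≠ 0)]
  · have h0 : 0 < ‖v‖ := norm_pos_iff.2 hv
    rw [real_inner_smul_left, real_inner_self_eq_norm_sq, ← Real.rpow_natCast,
      ← Real.rpow_add h0]
    congr 1
    push_cast
    ring

/-- Young's inequality for vectors. -/
theorem inner_le_rpow_add_rpow {r r' : ℝ} (h : r.HolderConjugate r') (b v : Eucl d) :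
    inner ℝ b v ≤ 1 / r' * ‖b‖ ^ r' + 1 / r * ‖v‖ ^ r := by
  have h1 := Real.young_inequality_of_nonneg (norm_nonneg b) (norm_nonneg v) h.symm
  have h2 := real_inner_le_norm b v
  calc inner ℝ b v ≤ _ := h2.trans h1
    _ = _ := by ring

/-- The equality case in Young's inequality: the norm of `b` minimizes
`x ↦ x ^ r' / r' - x ‖v‖`. -/
theorem eq_of_inner_eq_rpow_add_rpow {r r' : ℝ} (h : r.HolderConjugate r') {b v : Eucl d}
    (hbv : inner ℝ b v = 1 / r' * ‖b‖ ^ r' + 1 / r * ‖v‖ ^ r) : b = ‖v‖ ^ (r - 2) • v := by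
  have hr := h.lt
  have hr' := h.symm.lt
  have hr0 : r ≠ 0 := by linarith
  have hy : ∀ x : ℝ, 0 ≤ x → x * ‖v‖ ≤ 1 / r' * x ^ r' + 1 / r * ‖v‖ ^ r := by
    intro x hx
    have := Real.young_inequality_of_nonneg hx (norm_nonneg v) h.symm
    linarith [this, show x ^ r' / r' + ‖v‖ ^ r / r = 1 / r' * x ^ r' + 1 / r * ‖v‖ ^ r by ring]
  have hin := real_inner_le_norm b v
  have heq : inner ℝ b v = ‖b‖ * ‖v‖ := le_antisymm hin (hbv ▸ hy _ (norm_nonneg b))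
  have hnorm : ‖b‖ ^ (r' - 1) = ‖v‖ := by
    rcases (norm_nonneg b).eq_or_lt with h0 | h0
    · rw [heq, ← h0, zero_mul, Real.zero_rpow (by linarith), mul_zero, zero_add] at hbv
      have h1 : ‖v‖ ^ r = 0 := by
        have : (1 / r) ≠ 0 := by positivity
        rcases mul_eq_zero.1 hbv.symm with h2 | h2
        · exact absurd h2 this
        · exact h2
      rw [(Real.rpow_eq_zero (norm_nonneg v) hr0).1 h1, ← h0, Real.zero_rpow (by linarith)]
    · have hd : HasDerivAt (fun x : ℝ => 1 / r' * x ^ r' - x * ‖v‖)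
          (1 / r' * (r' * ‖b‖ ^ (r' - 1)) - 1 * ‖v‖) ‖b‖ :=
        ((Real.hasDerivAt_rpow_const (Or.inl h0.ne')).const_mul _).sub
          ((hasDerivAt_id _).mul_const _)
      have hmin : IsLocalMin (fun x : ℝ => 1 / r' * x ^ r' - x * ‖v‖) ‖b‖ := by
        filter_upwards [Ioi_mem_nhds h0] with x hx
        have := hy x (le_of_lt hx)
        rw [heq] at hbv
        linarith
      have := hmin.hasDerivAt_eq_zero hd
      rw [← mul_assoc, one_div, inv_mul_cancel₀ (by linarith)] at this
      linarith
  have hb : ‖b‖ = ‖v‖ ^ (r - 1) := by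
    rw [← hnorm, ← Real.rpow_mul (norm_nonneg b)]
    have : (r' - 1) * (r - 1) = 1 := by
      have h1 := h.sub_one_mul_conj
      linarith
    rw [this, Real.rpow_one]
  rcases eq_or_ne v 0 with rfl | hv
  · have : ‖b‖ = 0 := by rw [hb, norm_zero, Real.zero_rpow (by linarith)]
    simp [norm_eq_zero.1 this]
  · have h0 : 0 < ‖v‖ := norm_pos_iff.2 hv
    have h1 := inner_eq_norm_mul_iff_real.1 heq
    rw [← smul_right_inj h0.ne', h1, smul_smul, hb]
    congr 1
    nth_rewrite 2 [← Real.rpow_one ‖v‖]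
    rw [← Real.rpow_add h0]
    congr 1
    ring

end Young

section Ell

theorem ell_of_pos {r : ℝ} {a : ℝ} (ha : 0 < a) (b : Eucl d) :
    ell r a b = ENNReal.ofReal (a * (1 / r * ‖a⁻¹ • b‖ ^ r)) := by
  rw [ell, if_pos ha, norm_smul, norm_inv, Real.norm_of_nonneg ha.le,
    Real.mul_rpow (by positivity) (norm_nonneg _), Real.inv_rpow ha.le, Real.rpow_sub_one ha.ne']
  congr 1
  field_simp

theorem ell_zero_zero (r : ℝ) : ell r 0 (0 : Eucl d) = 0 := by simp [ell]

theorem ell_of_not_pos {r a : ℝ} {b : Eucl d} (ha : ¬0 < a) (hab : ¬(a = 0 ∧ b = 0)) :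
    ell r a b = ⊤ := by
  rw [ell, if_neg ha, if_neg hab]

theorem ell_smul {r c : ℝ} (hc : 0 < c) (a : ℝ) (b : Eucl d) :
    ell r (c * a) (c • b) = ENNReal.ofReal c * ell r a b := by
  by_cases ha : 0 < a
  · rw [ell_of_pos (mul_pos hc ha), ell_of_pos ha, ← ENNReal.ofReal_mul hc.le, smul_smul]
    congr 1
    rw [show (c * a)⁻¹ * c = a⁻¹ by field_simp]
    ring
  · have h1 : ¬0 < c * a := fun h => ha (pos_of_mul_pos_right h hc.le)
    by_cases hab : a = 0 ∧ b = 0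
    · rw [hab.1, hab.2, mul_zero, smul_zero, ell_zero_zero, mul_zero]
    · rw [ell_of_not_pos ha hab, ell_of_not_pos h1, ENNReal.mul_top (by simpa using hc)]
      rintro ⟨h2, h3⟩
      exact hab ⟨(mul_eq_zero.1 h2).resolve_left hc.ne', (smul_eq_zero.1 h3).resolve_left hc.ne'⟩

/-- `ell r a` is the support function, in the direction `(a, b)`, of the convex set
`{α + ‖β‖ ^ r' / r' ≤ 0}`: the easy inequality. -/
theorem ofReal_le_ell {r r' : ℝ} (h : r.HolderConjugate r') {α : ℝ} {β : Eucl d}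
    (hαβ : α + 1 / r' * ‖β‖ ^ r' ≤ 0) (a : ℝ) (b : Eucl d) :
    ENNReal.ofReal (α * a + inner ℝ β b) ≤ ell r a b := by
  by_cases ha : 0 < a
  · rw [ell_of_pos ha]
    refine ENNReal.ofReal_le_ofReal ?_
    have h1 := inner_le_rpow_add_rpow h β (a⁻¹ • b)
    have h2 : inner ℝ β b = a * inner ℝ β (a⁻¹ • b) := by
      rw [real_inner_smul_right]
      field_simp
    rw [h2]
    nlinarith
  · by_cases hab : a = 0 ∧ b = 0
    · simp [hab.1, hab.2]
    · rw [ell_of_not_pos ha hab]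
      exact le_top

end Ell

section Duality

open Filter

/-- The field used to recover `ell r a b` as a supremum over bounded fields: for `a > 0` the field
conjugate to `a⁻¹ • b`, cut off where `a` is small or `b` is large; for `a = 0` a multiple of `b` of
norm `n`, which tests that `b = 0`. -/
def optField (r : ℝ) (n : ℕ) (a : ℝ) (b : Eucl d) : Eucl d :=
  open Classical in
  if a < 0 then 0
  else if a = 0 then (n / ‖b‖) • b
  else if (n + 1 : ℝ)⁻¹ ≤ a ∧ ‖b‖ ≤ n then ‖a⁻¹ • b‖ ^ (r - 2) • a⁻¹ • b else 0

/-- The function such that `(optDensity r n a b, optField r n a b)` satisfies the constraint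
defining `setA` and nearly attains the supremum defining `ell r a b`; for `a < 0` the value `-n`
tests that `a` is nonnegative. -/
def optDensity (r : ℝ) (n : ℕ) (a : ℝ) (b : Eucl d) : ℝ :=
  open Classical in
  if a < 0 then -n else -(1 / r.conjExponent * ‖optField r n a b‖ ^ r.conjExponent)

variable {r : ℝ}

theorem optDensity_add_le (n : ℕ) (a : ℝ) (b : Eucl d) (hr : 1 < r) :
    optDensity r n a b + 1 / r.conjExponent * ‖optField r n a b‖ ^ r.conjExponent ≤ 0 := by
  have hr' := (Real.HolderConjugate.conjExponent hr).symm.pos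
  by_cases ha : a < 0
  · simp [optDensity, optField, ha, Real.zero_rpow hr'.ne']
  · simp [optDensity, ha]

theorem measurable_optField (r : ℝ) (n : ℕ) :
    Measurable fun p : ℝ × Eucl d => optField r n p.1 p.2 := by
  unfold optField
  refine Measurable.ite (measurableSet_lt measurable_fst measurable_const) measurable_const
    (Measurable.ite (measurableSet_eq_fun measurable_fst measurable_const) (by fun_prop)
      (Measurable.ite ?_ (by fun_prop) measurable_const))
  exact (measurableSet_le measurable_const measurable_fst).inter
    (measurableSet_le measurable_snd.norm measurable_const)

theorem measurable_optDensity (r : ℝ) (n : ℕ) :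
    Measurable fun p : ℝ × Eucl d => optDensity r n p.1 p.2 := by
  unfold optDensity
  exact Measurable.ite (measurableSet_lt measurable_fst measurable_const) measurable_const
    ((((measurable_optField r n).norm.pow_const _).const_mul _).neg)

theorem norm_optField_le (hr : 1 < r) (n : ℕ) (a : ℝ) (b : Eucl d) :
    ‖optField r n a b‖ ≤ n + ((n + 1) * n : ℝ) ^ (r - 1) := by
  have h0 : (0 : ℝ) ≤ ((n + 1) * n : ℝ) ^ (r - 1) := by positivity
  have hn : (0 : ℝ) ≤ n := by positivity
  unfold optField
  split_ifs with h1 h2 h3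
  · rw [norm_zero]; positivity
  · rw [norm_smul, norm_div, norm_norm, Real.norm_of_nonneg hn]
    have : n / ‖b‖ * ‖b‖ ≤ n := by
      rcases eq_or_ne ‖b‖ 0 with h | h
      · simp [h]
      · rw [div_mul_cancel₀ _ h]
    linarith
  · rw [norm_rpow_sub_two_smul hr]
    have h4 : ‖a⁻¹ • b‖ ≤ (n + 1) * n := by
      have ha : 0 < a := lt_of_lt_of_le (by positivity) h3.1
      rw [norm_smul, norm_inv, Real.norm_of_nonneg ha.le]
      exact mul_le_mul (inv_le_of_inv_le₀ (by positivity) h3.1) h3.2 (norm_nonneg b) (by positivity)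
    have := Real.rpow_le_rpow (norm_nonneg _) h4 (by linarith : 0 ≤ r - 1)
    linarith
  · rw [norm_zero]; positivity

theorem abs_optDensity_le (hr : 1 < r) (n : ℕ) (a : ℝ) (b : Eucl d) :
    |optDensity r n a b| ≤ n + 1 / r.conjExponent *
      (n + ((n + 1) * n : ℝ) ^ (r - 1)) ^ r.conjExponent := by
  have hr' := (Real.HolderConjugate.conjExponent hr).symm.pos
  have h0 : 0 ≤ 1 / r.conjExponent * (n + ((n + 1) * n : ℝ) ^ (r - 1)) ^ r.conjExponent := by
    positivity
  have hn : (0 : ℝ) ≤ n := by positivity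
  unfold optDensity
  split_ifs
  · rw [abs_neg, abs_of_nonneg hn]
    linarith
  · rw [abs_neg, abs_of_nonneg (by positivity)]
    have := Real.rpow_le_rpow (norm_nonneg _) (norm_optField_le hr n a b) hr'.le
    have h2 : 1 / r.conjExponent * ‖optField r n a b‖ ^ r.conjExponent ≤
        1 / r.conjExponent * (n + ((n + 1) * n : ℝ) ^ (r - 1)) ^ r.conjExponent := by gcongr
    linarith

theorem optDensity_mul_add_of_mem (hr : 1 < r) {n : ℕ} {a : ℝ} {b : Eucl d} (ha : 0 < a)
    (h : (n + 1 : ℝ)⁻¹ ≤ a ∧ ‖b‖ ≤ n) :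
    optDensity r n a b * a + inner ℝ (optField r n a b) b = a * (1 / r * ‖a⁻¹ • b‖ ^ r) := by
  have hc := Real.HolderConjugate.conjExponent hr
  have h1 : optField r n a b = ‖a⁻¹ • b‖ ^ (r - 2) • a⁻¹ • b := by
    rw [optField, if_neg ha.not_gt, if_neg ha.ne', if_pos h]
  have h2 : optDensity r n a b = -(1 / r.conjExponent * ‖a⁻¹ • b‖ ^ r) := by
    rw [optDensity, if_neg ha.not_gt, h1, norm_rpow_sub_two_smul_rpow hc]
  have h3 : inner ℝ (optField r n a b) b = a * ‖a⁻¹ • b‖ ^ r := by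
    rw [← inner_rpow_sub_two_smul_self hr, h1, real_inner_smul_right (_ • _) b a⁻¹]
    field_simp
  have h4 : 1 / r.conjExponent = 1 - 1 / r := by
    have := hc.inv_add_inv_eq_one
    rw [one_div, one_div]; linarith
  rw [h2, h3, h4]
  ring

theorem optDensity_mul_add_nonneg (hr : 1 < r) (n : ℕ) (a : ℝ) (b : Eucl d) :
    0 ≤ optDensity r n a b * a + inner ℝ (optField r n a b) b := by
  have hr' := (Real.HolderConjugate.conjExponent hr).symm.pos
  have hn : (0 : ℝ) ≤ n := by positivity
  rcases lt_trichotomy a 0 with ha | rfl | ha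
  · simp only [optDensity, optField, if_pos ha, inner_zero_left]
    nlinarith
  · rw [mul_zero, zero_add, optField, if_neg (lt_irrefl _), if_pos rfl, real_inner_smul_left,
      real_inner_self_eq_norm_sq]
    positivity
  · by_cases h : (n + 1 : ℝ)⁻¹ ≤ a ∧ ‖b‖ ≤ n
    · rw [optDensity_mul_add_of_mem hr ha h]
      positivity
    · have h1 : optField r n a b = 0 := by
        rw [optField, if_neg ha.not_gt, if_neg ha.ne', if_neg h]
      rw [optDensity, if_neg ha.not_gt, h1]
      simp [Real.zero_rpow hr'.ne']

theorem tendsto_optDensity_mul_add (hr : 1 < r) (a : ℝ) (b : Eucl d) :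
    Tendsto (fun n => ENNReal.ofReal (optDensity r n a b * a + inner ℝ (optField r n a b) b))
      atTop (𝓝 (ell r a b)) := by
  rcases lt_trichotomy a 0 with ha | rfl | ha
  · rw [ell_of_not_pos ha.not_gt fun h => ha.ne h.1]
    simp only [optDensity, optField, if_pos ha, inner_zero_left, add_zero]
    refine ENNReal.tendsto_ofReal_atTop.comp ?_
    have := tendsto_natCast_atTop_atTop (R := ℝ) |>.atTop_mul_const (neg_pos.2 ha)
    exact this.congr fun n => by ring
  · simp only [mul_zero, zero_add, optField, lt_irrefl, if_false, if_true, real_inner_smul_left,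
      real_inner_self_eq_norm_sq]
    by_cases hb : b = 0
    · simp [hb, ell_zero_zero]
    · rw [ell_of_not_pos (lt_irrefl _) fun h => hb h.2]
      have hb0 : 0 < ‖b‖ := norm_pos_iff.2 hb
      refine ENNReal.tendsto_ofReal_atTop.comp ?_
      have := tendsto_natCast_atTop_atTop (R := ℝ) |>.atTop_mul_const hb0
      exact this.congr fun n => by field_simp
  · rw [ell_of_pos ha]
    refine tendsto_const_nhds.congr' ?_
    have h1 : ∀ᶠ n : ℕ in atTop, (n + 1 : ℝ)⁻¹ ≤ a := by
      have : Tendsto (fun n : ℕ => (n + 1 : ℝ)⁻¹) atTop (𝓝 0) := by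
        simpa using tendsto_one_div_add_atTop_nhds_zero_nat (𝕜 := ℝ)
      exact this.eventually_le_const ha
    have h2 : ∀ᶠ n : ℕ in atTop, ‖b‖ ≤ n :=
      tendsto_natCast_atTop_atTop.eventually_ge_atTop ‖b‖
    filter_upwards [h1, h2] with n hn1 hn2
    rw [optDensity_mul_add_of_mem hr ha ⟨hn1, hn2⟩]

end Duality

/-! ### The energy as a support function -/

section Polar

open Filter

variable {Ω : Set (Eucl d)} {q r : ℝ} [Fact (1 < q)]

theorem coe_integral_le_energy {m : Sobolev Ω q} {w : LpV Ω q} {F : Eucl d → ℝ}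
    (hF : Integrable F (volume.restrict Ω))
    (h : ∀ᵐ x ∂volume.restrict Ω, ENNReal.ofReal (F x) ≤ ell r (m.fn x) (w x)) :
    ((∫ x in Ω, F x : ℝ) : EReal) ≤ energy r m w := by
  have h1 : ∫ x in Ω, F x ≤ (∫⁻ x in Ω, ENNReal.ofReal (F x)).toReal := by
    rw [integral_eq_lintegral_pos_part_sub_lintegral_neg_part hF]
    exact sub_le_self _ ENNReal.toReal_nonneg
  have h2 : ∫⁻ x in Ω, ENNReal.ofReal (F x) ≤ energy r m w := lintegral_mono_ae h
  have h3 : (∫⁻ x in Ω, ENNReal.ofReal (F x)) ≠ ⊤ := by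
    have := hF.2
    refine ((lintegral_mono fun x => ?_).trans_lt this).ne
    rw [← ofReal_norm]
    exact ENNReal.ofReal_le_ofReal (le_abs_self _)
  calc ((∫ x in Ω, F x : ℝ) : EReal) ≤ ((∫⁻ x in Ω, ENNReal.ofReal (F x)).toReal : ℝ) := by
        exact_mod_cast h1
    _ = ((∫⁻ x in Ω, ENNReal.ofReal (F x) : ℝ≥0∞) : EReal) := EReal.coe_ennreal_toReal h3
    _ ≤ _ := by exact_mod_cast h2

theorem integrable_inner_of_memLp {b c : Eucl d → Eucl d}
    (hb : MemLp b (ENNReal.ofReal q.conjExponent) (volume.restrict Ω))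
    (hc : MemLp c (ENNReal.ofReal q) (volume.restrict Ω)) :
    Integrable (fun x => inner ℝ (b x) (c x)) (volume.restrict Ω) := by
  have := (holderConjugate_conjExponent q).symm.ennrealOfReal
  refine (hb.norm.integrable_mul hc.norm).mono' (hb.1.inner hc.1) (.of_forall fun x => ?_)
  exact norm_inner_le_norm _ _

theorem pairing_sub_right (p : DualPair Ω q) (m m' : Sobolev Ω q) (w w' : LpV Ω q) :
    pairing p (m - m') (w - w') = pairing p m w - pairing p m' w' := by
  rw [pairing_eq, pairing_eq, pairing_eq, map_sub, map_sub]
  ring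

theorem pairing_smul_right (p : DualPair Ω q) (c : ℝ) (m : Sobolev Ω q) (w : LpV Ω q) :
    pairing p (c • m) (c • w) = c * pairing p m w := by
  rw [pairing_eq, pairing_eq, map_smul, map_smul, smul_eq_mul, smul_eq_mul]
  ring

theorem continuous_eval_add_eval {E F G : Type*} [NormedAddCommGroup E] [NormedSpace ℝ E]
    [NormedAddCommGroup F] [NormedSpace ℝ F] [NormedAddCommGroup G] [NormedSpace ℝ G]
    (B : G →L[ℝ] F →L[ℝ] ℝ) (m : E) (w : F) :
    Continuous fun p : StrongDual ℝ E × G => p.1 m + B p.2 w := by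
  fun_prop

theorem continuous_pairing (m : Sobolev Ω q) (w : LpV Ω q) :
    Continuous fun p : DualPair Ω q => pairing p m w := by
  simp only [pairing_eq]
  exact continuous_eval_add_eval (E := Sobolev Ω q) (F := LpV Ω q) (pairV Ω q) m w

theorem energy_smul {c : ℝ} (hc : 0 < c) (m : Sobolev Ω q) (w : LpV Ω q) :
    energy r (c • m) (c • w) = ENNReal.ofReal c * energy r m w := by
  rw [energy, energy, ← lintegral_const_mul' _ _ ENNReal.ofReal_ne_top]
  refine lintegral_congr_ae ?_
  filter_upwards [Lp.coeFn_smul c m.fn, Lp.coeFn_smul c w] with x h1 h2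
  rw [← ell_smul hc]
  exact congrArg₂ (ell r) h1 h2

theorem energy_zero : energy r (0 : Sobolev Ω q) (0 : LpV Ω q) = 0 := by
  rw [energy, lintegral_eq_zero_of_ae_eq_zero]
  filter_upwards [Lp.coeFn_zero ℝ (ENNReal.ofReal q) (volume.restrict Ω),
    Lp.coeFn_zero (Eucl d) (ENNReal.ofReal q) (volume.restrict Ω)] with x h1 h2
  exact (congrArg₂ (ell r) h1 h2).trans (ell_zero_zero r)

/-- The pairs that lie below the energy as linear functionals. As the energy is positively
homogeneous, it is the support function of this set. -/
def dominatedSet (Ω : Set (Eucl d)) (q r : ℝ) [Fact (1 < q)] : Set (DualPair Ω q) :=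
  {p | ∀ (m : Sobolev Ω q) (w : LpV Ω q), (pairing p m w : EReal) ≤ energy r m w}

/-- By homogeneity of the energy, subgradients at `(m, w)` are the dominated functionals whose
value at `(m, w)` is the energy. -/
theorem mem_subdifferential_iff {m : Sobolev Ω q} {w : LpV Ω q} (hfin : energy r m w < ⊤)
    (p : DualPair Ω q) : p ∈ subdifferential r m w ↔
      p ∈ dominatedSet Ω q r ∧ pairing p m w = (energy r m w).toReal := by
  set e := (energy r m w).toReal with he
  have hE : (energy r m w : EReal) = (e : ℝ) := (EReal.coe_ennreal_toReal hfin.ne).symm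
  have hkey : p ∈ subdifferential r m w ↔ ∀ m' w',
      ((e + pairing p m' w' - pairing p m w : ℝ) : EReal) ≤ energy r m' w' := by
    constructor
    · rintro ⟨-, h⟩ m' w'
      have := h m' w'
      rwa [hE, pairing_sub_right, ← EReal.coe_add, ← add_sub_assoc] at this
    · refine fun h => ⟨hfin, fun m' w' => ?_⟩
      rw [hE, pairing_sub_right, ← EReal.coe_add, ← add_sub_assoc]
      exact h m' w'
  rw [hkey]
  constructor
  · intro h
    have h0 := h 0 0
    have h2 := h ((2 : ℝ) • m) ((2 : ℝ) • w)
    have hz : pairing p (0 : Sobolev Ω q) (0 : LpV Ω q) = 0 := by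
      rw [pairing_eq, map_zero, map_zero, add_zero]
    rw [energy_zero, hz] at h0
    have h2E : energy r ((2 : ℝ) • m) ((2 : ℝ) • w) = ENNReal.ofReal (2 * e) := by
      rw [energy_smul two_pos, ENNReal.ofReal_mul two_pos.le, he, ENNReal.ofReal_toReal hfin.ne]
    rw [h2E, pairing_smul_right, EReal.coe_ennreal_ofReal,
      max_eq_left (mul_nonneg two_pos.le ENNReal.toReal_nonneg)] at h2
    have h2' := EReal.coe_le_coe_iff.1 h2
    rw [EReal.coe_ennreal_zero, ← EReal.coe_zero] at h0
    have h0' := EReal.coe_le_coe_iff.1 h0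
    have heq : pairing p m w = e := by linarith
    refine ⟨fun m' w' => ?_, heq⟩
    have := h m' w'
    rwa [heq, add_sub_cancel_left] at this
  · rintro ⟨h, heq⟩ m' w'
    rw [heq, add_sub_cancel_left]
    exact h m' w'

theorem isClosed_dominatedSet : IsClosed (dominatedSet Ω q r) := by
  rw [dominatedSet, Set.ofPred_forall]
  refine isClosed_iInter fun m => ?_
  rw [Set.ofPred_forall]
  refine isClosed_iInter fun w => ?_
  exact isClosed_le (continuous_coe_real_ereal.comp (continuous_pairing m w)) continuous_const

theorem norm_convex_comb_rpow_le {F : Type*} [NormedAddCommGroup F] [NormedSpace ℝ F] {s : ℝ}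
    (hs : 1 ≤ s) {c c' : ℝ} (hc : 0 ≤ c) (hc' : 0 ≤ c') (hcc : c + c' = 1) (b b' : F) :
    ‖c • b + c' • b'‖ ^ s ≤ c * ‖b‖ ^ s + c' * ‖b'‖ ^ s := by
  have h1 : ‖c • b + c' • b'‖ ≤ c * ‖b‖ + c' * ‖b'‖ := by
    refine (norm_add_le _ _).trans ?_
    rw [norm_smul, norm_smul, Real.norm_of_nonneg hc, Real.norm_of_nonneg hc']
  refine (Real.rpow_le_rpow (norm_nonneg _) h1 (by linarith)).trans ?_
  exact (convexOn_rpow hs).2 (norm_nonneg b) (norm_nonneg b') hc hc' hcc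

variable [IsFiniteMeasure (volume.restrict Ω)]

theorem integrable_mul_fn {a : Eucl d → ℝ} (ha : MemLp a ⊤ (volume.restrict Ω))
    (m : Sobolev Ω q) : Integrable (fun x => a x * m.fn x) (volume.restrict Ω) := by
  have := (holderConjugate_conjExponent q).symm.ennrealOfReal
  exact (ha.mono_exponent (p := ENNReal.ofReal q.conjExponent) le_top).integrable_mul
    (Lp.memLp m.fn)

/-- An element of `setA` is dominated, because its value at `(m, w)` is the integral of a function
below the energy density. -/
theorem setA_subset_dominatedSet (hr : 1 < r) :
    setA Ω q r.conjExponent ⊆ dominatedSet Ω q r := by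
  rintro p ⟨a, b, ha, hb, hab, hp1, hp2⟩ m w
  have h1 := integrable_mul_fn ha m
  have h2 := integrable_inner_of_memLp (q := q) (hb.mono_exponent le_top) (Lp.memLp w)
  have h3 : pairing p m w = ∫ x in Ω, (a x * m.fn x + inner ℝ (b x) (w x)) := by
    rw [integral_add h1 h2, pairing, hp1]
    congr 1
    refine integral_congr_ae ?_
    filter_upwards [hp2] with x hx
    rw [hx]
  rw [h3]
  refine coe_integral_le_energy (h1.add h2) ?_
  filter_upwards [hab] with x hx
  exact ofReal_le_ell (Real.HolderConjugate.conjExponent hr) hx _ _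

theorem convex_setA {s : ℝ} (hs : 1 ≤ s) : Convex ℝ (setA Ω q s) := by
  rintro p ⟨a, b, ha, hb, hab, hp1, hp2⟩ p' ⟨a', b', ha', hb', hab', hp1', hp2'⟩ c c' hc hc' hcc
  refine ⟨c • a + c' • a', c • b + c' • b', (ha.const_smul c).add (ha'.const_smul c'),
    (hb.const_smul c).add (hb'.const_smul c'), ?_, fun φ => ?_, ?_⟩
  · filter_upwards [hab, hab'] with x h h'
    have h1 := norm_convex_comb_rpow_le hs hc hc' hcc (b x) (b' x)
    have hs0 : 0 ≤ 1 / s := by positivity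
    have h2 := mul_le_mul_of_nonneg_left h1 hs0
    have h3 := mul_le_mul_of_nonneg_left h hc
    have h4 := mul_le_mul_of_nonneg_left h' hc'
    simp only [Pi.add_apply, Pi.smul_apply, smul_eq_mul]
    nlinarith
  · have e : (c • p + c' • p').1 φ = c * p.1 φ + c' * p'.1 φ := rfl
    rw [e, hp1, hp1', ← integral_const_mul, ← integral_const_mul, ← integral_add
      ((integrable_mul_fn ha φ).const_mul c) ((integrable_mul_fn ha' φ).const_mul c')]
    refine integral_congr_ae (.of_forall fun x => ?_)
    simp only [Pi.add_apply, Pi.smul_apply, smul_eq_mul]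
    ring
  · have e : (c • p + c' • p').2 = c • p.2 + c' • p'.2 := rfl
    rw [e]
    filter_upwards [hp2, hp2', Lp.coeFn_add (c • p.2) (c' • p'.2), Lp.coeFn_smul c p.2,
      Lp.coeFn_smul c' p'.2] with x h1 h2 h3 h4 h5
    rw [h3, Pi.add_apply, h4, h5, Pi.smul_apply, Pi.smul_apply, h1, h2]
    rfl

theorem exists_mem_setA {s : ℝ} {a : Eucl d → ℝ} {b : Eucl d → Eucl d}
    (ha : MemLp a ⊤ (volume.restrict Ω)) (hb : MemLp b ⊤ (volume.restrict Ω))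
    (hab : ∀ᵐ x ∂volume.restrict Ω, a x + 1 / s * ‖b x‖ ^ s ≤ 0) :
    ∃ p ∈ setA Ω q s, ∀ m w,
      pairing p m w = ∫ x in Ω, (a x * m.fn x + inner ℝ (b x) (w x)) := by
  have ha' : MemLp a (ENNReal.ofReal q.conjExponent) (volume.restrict Ω) :=
    ha.mono_exponent le_top
  have hb' : MemLp b (ENNReal.ofReal q.conjExponent) (volume.restrict Ω) :=
    hb.mono_exponent le_top
  have h1 : ∀ φ : Sobolev Ω q, ((pairS Ω q (ha'.toLp a)).comp (Sobolev.fnL Ω q)) φ =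
      ∫ x in Ω, a x * φ.fn x := by
    intro φ
    rw [ContinuousLinearMap.comp_apply, pairS_apply]
    refine integral_congr_ae ?_
    filter_upwards [ha'.coeFn_toLp] with x hx
    rw [hx]
    rfl
  refine ⟨((pairS Ω q (ha'.toLp a)).comp (Sobolev.fnL Ω q), hb'.toLp b),
    ⟨a, b, ha, hb, hab, h1, hb'.coeFn_toLp⟩, fun m w => ?_⟩
  rw [integral_add (integrable_mul_fn ha m) (integrable_inner_of_memLp hb' (Lp.memLp w)),
    pairing, h1]
  congr 1
  refine integral_congr_ae ?_
  filter_upwards [hb'.coeFn_toLp] with x hx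
  rw [hx]

theorem mem_closure_of_forall_strongDual {E F : Type*} [NormedAddCommGroup E] [NormedSpace ℝ E]
    [NormedAddCommGroup F] [NormedSpace ℝ F] {A : Set (StrongDual ℝ E × F)} (hA : Convex ℝ A)
    {p : StrongDual ℝ E × F} (h : ∀ (ξ : StrongDual ℝ (StrongDual ℝ E × F)) (u : ℝ),
      (∀ a ∈ A, ξ a < u) → ξ p ≤ u) : p ∈ closure A := by
  by_contra hp
  obtain ⟨ξ, u, h1, h2⟩ := geometric_hahn_banach_closed_point hA.closure isClosed_closure hp
  exact h2.not_ge (h ξ u fun a ha => h1 a (subset_closure ha))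

/-- The energy is the support function of `setA`, so a bound on `setA` of the functional given by
`(m, w)` bounds the energy. -/
theorem energy_le_of_forall_setA (hr : 1 < r) {m : Sobolev Ω q} {w : LpV Ω q} {u : ℝ}
    (h : ∀ p ∈ setA Ω q r.conjExponent, pairing p m w ≤ u) :
    energy r m w ≤ ENNReal.ofReal u := by
  set g : ℕ → Eucl d → ℝ := fun n x => optDensity r n (m.fn x) (w x) * m.fn x +
    inner ℝ (optField r n (m.fn x) (w x)) (w x) with hg
  have hmw : AEMeasurable (fun x => (m.fn x, w x)) (volume.restrict Ω) :=
    (Lp.aestronglyMeasurable m.fn).aemeasurable.prodMk (Lp.aestronglyMeasurable w).aemeasurable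
  have ha : ∀ n, MemLp (fun x => optDensity r n (m.fn x) (w x)) ⊤ (volume.restrict Ω) := fun n =>
    memLp_top_of_bound ((measurable_optDensity r n).comp_aemeasurable hmw).aestronglyMeasurable _
      (.of_forall fun x => abs_optDensity_le hr n _ _)
  have hb : ∀ n, MemLp (fun x => optField r n (m.fn x) (w x)) ⊤ (volume.restrict Ω) := fun n =>
    memLp_top_of_bound ((measurable_optField r n).comp_aemeasurable hmw).aestronglyMeasurable _
      (.of_forall fun x => norm_optField_le hr n _ _)
  have hgi : ∀ n, Integrable (g n) (volume.restrict Ω) := fun n =>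
    (integrable_mul_fn (ha n) m).add
      (integrable_inner_of_memLp (q := q) ((hb n).mono_exponent le_top) (Lp.memLp w))
  have hgu : ∀ n, ∫⁻ x in Ω, ENNReal.ofReal (g n x) ≤ ENNReal.ofReal u := by
    intro n
    obtain ⟨p, hp, hpm⟩ := exists_mem_setA (q := q) (ha n) (hb n)
      (.of_forall fun x => optDensity_add_le n _ _ hr)
    rw [← ofReal_integral_eq_lintegral_ofReal (hgi n)
      (.of_forall fun x => optDensity_mul_add_nonneg hr n _ _)]
    exact ENNReal.ofReal_le_ofReal (hpm m w ▸ h p hp)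
  calc energy r m w = ∫⁻ x in Ω, liminf (fun n => ENNReal.ofReal (g n x)) atTop :=
        lintegral_congr fun x => (tendsto_optDensity_mul_add hr _ _).liminf_eq.symm
    _ ≤ liminf (fun n => ∫⁻ x in Ω, ENNReal.ofReal (g n x)) atTop :=
        lintegral_liminf_le' fun n => (hgi n).1.aemeasurable.ennreal_ofReal
    _ ≤ ENNReal.ofReal u := liminf_le_of_le (by isBoundedDefault) fun b hb => by
        obtain ⟨n, hn⟩ := hb.exists
        exact hn.trans (hgu n)

theorem dominatedSet_subset_closure (hr : 1 < r) :
    dominatedSet Ω q r ⊆ closure (setA Ω q r.conjExponent) := by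
  intro p hp
  have hr' := (Real.HolderConjugate.conjExponent hr).symm
  refine mem_closure_of_forall_strongDual (E := Sobolev Ω q) (F := LpV Ω q.conjExponent)
    (convex_setA (Ω := Ω) (q := q) hr'.lt.le) fun ξ u h1 => ?_
  have hΩ : volume Ω ≠ ⊤ := by
    simpa using measure_ne_top (volume.restrict Ω) univ
  obtain ⟨m, w, hmw⟩ := exists_eq_pairing hΩ ξ
  obtain ⟨p₀, hp₀, hp₀'⟩ := exists_mem_setA (Ω := Ω) (q := q) (s := r.conjExponent)
    (a := fun _ => 0) (b := fun _ => 0) MemLp.zero MemLp.zero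
    (.of_forall fun x => by simp [Real.zero_rpow hr'.pos.ne'])
  have hu : 0 < u := by
    have := h1 p₀ hp₀
    rw [hmw, hp₀'] at this
    simpa using this
  have h3 := energy_le_of_forall_setA hr (m := m) (w := w) (u := u)
    fun p hp => (hmw p ▸ h1 p hp).le
  have h4 : (pairing p m w : EReal) ≤ (u : ℝ) := by
    refine (hp m w).trans ?_
    have : ((energy r m w : ℝ≥0∞) : EReal) ≤ (ENNReal.ofReal u : ℝ≥0∞) := by exact_mod_cast h3
    rwa [EReal.coe_ennreal_ofReal, max_eq_left hu.le] at this
  rw [hmw]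
  exact EReal.coe_le_coe_iff.1 h4

theorem closure_setA_subset (hr : 1 < r) :
    closure (setA Ω q r.conjExponent) ⊆ dominatedSet Ω q r :=
  closure_minimal (setA_subset_dominatedSet hr) isClosed_dominatedSet

end Polar

/-! ### Pairs of finite energy and dominated functionals -/

section FiniteEnergy

open Filter

variable {Ω : Set (Eucl d)} {q r : ℝ} [Fact (1 < q)]

theorem measurable_ell (r : ℝ) : Measurable fun p : ℝ × Eucl d => ell r p.1 p.2 := by
  unfold ell
  refine Measurable.ite (measurableSet_lt measurable_const measurable_fst) (by fun_prop)
    (Measurable.ite ?_ measurable_const measurable_const)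
  exact (measurableSet_eq_fun measurable_fst measurable_const).inter
    (measurableSet_eq_fun measurable_snd measurable_const)

theorem ell_smul_self {a : ℝ} (ha : 0 ≤ a) (z : Eucl d) :
    ell r a (a • z) = ENNReal.ofReal (a * (1 / r * ‖z‖ ^ r)) := by
  rcases ha.eq_or_lt with rfl | ha
  · simp [ell_zero_zero]
  · rw [ell_of_pos ha, smul_smul, inv_mul_cancel₀ ha.ne', one_smul]

theorem measurableSet_posSet {f : Eucl d → ℝ} (hf : ContinuousOn f (closure Ω)) :
    MeasurableSet (posSet Ω f) := by
  obtain ⟨u, hu, h⟩ := continuousOn_iff'.1 hf (Ioi 0) isOpen_Ioi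
  have : posSet Ω f = u ∩ closure Ω := by
    rw [← h]
    ext x
    exact and_comm
  rw [this]
  exact hu.measurableSet.inter isClosed_closure.measurableSet

theorem IsContRep.aestronglyMeasurable {m : Sobolev Ω q} {f : Eucl d → ℝ} (hf : IsContRep m f) :
    AEStronglyMeasurable f (volume.restrict Ω) :=
  (Lp.aestronglyMeasurable m.fn).congr hf.2

theorem aestronglyMeasurable_velocity {m : Sobolev Ω q} {f : Eucl d → ℝ} (hf : IsContRep m f)
    (w : LpV Ω q) : AEStronglyMeasurable (velocity Ω f w) (volume.restrict Ω) :=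
  (hf.aestronglyMeasurable.aemeasurable.inv.aestronglyMeasurable.smul
    (Lp.aestronglyMeasurable w)).indicator (measurableSet_posSet hf.1)

theorem velocity_of_notMem {f : Eucl d → ℝ} {w : Eucl d → Eucl d} {x : Eucl d}
    (hx : x ∉ posSet Ω f) : velocity Ω f w x = 0 :=
  indicator_of_notMem hx _

/-- Where the energy density is finite, `f` is nonnegative and the momentum `w` is `f • v`. -/
theorem ae_eq_smul_velocity (hopen : IsOpen Ω) {m : Sobolev Ω q} {w : LpV Ω q}
    (hfin : energy r m w < ⊤) {f : Eucl d → ℝ} (hf : IsContRep m f) :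
    ∀ᵐ x ∂volume.restrict Ω, m.fn x = f x ∧ 0 ≤ f x ∧ w x = f x • velocity Ω f w x := by
  have hmw : AEMeasurable (fun x => (m.fn x, w x)) (volume.restrict Ω) :=
    (Lp.aestronglyMeasurable m.fn).aemeasurable.prodMk (Lp.aestronglyMeasurable w).aemeasurable
  have h1 : ∀ᵐ x ∂volume.restrict Ω, ell r (m.fn x) (w x) < ⊤ :=
    ae_lt_top' ((measurable_ell r).comp_aemeasurable hmw) hfin.ne
  filter_upwards [h1, hf.2, ae_restrict_mem hopen.measurableSet] with x hx hfx hxΩ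
  refine ⟨hfx, ?_⟩
  rw [hfx] at hx
  by_cases hpos : 0 < f x
  · refine ⟨hpos.le, ?_⟩
    rw [velocity, indicator_of_mem (show x ∈ posSet Ω f from ⟨subset_closure hxΩ, hpos⟩), smul_smul,
      mul_inv_cancel₀ hpos.ne', one_smul]
  · by_cases h0 : f x = 0 ∧ w x = 0
    · exact ⟨h0.1.ge, by rw [h0.1, h0.2, zero_smul]⟩
    · rw [ell_of_not_pos hpos h0] at hx
      exact absurd hx (lt_irrefl _)

theorem IsContRep.nonneg (hopen : IsOpen Ω) {m : Sobolev Ω q} {w : LpV Ω q}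
    (hfin : energy r m w < ⊤) {f : Eucl d → ℝ} (hf : IsContRep m f) : ∀ x ∈ closure Ω, 0 ≤ f x :=
  nonneg_on_closure_of_ae hopen hf.1
    ((ae_eq_smul_velocity hopen hfin hf).mono fun _ h => h.2.1)

theorem energy_eq (hopen : IsOpen Ω) (hr : 1 < r) {m : Sobolev Ω q} {w : LpV Ω q}
    (hfin : energy r m w < ⊤) {f : Eucl d → ℝ} (hf : IsContRep m f) :
    Integrable (fun x => f x * (1 / r * ‖velocity Ω f w x‖ ^ r)) (volume.restrict Ω) ∧
    (energy r m w).toReal = ∫ x in Ω, f x * (1 / r * ‖velocity Ω f w x‖ ^ r) := by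
  have h := ae_eq_smul_velocity hopen hfin hf
  have h0 : 0 ≤ᵐ[volume.restrict Ω] fun x => f x * (1 / r * ‖velocity Ω f w x‖ ^ r) :=
    h.mono fun x hx => mul_nonneg hx.2.1 (by positivity)
  have hE : energy r m w =
      ∫⁻ x in Ω, ENNReal.ofReal (f x * (1 / r * ‖velocity Ω f w x‖ ^ r)) := by
    refine lintegral_congr_ae ?_
    filter_upwards [h] with x hx
    rw [hx.1, ← ell_smul_self hx.2.1, ← hx.2.2]
  have hm : AEStronglyMeasurable (fun x => f x * (1 / r * ‖velocity Ω f w x‖ ^ r))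
      (volume.restrict Ω) :=
    (hf.aestronglyMeasurable.aemeasurable.mul
      (((aestronglyMeasurable_velocity hf w).aemeasurable.norm.pow_const r).const_mul
        _)).aestronglyMeasurable
  refine ⟨⟨hm, ?_⟩, ?_⟩
  · rw [hasFiniteIntegral_iff_ofReal h0, ← hE]
    exact hfin
  · rw [integral_eq_lintegral_of_nonneg_ae h0 hm, hE]

theorem dominatedSet.apply_nonpos (hr : 1 < r) {p : DualPair Ω q} (hp : p ∈ dominatedSet Ω q r)
    (φ : Sobolev Ω q) (hφ : ∀ᵐ x ∂volume.restrict Ω, 0 ≤ φ.fn x) : p.1 φ ≤ 0 := by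
  have h1 : energy r φ (0 : LpV Ω q) = 0 := by
    rw [energy, lintegral_eq_zero_of_ae_eq_zero]
    filter_upwards [hφ, Lp.coeFn_zero (Eucl d) (ENNReal.ofReal q) (volume.restrict Ω)] with x hx h0
    have h2 := ell_smul_self (r := r) hx (0 : Eucl d)
    rw [smul_zero, norm_zero, Real.zero_rpow (by linarith), mul_zero, mul_zero,
      ENNReal.ofReal_zero] at h2
    exact (congrArg (ell r (φ.fn x)) h0).trans h2
  have h2 := hp φ 0
  rw [h1, pairing_eq, map_zero, add_zero, EReal.coe_ennreal_zero, ← EReal.coe_zero] at h2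
  exact EReal.coe_le_coe_iff.1 h2

/-- The measure on `Ω` with density `‖β‖ ^ s / s`. -/
def powMeasure (Ω : Set (Eucl d)) (s : ℝ) (β : Eucl d → Eucl d) : Measure (Eucl d) :=
  (volume.restrict Ω).withDensity fun x => ENNReal.ofReal (1 / s * ‖β x‖ ^ s)

/-- Integration against a measure with a real density on `Ω`. -/
theorem integral_withDensity_ofReal {g : Eucl d → ℝ} (hg : AEMeasurable g (volume.restrict Ω))
    (hg0 : ∀ x, 0 ≤ g x) (f : Eucl d → ℝ) :
    ∫ x, f x ∂(volume.restrict Ω).withDensity (fun x => ENNReal.ofReal (g x)) =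
      ∫ x in Ω, f x * g x := by
  rw [integral_withDensity_eq_integral_toReal_smul₀ hg.ennreal_ofReal
    (.of_forall fun x => ENNReal.ofReal_lt_top)]
  refine integral_congr_ae (.of_forall fun x => ?_)
  simp only [smul_eq_mul, ENNReal.toReal_ofReal (hg0 x), mul_comm]

variable [IsFiniteMeasure (volume.restrict Ω)]

/-- Testing domination with momenta `φ • z`, where `z` is the field conjugate to a truncation of
`β`, bounds the truncated density `‖β‖ ^ r' / r'`. -/
theorem powMeasure_truncation_le (hbdd : Bornology.IsBounded Ω) (hr : 1 < r) {p : DualPair Ω q}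
    (hp : p ∈ dominatedSet Ω q r) {ν : Measure (Eucl d)} (hν : IsNegIntegral p.1 ν) (N : ℕ) :
    (volume.restrict Ω).withDensity (fun x => ENNReal.ofReal
      ({x | ‖p.2 x‖ ≤ N}.indicator (fun x => 1 / r.conjExponent * ‖p.2 x‖ ^ r.conjExponent) x))
      ≤ ν := by
  have := hν.isFinite
  have hc := Real.HolderConjugate.conjExponent hr
  have hr' := hc.symm.lt
  set s := r.conjExponent with hs
  set β : Eucl d → Eucl d := ⇑p.2 with hβ
  have hβm : Measurable β := (Lp.stronglyMeasurable p.2).measurable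
  set S := {x | ‖β x‖ ≤ N} with hS
  have hSm : MeasurableSet S := measurableSet_le hβm.norm measurable_const
  set z : Eucl d → Eucl d := S.indicator fun x => ‖β x‖ ^ (s - 2) • β x with hz
  set g : Eucl d → ℝ := S.indicator fun x => 1 / s * ‖β x‖ ^ s with hg
  have hzm : Measurable z := ((hβm.norm.pow_const _).smul hβm).indicator hSm
  have hgm : Measurable g := ((hβm.norm.pow_const _).const_mul _).indicator hSm
  have hg0 : ∀ x, 0 ≤ g x := fun x => indicator_nonneg (fun x _ => by positivity) x
  have hgb : ∀ x, ‖g x‖ ≤ 1 / s * (N : ℝ) ^ s := by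
    intro x
    rw [Real.norm_of_nonneg (hg0 x), hg]
    by_cases hx : x ∈ S
    · rw [indicator_of_mem hx]
      have : ‖β x‖ ≤ N := hx
      gcongr
    · rw [indicator_of_notMem hx]
      positivity
  have hzb : ∀ x, ‖z x‖ ≤ (N : ℝ) ^ (s - 1) := by
    intro x
    rw [hz]
    by_cases hx : x ∈ S
    · rw [indicator_of_mem hx, norm_rpow_sub_two_smul hr']
      exact Real.rpow_le_rpow (norm_nonneg _) hx (by linarith)
    · rw [indicator_of_notMem hx, norm_zero]
      positivity
  have hgi : Integrable g (volume.restrict Ω) :=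
    Integrable.of_bound hgm.aestronglyMeasurable _ (.of_forall hgb)
  have hfin : IsFiniteMeasure
      ((volume.restrict Ω).withDensity fun x => ENNReal.ofReal (g x)) :=
    isFiniteMeasure_withDensity_ofReal hgi.2
  -- pointwise, the momentum pairs with `β` to the total of the two Young terms
  have hin : ∀ x, inner ℝ (β x) (z x) = g x + 1 / r * ‖z x‖ ^ r := by
    intro x
    have h1 : (1 : ℝ) / s = 1 - 1 / r := by
      have := hc.inv_add_inv_eq_one
      rw [one_div, one_div]; linarith
    by_cases hx : x ∈ S
    · have e1 : z x = ‖β x‖ ^ (s - 2) • β x := indicator_of_mem hx _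
      have e2 : g x = 1 / s * ‖β x‖ ^ s := indicator_of_mem hx _
      rw [e2, e1, norm_rpow_sub_two_smul_rpow hc.symm, real_inner_comm,
        inner_rpow_sub_two_smul_self hr', h1]
      ring
    · have e1 : z x = 0 := indicator_of_notMem hx _
      have e2 : g x = 0 := indicator_of_notMem hx _
      rw [e1, e2, inner_zero_right, norm_zero, Real.zero_rpow (by linarith)]
      simp
  refine measure_le_of_forall_integral_contDiff_le fun φ hφ hφ01 => ?_
  obtain ⟨m, hm⟩ := exists_sobolev_of_contDiff hbdd q hφ
  have hφz : MemLp (fun x => φ x • z x) (ENNReal.ofReal q) (volume.restrict Ω) := by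
    refine MemLp.of_bound (hφ.continuous.aestronglyMeasurable.smul hzm.aestronglyMeasurable)
      ((N : ℝ) ^ (s - 1)) (.of_forall fun x => ?_)
    rw [norm_smul, Real.norm_of_nonneg (hφ01 x).1]
    exact (mul_le_of_le_one_left (norm_nonneg _) (hφ01 x).2).trans (hzb x)
  have hφb : ∀ x, ‖φ x‖ ≤ 1 := fun x => by
    rw [Real.norm_of_nonneg (hφ01 x).1]; exact (hφ01 x).2
  have hgφ : Integrable (fun x => φ x * g x) (volume.restrict Ω) :=
    hgi.bdd_mul hφ.continuous.aestronglyMeasurable (.of_forall hφb)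
  have hzi : Integrable (fun x => 1 / r * ‖z x‖ ^ r) (volume.restrict Ω) := by
    refine Integrable.of_bound ((hzm.norm.pow_const r).const_mul _).aestronglyMeasurable
      (1 / r * ((N : ℝ) ^ (s - 1)) ^ r) (.of_forall fun x => ?_)
    rw [Real.norm_of_nonneg (by positivity)]
    have := hzb x
    gcongr
  have hzφ : Integrable (fun x => φ x * (1 / r * ‖z x‖ ^ r)) (volume.restrict Ω) :=
    hzi.bdd_mul hφ.continuous.aestronglyMeasurable (.of_forall hφb)
  have hzφ0 : ∀ x, 0 ≤ φ x * (1 / r * ‖z x‖ ^ r) := fun x =>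
    mul_nonneg (hφ01 x).1 (by positivity)
  have hE : energy r m (hφz.toLp _) =
      ENNReal.ofReal (∫ x in Ω, φ x * (1 / r * ‖z x‖ ^ r)) := by
    rw [ofReal_integral_eq_lintegral_ofReal hzφ (.of_forall hzφ0)]
    refine lintegral_congr_ae ?_
    filter_upwards [hm, hφz.coeFn_toLp] with x h1 h2
    rw [h1, h2, ell_smul_self (hφ01 x).1]
  have h1 := hp m (hφz.toLp _)
  rw [hE, EReal.coe_ennreal_ofReal, max_eq_left (integral_nonneg hzφ0)] at h1
  have h2 := EReal.coe_le_coe_iff.1 h1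
  have h3 : ∫ x in Ω, inner ℝ (p.2 x) (hφz.toLp _ x) =
      (∫ x in Ω, φ x * g x) + ∫ x in Ω, φ x * (1 / r * ‖z x‖ ^ r) := by
    rw [← integral_add hgφ hzφ]
    refine integral_congr_ae ?_
    filter_upwards [hφz.coeFn_toLp] with x hx
    rw [hx, real_inner_smul_right]
    show φ x * inner ℝ (β x) (z x) = _
    rw [hin]
    ring
  rw [pairing, hν.apply_eq m φ ⟨hφ.continuous.continuousOn, hm⟩, h3] at h2
  rw [integral_withDensity_ofReal hgm.aemeasurable hg0]
  linarith

theorem powMeasure_le (hbdd : Bornology.IsBounded Ω) (hr : 1 < r) {p : DualPair Ω q}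
    (hp : p ∈ dominatedSet Ω q r) {ν : Measure (Eucl d)} (hν : IsNegIntegral p.1 ν) :
    powMeasure Ω r.conjExponent p.2 ≤ ν := by
  refine Measure.le_iff.2 fun B hB => ?_
  set β : Eucl d → Eucl d := ⇑p.2 with hβ
  have hβm : Measurable β := (Lp.stronglyMeasurable p.2).measurable
  set s := r.conjExponent
  set g : ℕ → Eucl d → ℝ := fun N =>
    {x | ‖β x‖ ≤ N}.indicator (fun x => 1 / s * ‖β x‖ ^ s) with hg
  have hgm : ∀ N, Measurable (g N) := fun N =>
    ((hβm.norm.pow_const _).const_mul _).indicator (measurableSet_le hβm.norm measurable_const)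
  have hlim : ∀ x, Tendsto (fun N => ENNReal.ofReal (g N x)) atTop
      (𝓝 (ENNReal.ofReal (1 / s * ‖β x‖ ^ s))) := by
    intro x
    refine tendsto_const_nhds.congr' ?_
    filter_upwards [tendsto_natCast_atTop_atTop.eventually_ge_atTop ‖β x‖] with N hN
    rw [hg]
    simp only
    rw [indicator_of_mem (show x ∈ {x | ‖β x‖ ≤ N} from hN)]
  have hle : ∀ N, ∫⁻ x in B, ENNReal.ofReal (g N x) ∂(volume.restrict Ω) ≤ ν B := by
    intro N
    rw [← withDensity_apply _ hB]
    exact powMeasure_truncation_le hbdd hr hp hν N B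
  rw [powMeasure, withDensity_apply _ hB]
  calc ∫⁻ x in B, ENNReal.ofReal (1 / s * ‖β x‖ ^ s) ∂(volume.restrict Ω)
      = ∫⁻ x in B, liminf (fun N => ENNReal.ofReal (g N x)) atTop ∂(volume.restrict Ω) :=
        lintegral_congr fun x => (hlim x).liminf_eq.symm
    _ ≤ liminf (fun N => ∫⁻ x in B, ENNReal.ofReal (g N x) ∂(volume.restrict Ω)) atTop :=
        lintegral_liminf_le fun N => (hgm N).ennreal_ofReal
    _ ≤ ν B := liminf_le_of_le (by isBoundedDefault) fun b hb => by
        obtain ⟨n, hn⟩ := hb.exists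
        exact hn.trans (hle n)

end FiniteEnergy

/-! ### Optimality conditions -/

section Contact

open Filter

variable {Ω : Set (Eucl d)} {q r : ℝ} [Fact (1 < q)]

/-- The field `‖v‖ ^ (r - 2) • v` conjugate to the velocity `v`. -/
def dualField (Ω : Set (Eucl d)) (r : ℝ) (f : Eucl d → ℝ) (w : Eucl d → Eucl d) (x : Eucl d) :
    Eucl d :=
  ‖velocity Ω f w x‖ ^ (r - 2) • velocity Ω f w x

theorem dualField_of_notMem {f : Eucl d → ℝ} {w : Eucl d → Eucl d} {x : Eucl d}
    (hx : x ∉ posSet Ω f) : dualField Ω r f w x = 0 := by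
  rw [dualField, velocity_of_notMem hx, smul_zero]

theorem norm_dualField_rpow (hr : 1 < r) (f : Eucl d → ℝ) (w : Eucl d → Eucl d) (x : Eucl d) :
    ‖dualField Ω r f w x‖ ^ r.conjExponent = ‖velocity Ω f w x‖ ^ r :=
  norm_rpow_sub_two_smul_rpow (Real.HolderConjugate.conjExponent hr) _

theorem aestronglyMeasurable_dualField {m : Sobolev Ω q} {f : Eucl d → ℝ} (hf : IsContRep m f)
    (w : LpV Ω q) (r : ℝ) : AEStronglyMeasurable (dualField Ω r f w) (volume.restrict Ω) :=
  (((aestronglyMeasurable_velocity hf w).aemeasurable.norm.pow_const _).smul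
    (aestronglyMeasurable_velocity hf w).aemeasurable).aestronglyMeasurable

theorem IsNegIntegral.ae_mem_closure {α : StrongDual ℝ (Sobolev Ω q)} {ν : Measure (Eucl d)}
    (h : IsNegIntegral α ν) : ∀ᵐ x ∂ν, x ∈ closure Ω := by
  rw [ae_iff]
  exact h.compl_closure

theorem IsNegIntegral.integrable (hbdd : Bornology.IsBounded Ω)
    {α : StrongDual ℝ (Sobolev Ω q)} {ν : Measure (Eucl d)} (h : IsNegIntegral α ν)
    {f : Eucl d → ℝ} (hf : ContinuousOn f (closure Ω)) : Integrable f ν := by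
  have := h.isFinite
  have h1 : IntegrableOn f (closure Ω) ν := hf.integrableOn_compact hbdd.isCompact_closure
  rwa [IntegrableOn, Measure.restrict_eq_self_of_ae_mem h.ae_mem_closure] at h1

/-- If `β` is the dual field on `{m > 0}`, the measure with density `‖β‖ ^ r' / r'` restricts to the
one with density `‖v‖ ^ r / r'`. -/
theorem powMeasure_restrict_posSet {f : Eucl d → ℝ} (hf : ContinuousOn f (closure Ω))
    (hr : 1 < r) {β w : Eucl d → Eucl d}
    (h : ∀ᵐ x ∂volume.restrict Ω, x ∈ posSet Ω f → β x = dualField Ω r f w x) :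
    (powMeasure Ω r.conjExponent β).restrict (posSet Ω f) =
      powMeasure Ω r.conjExponent (dualField Ω r f w) := by
  have hr' := (Real.HolderConjugate.conjExponent hr).symm.pos
  have hm := measurableSet_posSet hf
  rw [powMeasure, restrict_withDensity hm, ← withDensity_indicator hm]
  refine withDensity_congr_ae ?_
  filter_upwards [h] with x hx
  by_cases hxp : x ∈ posSet Ω f
  · rw [indicator_of_mem hxp, hx hxp]
  · rw [indicator_of_notMem hxp, dualField_of_notMem hxp, norm_zero, Real.zero_rpow hr'.ne',
      mul_zero, ENNReal.ofReal_zero]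

theorem integral_powMeasure_dualField (hr : 1 < r) {m : Sobolev Ω q} {f : Eucl d → ℝ}
    (hf : IsContRep m f) (w : LpV Ω q) (g : Eucl d → ℝ) :
    ∫ x, g x ∂powMeasure Ω r.conjExponent (dualField Ω r f w) =
      ∫ x in Ω, g x * (1 / r.conjExponent * ‖velocity Ω f w x‖ ^ r) := by
  have hr' := (Real.HolderConjugate.conjExponent hr).symm.pos
  rw [powMeasure, integral_withDensity_ofReal
    (((aestronglyMeasurable_dualField hf w r).aemeasurable.norm.pow_const _).const_mul _)
    fun x => by positivity]
  simp only [norm_dualField_rpow hr]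

/-- The velocity is in `L^r` when the measure with density `‖v‖ ^ r / r'` is finite. -/
theorem memLp_velocity (hr : 1 < r) {m : Sobolev Ω q} {f : Eucl d → ℝ}
    (hf : IsContRep m f) (w : LpV Ω q)
    (h : IsFiniteMeasure (powMeasure Ω r.conjExponent (dualField Ω r f w))) :
    MemLp (velocity Ω f w) (ENNReal.ofReal r) (volume.restrict Ω) := by
  have hr' := (Real.HolderConjugate.conjExponent hr).symm.pos
  have hv := aestronglyMeasurable_velocity hf w
  rw [← integrable_norm_rpow_iff hv (by simp; linarith) (by simp),
    ENNReal.toReal_ofReal (by linarith)]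
  have h1 := h.measure_univ_lt_top
  rw [powMeasure, withDensity_apply _ MeasurableSet.univ, Measure.restrict_univ] at h1
  simp only [norm_dualField_rpow hr] at h1
  have h2 : Integrable (fun x => 1 / r.conjExponent * ‖velocity Ω f w x‖ ^ r)
      (volume.restrict Ω) :=
    ⟨((hv.aemeasurable.norm.pow_const r).const_mul _).aestronglyMeasurable,
      (hasFiniteIntegral_iff_ofReal (.of_forall fun x => by positivity)).2 h1⟩
  refine (h2.const_mul r.conjExponent).congr (.of_forall fun x => ?_)
  simp only
  field_simp

/-- If `β` is the dual field on `{m > 0}`, then `β · w = m |v| ^ r`. -/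
theorem ae_inner_eq (hopen : IsOpen Ω) (hr : 1 < r) {m : Sobolev Ω q} {w : LpV Ω q}
    (hfin : energy r m w < ⊤) {f : Eucl d → ℝ} (hf : IsContRep m f) {β : Eucl d → Eucl d}
    (h : ∀ᵐ x ∂volume.restrict Ω, x ∈ posSet Ω f → β x = dualField Ω r f w x) :
    ∀ᵐ x ∂volume.restrict Ω, inner ℝ (β x) (w x) = f x * ‖velocity Ω f w x‖ ^ r := by
  filter_upwards [h, ae_eq_smul_velocity hopen hfin hf] with x h1 h2
  rw [h2.2.2, real_inner_smul_right]
  by_cases hx : x ∈ posSet Ω f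
  · rw [h1 hx, dualField, inner_rpow_sub_two_smul_self hr]
  · rw [velocity_of_notMem hx, inner_zero_right, norm_zero, Real.zero_rpow (by linarith)]

/-- Sufficiency of the optimality conditions. -/
theorem pairing_eq_energy_of_restrict_eq (hopen : IsOpen Ω) (hr : 1 < r) {m : Sobolev Ω q}
    {w : LpV Ω q} (hfin : energy r m w < ⊤) {f : Eucl d → ℝ} (hf : IsContRep m f)
    {p : DualPair Ω q} {ν : Measure (Eucl d)} (hν : IsNegIntegral p.1 ν)
    (hβ : ∀ᵐ x ∂volume.restrict Ω, x ∈ posSet Ω f → p.2 x = dualField Ω r f w x)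
    (hνp : ν.restrict (posSet Ω f) = powMeasure Ω r.conjExponent (dualField Ω r f w)) :
    pairing p m w = (energy r m w).toReal := by
  have hc := Real.HolderConjugate.conjExponent hr
  obtain ⟨hi, hE⟩ := energy_eq hopen hr hfin hf
  have hnn := hf.nonneg hopen hfin
  have h1 : ∫ x, f x ∂ν = ∫ x in Ω, f x * (1 / r.conjExponent * ‖velocity Ω f w x‖ ^ r) := by
    rw [← integral_powMeasure_dualField hr hf, ← hνp,
      ← integral_indicator (measurableSet_posSet hf.1)]
    refine hν.integral_congr fun x hx => ?_
    by_cases hxp : x ∈ posSet Ω f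
    · rw [indicator_of_mem hxp]
    · rw [indicator_of_notMem hxp]
      exact le_antisymm (not_lt.1 fun h => hxp ⟨hx, h⟩) (hnn x hx)
  have hi' : Integrable (fun x => f x * ‖velocity Ω f w x‖ ^ r) (volume.restrict Ω) := by
    refine (hi.const_mul r).congr (.of_forall fun x => ?_)
    simp only
    field_simp
  have h2 : 1 / r.conjExponent = 1 - 1 / r := by
    have := hc.inv_add_inv_eq_one
    rw [one_div, one_div]; linarith
  rw [pairing, hν.apply_eq m f hf, h1, integral_congr_ae (ae_inner_eq hopen hr hfin hf hβ), hE,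
    h2]
  have e1 : ∀ c : ℝ, ∫ x in Ω, f x * (c * ‖velocity Ω f w x‖ ^ r) =
      c * ∫ x in Ω, f x * ‖velocity Ω f w x‖ ^ r := by
    intro c
    rw [← integral_const_mul]
    exact integral_congr_ae (.of_forall fun x => by ring)
  rw [e1, e1]
  ring

variable [IsFiniteMeasure (volume.restrict Ω)]

/-- Necessity of the optimality conditions: with `ρ` the measure of density `‖β‖ ^ r' / r'`, which
is at most `ν`, the defect in the equality of pairing and energy is the sum of the nonnegative terms
`∫ m d(ν - ρ)` and `∫ m (‖β‖ ^ r' / r' + ‖v‖ ^ r / r - β · v) dx`. -/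
theorem restrict_eq_of_pairing_eq_energy (hopen : IsOpen Ω) (hbdd : Bornology.IsBounded Ω)
    (hr : 1 < r) {m : Sobolev Ω q} {w : LpV Ω q} (hfin : energy r m w < ⊤) {f : Eucl d → ℝ}
    (hf : IsContRep m f) {p : DualPair Ω q} (hp : p ∈ dominatedSet Ω q r) {ν : Measure (Eucl d)}
    (hν : IsNegIntegral p.1 ν) (heq : pairing p m w = (energy r m w).toReal) :
    (∀ᵐ x ∂volume.restrict Ω, x ∈ posSet Ω f → p.2 x = dualField Ω r f w x) ∧
      ν.restrict (posSet Ω f) = powMeasure Ω r.conjExponent (dualField Ω r f w) := by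
  have hc := Real.HolderConjugate.conjExponent hr
  have hr' := hc.symm.pos
  have := hν.isFinite
  obtain ⟨hEi, hE⟩ := energy_eq hopen hr hfin hf
  have hnn := hf.nonneg hopen hfin
  have hae := ae_eq_smul_velocity hopen hfin hf
  set v := velocity Ω f w with hv
  set s := r.conjExponent with hs
  set β : Eucl d → Eucl d := ⇑p.2 with hβ
  have hβm : Measurable β := (Lp.stronglyMeasurable p.2).measurable
  set ρ := powMeasure Ω s β with hρ
  have hρν : ρ ≤ ν := powMeasure_le hbdd hr hp hν
  have hρfin : IsFiniteMeasure ρ := isFiniteMeasure_of_le ν hρν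
  set κ := ν - ρ with hκ
  have hκρ : κ + ρ = ν := Measure.sub_add_cancel_of_le hρν
  have hκν : κ ≤ ν := Measure.sub_le
  have hfν : Integrable f ν := hν.integrable hbdd hf.1
  have hfρ : Integrable f ρ := hfν.mono_measure hρν
  have hfκ : Integrable f κ := hfν.mono_measure hκν
  have hκae : 0 ≤ᵐ[κ] f := by
    filter_upwards [(Measure.absolutelyContinuous_of_le hκν).ae_le hν.ae_mem_closure] with x hx
      using hnn x hx
  have hsplit : ∫ x, f x ∂ν = ∫ x, f x ∂κ + ∫ x, f x ∂ρ := by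
    rw [← integral_add_measure hfκ hfρ, hκρ]
  have hgm : Measurable fun x => 1 / s * ‖β x‖ ^ s := (hβm.norm.pow_const _).const_mul _
  have hfρi : Integrable (fun x => f x * (1 / s * ‖β x‖ ^ s)) (volume.restrict Ω) := by
    rw [hρ, powMeasure, integrable_withDensity_iff_integrable_smul' hgm.ennreal_ofReal
      (.of_forall fun x => ENNReal.ofReal_lt_top)] at hfρ
    refine hfρ.congr (.of_forall fun x => ?_)
    simp only
    rw [ENNReal.toReal_ofReal (by positivity), smul_eq_mul, mul_comm]
  have hρint : ∫ x, f x ∂ρ = ∫ x in Ω, f x * (1 / s * ‖β x‖ ^ s) :=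
    integral_withDensity_ofReal hgm.aemeasurable (fun x => by positivity) f
  have hwi : Integrable (fun x => inner ℝ (β x) (w x)) (volume.restrict Ω) :=
    integrable_inner_of_memLp (Lp.memLp p.2) (Lp.memLp w)
  set D : Eucl d → ℝ := fun x => f x * (1 / s * ‖β x‖ ^ s) + f x * (1 / r * ‖v x‖ ^ r) -
    inner ℝ (β x) (w x) with hD
  have hDi : Integrable D (volume.restrict Ω) := (hfρi.add hEi).sub hwi
  have hDeq : ∀ᵐ x ∂volume.restrict Ω,
      D x = f x * (1 / s * ‖β x‖ ^ s + 1 / r * ‖v x‖ ^ r - inner ℝ (β x) (v x)) := by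
    filter_upwards [hae] with x hx
    rw [hD]
    simp only
    rw [hx.2.2, real_inner_smul_right]
    ring
  have hD0 : 0 ≤ᵐ[volume.restrict Ω] D := by
    filter_upwards [hDeq, hae] with x hx h2
    rw [hx]
    exact mul_nonneg h2.2.1 (sub_nonneg.2 (inner_le_rpow_add_rpow hc _ _))
  have hDint : ∫ x in Ω, D x = (∫ x, f x ∂ρ) + (energy r m w).toReal -
      ∫ x in Ω, inner ℝ (β x) (w x) := by
    rw [hρint, hE]
    exact (integral_sub (hfρi.add hEi) hwi).trans (congrArg (· - _) (integral_add hfρi hEi))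
  rw [pairing, hν.apply_eq m f hf] at heq
  have hκ0 : 0 ≤ ∫ x, f x ∂κ := integral_nonneg_of_ae hκae
  have hDint0 : 0 ≤ ∫ x in Ω, D x := integral_nonneg_of_ae hD0
  have hsum : (∫ x in Ω, D x) + ∫ x, f x ∂κ = 0 := by
    rw [hDint]
    linarith
  have hDz := (integral_eq_zero_iff_of_nonneg_ae hD0 hDi).1 (by linarith)
  have hκz := (integral_eq_zero_iff_of_nonneg_ae hκae hfκ).1 (by linarith)
  have hβv : ∀ᵐ x ∂volume.restrict Ω, x ∈ posSet Ω f → β x = dualField Ω r f w x := by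
    filter_upwards [hDz, hDeq] with x h1 h2 hx
    rw [h2] at h1
    have h3 := (mul_eq_zero.1 h1).resolve_left hx.2.ne'
    exact eq_of_inner_eq_rpow_add_rpow hc (by linarith)
  refine ⟨hβv, ?_⟩
  have hκp : κ (posSet Ω f) = 0 := by
    refine measure_mono_null (fun x hx => ?_) (ae_iff.1 hκz)
    exact fun h => hx.2.ne' h
  rw [← hκρ, Measure.restrict_add, Measure.restrict_eq_zero.2 hκp, zero_add]
  exact powMeasure_restrict_posSet hf.1 hr hβv

end Contact

/-! ### Existence and characterization of subgradients -/

section Existence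

open Filter

variable {Ω : Set (Eucl d)} {q r : ℝ} [Fact (1 < q)]

/-- Elements of `W^{1,q}(Ω)` are bounded, so an integrable function acts on them. -/
theorem exists_dual_of_integrable {C : ℝ}
    (hC : ∀ φ : Sobolev Ω q, ∀ᵐ x ∂volume.restrict Ω, |φ.fn x| ≤ C * ‖φ‖) {a : Eucl d → ℝ}
    (ha : Integrable a (volume.restrict Ω)) :
    (∀ φ : Sobolev Ω q, Integrable (fun x => a x * φ.fn x) (volume.restrict Ω)) ∧
    ∃ α : StrongDual ℝ (Sobolev Ω q), ∀ φ, α φ = ∫ x in Ω, a x * φ.fn x := by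
  have hi : ∀ φ : Sobolev Ω q, Integrable (fun x => a x * φ.fn x) (volume.restrict Ω) :=
    fun φ => ha.mul_bdd (Lp.aestronglyMeasurable φ.fn) (hC φ)
  refine ⟨hi, LinearMap.mkContinuous
    { toFun := fun φ => ∫ x in Ω, a x * φ.fn x
      map_add' := fun φ ψ => ?_
      map_smul' := fun c φ => ?_ } ((∫ x in Ω, |a x|) * C) fun φ => ?_, fun φ => rfl⟩
  · rw [← integral_add (hi φ) (hi ψ)]
    refine integral_congr_ae ?_
    filter_upwards [Lp.coeFn_add φ.fn ψ.fn] with x hx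
    rw [← mul_add]
    exact congrArg (a x * ·) hx
  · rw [RingHom.id_apply, smul_eq_mul, ← integral_const_mul]
    refine integral_congr_ae ?_
    filter_upwards [Lp.coeFn_smul c φ.fn] with x hx
    rw [mul_left_comm]
    exact congrArg (a x * ·) hx
  · show ‖∫ x in Ω, a x * φ.fn x‖ ≤ _
    rw [mul_assoc, ← integral_mul_const]
    refine norm_integral_le_of_norm_le (ha.abs.mul_const _) ?_
    filter_upwards [hC φ] with x hx
    rw [norm_mul, Real.norm_eq_abs, Real.norm_eq_abs]
    gcongr

variable [IsFiniteMeasure (volume.restrict Ω)]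

/-- The exponents satisfy `q' ≤ r'`, so that the dual field is in `L^{q'}`. -/
theorem memLp_dualField (hr : 1 < r) (hrq : r ≤ q) {m : Sobolev Ω q} {f : Eucl d → ℝ}
    (hf : IsContRep m f) (w : LpV Ω q)
    (hv : MemLp (velocity Ω f w) (ENNReal.ofReal r) (volume.restrict Ω)) :
    MemLp (dualField Ω r f w) (ENNReal.ofReal q.conjExponent) (volume.restrict Ω) := by
  have hr' := (Real.HolderConjugate.conjExponent hr).symm.pos
  have h1 : MemLp (dualField Ω r f w) (ENNReal.ofReal r.conjExponent) (volume.restrict Ω) := by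
    rw [← integrable_norm_rpow_iff (aestronglyMeasurable_dualField hf w r) (by simpa using hr')
      (by simp), ENNReal.toReal_ofReal hr'.le]
    simp only [norm_dualField_rpow hr]
    have := hv.integrable_norm_rpow (by simp; linarith) (by simp)
    rwa [ENNReal.toReal_ofReal (by linarith)] at this
  refine h1.mono_exponent (ENNReal.ofReal_le_ofReal ?_)
  rw [Real.conjExponent, Real.conjExponent, div_le_div_iff₀ (by linarith) (by linarith)]
  linarith

/-- The pair `(-‖v‖ ^ r / r', ‖v‖ ^ (r - 2) • v)` is a subgradient. -/
theorem subdifferential_nonempty (hopen : IsOpen Ω) (hr : 1 < r) (hrq : r ≤ q) {C : ℝ}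
    (hC : ∀ φ : Sobolev Ω q, ∀ᵐ x ∂volume.restrict Ω, |φ.fn x| ≤ C * ‖φ‖)
    {m : Sobolev Ω q} {w : LpV Ω q} (hfin : energy r m w < ⊤) {f : Eucl d → ℝ}
    (hf : IsContRep m f)
    (hv : MemLp (velocity Ω f w) (ENNReal.ofReal r) (volume.restrict Ω)) :
    (subdifferential r m w).Nonempty := by
  have hc := Real.HolderConjugate.conjExponent hr
  set v := velocity Ω f w with hvdef
  set s := r.conjExponent with hs
  have hvr : Integrable (fun x => ‖v x‖ ^ r) (volume.restrict Ω) := by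
    have := hv.integrable_norm_rpow (by simp; linarith) (by simp)
    rwa [ENNReal.toReal_ofReal (by linarith)] at this
  obtain ⟨hai, α, hα⟩ := exists_dual_of_integrable hC (hvr.const_mul (-(1 / s)))
  have hβ := memLp_dualField hr hrq hf w hv
  have hpair : ∀ (m' : Sobolev Ω q) (w' : LpV Ω q), pairing (α, hβ.toLp _) m' w' =
      ∫ x in Ω, (-(1 / s) * ‖v x‖ ^ r * m'.fn x + inner ℝ (dualField Ω r f w x) (w' x)) := by
    intro m' w'
    rw [integral_add (hai m') (integrable_inner_of_memLp hβ (Lp.memLp w')), ← hα, pairing]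
    congr 1
    refine integral_congr_ae ?_
    filter_upwards [hβ.coeFn_toLp] with x hx
    rw [hx]
  refine ⟨(α, hβ.toLp _), (mem_subdifferential_iff hfin _).2 ⟨fun m' w' => ?_, ?_⟩⟩
  · rw [hpair]
    refine coe_integral_le_energy
      ((hai m').add (integrable_inner_of_memLp hβ (Lp.memLp w'))) (.of_forall fun x => ?_)
    refine ofReal_le_ell hc ?_ _ _
    rw [norm_dualField_rpow hr]
    linarith
  · rw [hpair, (energy_eq hopen hr hfin hf).2]
    have h2 : 1 / s = 1 - 1 / r := by
      have := hc.inv_add_inv_eq_one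
      rw [one_div, one_div]; linarith
    refine integral_congr_ae ?_
    filter_upwards [ae_inner_eq hopen hr hfin hf (β := dualField Ω r f w)
      (.of_forall fun _ _ => rfl), hf.2] with x h1 h3
    rw [h1, h2, h3]
    ring

end Existence

section Characterization

variable {Ω : Set (Eucl d)} {q r : ℝ} [Fact (1 < q)]

/-- The restriction of `ν` to `{m > 0}` is determined by its values on the subsets of `{m > 0}`. -/
theorem restrict_posSet_eq_iff (hr : 1 < r) {m : Sobolev Ω q} {f : Eucl d → ℝ}
    (hf : IsContRep m f) (w : LpV Ω q)
    (hv : MemLp (velocity Ω f w) (ENNReal.ofReal r) (volume.restrict Ω))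
    (ν : Measure (Eucl d)) [IsFiniteMeasure ν] :
    ν.restrict (posSet Ω f) = powMeasure Ω r.conjExponent (dualField Ω r f w) ↔
      ∀ B, MeasurableSet B → B ⊆ posSet Ω f → -ν.real B =
        ∫ x in B ∩ Ω, -(1 / r.conjExponent) * ‖velocity Ω f w x‖ ^ r := by
  have hr' := (Real.HolderConjugate.conjExponent hr).symm.pos
  have hm := measurableSet_posSet hf.1
  set P := powMeasure Ω r.conjExponent (dualField Ω r f w) with hP
  have hvr : Integrable (fun x => 1 / r.conjExponent * ‖velocity Ω f w x‖ ^ r)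
      (volume.restrict Ω) := by
    have := hv.integrable_norm_rpow (by simp; linarith) (by simp)
    rw [ENNReal.toReal_ofReal (by linarith)] at this
    exact this.const_mul _
  have hPfin : IsFiniteMeasure P := by
    rw [hP, powMeasure]
    simp only [norm_dualField_rpow hr]
    exact isFiniteMeasure_withDensity_ofReal hvr.2
  have hPB : ∀ B, MeasurableSet B →
      -P.real B = ∫ x in B ∩ Ω, -(1 / r.conjExponent) * ‖velocity Ω f w x‖ ^ r := by
    intro B hB
    have h1 := integral_powMeasure_dualField hr hf w (B.indicator fun _ => (1 : ℝ))
    rw [integral_indicator hB, setIntegral_const, smul_eq_mul, mul_one] at h1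
    rw [hP, h1, ← integral_neg, ← Measure.restrict_restrict hB, ← integral_indicator hB]
    refine integral_congr_ae (.of_forall fun x => ?_)
    by_cases hx : x ∈ B <;> simp [hx]
  have hPp : P (posSet Ω f)ᶜ = 0 := by
    have h1 := powMeasure_restrict_posSet hf.1 hr (β := dualField Ω r f w) (w := w)
      (.of_forall fun _ _ => rfl)
    rw [← hP] at h1
    rw [← h1, Measure.restrict_apply hm.compl, compl_inter_self, measure_empty]
  constructor
  · intro h B hB hBp
    rw [← hPB B hB, ← h, measureReal_restrict_apply hB, inter_eq_self_of_subset_left hBp]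
  · intro h
    refine Measure.ext fun B hB => ?_
    have h1 := h (B ∩ posSet Ω f) (hB.inter hm) inter_subset_right
    rw [← hPB _ (hB.inter hm), neg_inj, measureReal_def, measureReal_def,
      ENNReal.toReal_eq_toReal_iff' (measure_ne_top _ _) (measure_ne_top _ _)] at h1
    rw [Measure.restrict_apply hB, h1, measure_inter_conull hPp]

/-- The singular part of `-ν` does not charge `{m > 0}`, where `ν` has a density. -/
theorem singularPart_neg_apply_eq_zero {ν P : Measure (Eucl d)} [IsFiniteMeasure ν]
    {S : Set (Eucl d)} (hS : MeasurableSet S) (hP : P ≪ volume) (hνP : ν.restrict S = P)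
    {B : Set (Eucl d)} (hB : MeasurableSet B) (hBS : ν (B \ S) = 0) {μ : SignedMeasure (Eucl d)}
    (hμ : ∀ B, MeasurableSet B → μ B = -ν.real B) : μ.singularPart volume B = 0 := by
  have hj : μ.toJordanDecomposition = ⟨0, ν, Measure.MutuallySingular.zero_left⟩ := by
    refine SignedMeasure.toJordanDecomposition_eq ?_
    ext A hA
    rw [hμ A hA, JordanDecomposition.toSignedMeasure, _root_.sub_apply,
      Measure.toSignedMeasure_apply_measurable hA, Measure.toSignedMeasure_apply_measurable hA]
    simp
  have h0 : ν.singularPart volume B = 0 := by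
    refine le_antisymm ?_ zero_le
    calc ν.singularPart volume B
        ≤ ν.singularPart volume (B ∩ S) + ν.singularPart volume (B \ S) :=
          measure_le_inter_add_sdiff _ _ _
      _ ≤ (ν.singularPart volume).restrict S B + ν (B \ S) := by
          rw [Measure.restrict_apply hB]
          gcongr
          exact Measure.singularPart_le _ _
      _ = 0 := by
          rw [hBS, ← Measure.singularPart_restrict _ _ hS, hνP,
            Measure.singularPart_eq_zero_of_ac hP]
          simp
  rw [SignedMeasure.singularPart, _root_.sub_apply,
    Measure.toSignedMeasure_apply_measurable hB, Measure.toSignedMeasure_apply_measurable hB, hj,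
    measureReal_def, measureReal_def, h0]
  simp

end Characterization

end

theorem theorem2p2 {d : ℕ} (hd : 2 ≤ d) (Ω : Set (Eucl d)) (hne : Ω.Nonempty)
    (hopen : IsOpen Ω) (hbdd : Bornology.IsBounded Ω) (hsmooth : HasSmoothBoundary Ω)
    (hball : UniformInteriorBall Ω) (q r : ℝ) [Fact (1 < q)] (hqd : (d : ℝ) < q)
    (hr : 1 < r) (hrq : r ≤ q) (m : Sobolev Ω q) (w : LpV Ω q) (hfin : energy r m w < ⊤) :
    -- `f` is the continuous representative of `m`, and `velocity Ω f w` is `(w / m) 𝟙_{m > 0}`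
    ∃ f : Eucl d → ℝ, IsContRep m f ∧
      (¬ MemLp (velocity Ω f w) (ENNReal.ofReal r) (volume.restrict Ω) → subdifferential r m w = ∅) ∧
      (MemLp (velocity Ω f w) (ENNReal.ofReal r) (volume.restrict Ω) →
        (subdifferential r m w).Nonempty ∧
        subdifferential r m w =
          {p | p ∈ closure (setA Ω q r.conjExponent) ∧
            (∃ μ : SignedMeasure (Eucl d), IsRepresentedBy p.1 μ ∧
              ∀ B, MeasurableSet B → B ⊆ posSet Ω f →
                μ B = ∫ x in B ∩ Ω, -(1 / r.conjExponent) * ‖velocity Ω f w x‖ ^ r) ∧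
            ∀ᵐ x ∂volume.restrict Ω, x ∈ posSet Ω f →
              p.2 x = ‖velocity Ω f w x‖ ^ (r - 2) • velocity Ω f w x} ∧
        ∀ p ∈ subdifferential r m w, ∀ μ : SignedMeasure (Eucl d), IsRepresentedBy p.1 μ →
          ∀ B, MeasurableSet B → Disjoint B (zeroSet Ω f) → μ.singularPart volume B = 0) := by
  obtain ⟨C, hC0, hC⟩ := exists_contRep hopen hbdd hsmooth hqd
  have hrep : ∀ φ : Sobolev Ω q, ∃ f, IsContRep φ f := fun φ =>
    (hC φ).imp fun f hf => hf.1
  have hbound : ∀ φ : Sobolev Ω q, ∀ᵐ x ∂volume.restrict Ω, |φ.fn x| ≤ C * ‖φ‖ := by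
    intro φ
    obtain ⟨f, hf, hfC⟩ := hC φ
    filter_upwards [hf.2, ae_restrict_mem hopen.measurableSet] with x hx hxΩ
    rw [hx]
    exact hfC x (subset_closure hxΩ)
  have : IsFiniteMeasure (volume.restrict Ω) := ⟨by simpa using hbdd.measure_lt_top⟩
  obtain ⟨f, hf⟩ := hrep m
  have hneg : ∀ p ∈ dominatedSet Ω q r, ∃ ν, IsNegIntegral p.1 ν := fun p hp =>
    exists_isNegIntegral hopen hbdd hrep p.1 (dominatedSet.apply_nonpos hr hp)
  have hcond : ∀ p ∈ subdifferential r m w, ∀ ν, IsNegIntegral p.1 ν →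
      (∀ᵐ x ∂volume.restrict Ω, x ∈ posSet Ω f → p.2 x = dualField Ω r f w x) ∧
        ν.restrict (posSet Ω f) = powMeasure Ω r.conjExponent (dualField Ω r f w) := by
    intro p hp ν hν
    obtain ⟨h1, h2⟩ := (mem_subdifferential_iff hfin p).1 hp
    exact restrict_eq_of_pairing_eq_energy hopen hbdd hr hfin hf h1 hν h2
  refine ⟨f, hf, fun hv => ?_, fun hv => ⟨?_, ?_, ?_⟩⟩
  · refine eq_empty_of_forall_notMem fun p hp => hv ?_
    obtain ⟨ν, hν⟩ := hneg p ((mem_subdifferential_iff hfin p).1 hp).1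
    have := hν.isFinite
    refine memLp_velocity hr hf w ?_
    rw [← (hcond p hp ν hν).2]
    infer_instance
  · exact subdifferential_nonempty hopen hr hrq hbound hfin hf hv
  · ext p
    constructor
    · intro hp
      have hdom := ((mem_subdifferential_iff hfin p).1 hp).1
      obtain ⟨ν, hν⟩ := hneg p hdom
      have := hν.isFinite
      obtain ⟨h1, h2⟩ := hcond p hp ν hν
      refine ⟨dominatedSet_subset_closure hr hdom, ⟨_, hν.isRepresentedBy hrep, ?_⟩, h1⟩
      intro B hB hBp
      rw [_root_.neg_apply, Measure.toSignedMeasure_apply_measurable hB]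
      exact (restrict_posSet_eq_iff hr hf w hv ν).1 h2 B hB hBp
    · rintro ⟨h1, ⟨μ, hμ, hμB⟩, h3⟩
      have hdom := closure_setA_subset hr h1
      obtain ⟨ν, hν⟩ := hneg p hdom
      have := hν.isFinite
      refine (mem_subdifferential_iff hfin p).2 ⟨hdom, ?_⟩
      refine pairing_eq_energy_of_restrict_eq hopen hr hfin hf hν h3 ?_
      refine (restrict_posSet_eq_iff hr hf w hv ν).2 fun B hB hBp => ?_
      rw [← hν.eq_of_isRepresentedBy hopen hbdd hμ hB]
      exact hμB B hB hBp
  · intro p hp μ hμ B hB hBz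
    obtain ⟨ν, hν⟩ := hneg p ((mem_subdifferential_iff hfin p).1 hp).1
    have := hν.isFinite
    refine singularPart_neg_apply_eq_zero (measurableSet_posSet hf.1)
      ((withDensity_absolutelyContinuous _ _).trans Measure.restrict_le_self.absolutelyContinuous)
      (hcond p hp ν hν).2 hB ?_ fun A hA => hν.eq_of_isRepresentedBy hopen hbdd hμ hA
    refine measure_mono_null (fun x hx => ?_) hν.compl_closure
    intro hxc
    have h0 := hf.nonneg hopen hfin x hxc
    rcases h0.eq_or_lt with h | h
    · exact disjoint_left.1 hBz hx.1 ⟨hxc, h.symm⟩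
    · exact hx.2 ⟨hxc, h⟩
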